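/- **Theorem (Second recipe theorem for $\mathcal R'$).** A *pinched ribbon graph* is a finite ribbon graph $G$ (orientable or not, possibly disconnected) together with a finite set $\mathfrak f^0(G)$ of half-ribbons, each attached to one vertex and pinched at its free end; graphs are taken up to isomorphism. Write $k(G)$ for the number of connected components, $r(G)=|V(G)|-k(G)$ and $n(G)=|E(G)|-r(G)$. For $A\subseteq E(G)$ let $G_A$ be the cutting spanning subgraph: every edge outside $A$ is cut, leaving a half-ribbon at each of its two ends. Let $F_{\rm int}(A)$ be the number of boundary components of $G_A$ meeting no half-ribbon, $C_\partial(A)$ the number of those meeting a half-ribbon, $f(A)$ the number of half-ribbons of $G_A$, and $t(A)=0$ if $G_A$ is orientable, $t(A)=1$ otherwise; $k(A),r(A),n(A)$ are those of $G_A$. Let $bc(A)=F_{\rm int}(A)+C_\partial(A)$, which is the number of boundary components of the spanning ribbon subgraph with edge set $A$. Put $$R(G;X,Y,Z,W)=\sum_{A\subseteq E(G)}(X-1)^{r(G)-r(A)}(Y-1)^{n(A)}Z^{k(A)-bc(A)+n(A)}W^{t(A)},$$ $$\mathcal R'(G;X,Y,Z,W,T)=\sum_{A\subseteq E(G)}(X-1)^{r(G)-r(A)}(Y-1)^{n(A)}Z^{k(A)-F_{\rm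 int}(A)-C_\partial(A)+n(A)}W^{t(A)}T^{f(A)},$$ both evaluated only at idempotent $W$. Let $\mathcal M$ be a class of pinched ribbon graphs that is minor closed (closed under deleting edges and contracting non-loop edges) and contains all pinched ribbon graphs with exactly two vertices. Let $F$ be a map from $\mathcal M$ to a commutative ring $\mathfrak R$ with unity. A *bouquet* is a pinched ribbon graph with one vertex; every bouquet lies in $\mathcal M$. Let $q$, $r$, $s$ be the values of $F$ on the bouquets without half-ribbons consisting, respectively, of one untwisted loop, one twisted loop, and two interlaced untwisted loops. Let $\alpha,\sigma,\tau\in\mathfrak R$ be units and $x,u,v,T\in\mathfrak R$ elements such that: 1. for all $G\in\mathcal M$, $F(G)=\tau F(G-e)+\sigma F(G/e)$ if $e$ is a regular edge (neither a bridge nor a loop), and $F(G)=xF(G/e)$ if $e$ is a bridge; 2. $F(B_1\sqcup\dots\sqcup B_m)=F(B_1)\cdots F(B_m)$ for all bouquets $B_1,\dots,B_m$ whose disjoint union is in $\mathcal M$, and $\alpha F(B\cdot B')=F(B)F(B')$ for every one-point join $B\cdot B'$ of two bouquets; 3. $F(E)=\alpha^{n}T^{m}$ if $E\in\mathcal M$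 is an edgeless graph with $n$ vertices and $m$ half-ribbons; 4. $(q-\alpha\tau)^2u^2=\alpha(s-2\tau q+\alpha\tau^2)$, $\ (q-\alpha\tau)uv=r-\alpha\tau$, and $v=v^2$. Then for every $G\in\mathcal M$ $$\sigma^{-r(G)}\tau^{-n(G)}F(G)=T^{|\mathfrak f^0(G)|}\,\alpha^{k(G)}R\bigl(G;\sigma^{-1}x,\ \alpha^{-1}\tau^{-1}q,\ u,\ v\bigr),$$ and for every unit $t\in\mathfrak R$ (in particular $t=T$, if $T$ is a unit) $$\alpha^{k(G)}R\bigl(G;\sigma^{-1}x,\alpha^{-1}\tau^{-1}q,u,v\bigr)=t^{-(|\mathfrak f^0(G)|+2n(G))}\alpha^{k(G)}\mathcal R'\bigl(G;\sigma^{-1}[(x-\sigma)t^{-2}+\sigma],\ t^{2}\alpha^{-1}\tau^{-1}q-t^{2}+1,\ u,\ v,\ t\bigr).$$ -/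

import Mathlib

/-! ### Pinched ribbon graphs, encoded by flags

Every ribbon end or half-ribbon end attached to a vertex disc contributes two flags, the two end
points of the segment along which it is attached.  A flag `f` has

* `corner f`: the other end of the free arc of the vertex boundary that starts at `f`;
* `side f`: the other end point of the attaching segment of `f`;
* `strand f`: for a ribbon edge, the flag reached along the strand of the ribbon that starts at
  `f`; for a half-ribbon, whose free segment is pinched, the boundary curve runs round the
  half-ribbon and comes back at `side f`.

So `f` belongs to a half-ribbon iff `strand f = side f`.  The vertices carrying at least one flag
are the orbits of `corner` and `side`; `Bare` is the set of vertices carrying nothing.  No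
orientability is required: a ribbon may be twisted. -/

/-- A finite ribbon graph with half-ribbons, all of them pinched. -/
structure PinchedRibbonGraph where
  Bare : Type
  Flag : Type
  finite_bare : Finite Bare
  finite_flag : Finite Flag
  corner : Flag → Flag
  side : Flag → Flag
  strand : Flag → Flag
  corner_corner : ∀ f, corner (corner f) = f
  side_side : ∀ f, side (side f) = f
  strand_strand : ∀ f, strand (strand f) = f
  corner_ne : ∀ f, corner f ≠ f
  side_ne : ∀ f, side f ≠ f
  strand_ne : ∀ f, strand f ≠ f
  strand_side : ∀ f, strand (side f) = side (strand f)

namespace PinchedRibbonGraph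

attribute [instance] finite_bare finite_flag

/-- Two pinched ribbon graphs are isomorphic (homeomorphic as ribbon graphs; orientations of the
vertex discs need not be respected). -/
def Iso (G H : PinchedRibbonGraph) : Prop :=
  Nonempty (G.Bare ≃ H.Bare) ∧
    ∃ φ : G.Flag ≃ H.Flag, ∀ f, φ (G.corner f) = H.corner (φ f) ∧
      φ (G.side f) = H.side (φ f) ∧ φ (G.strand f) = H.strand (φ f)

section Basic

variable (G : PinchedRibbonGraph)

/-- The vertices: the bare ones, and the orbits of flags under `corner` and `side`. -/
def Vertex : Type :=
  G.Bare ⊕ Quot (fun f g : G.Flag => g = G.corner f ∨ g = G.side f)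

/-- The vertex at which a flag sits. -/
def vertexOf (f : G.Flag) : G.Vertex := Sum.inr (Quot.mk _ f)

/-- The connected components. -/
def Component : Type :=
  G.Bare ⊕ Quot (fun f g : G.Flag => g = G.corner f ∨ g = G.side f ∨ g = G.strand f)

/-- The boundary components carrying flags, as orbits under `corner` and `strand`. -/
def FlagBoundary : Type := Quot (fun f g : G.Flag => g = G.corner f ∨ g = G.strand f)

/-- The flag belongs to a half-ribbon. -/
def IsHalf (f : G.Flag) : Prop := G.strand f = G.side f

/-- The ribbon edges: sets of four flags `{f, side f, strand f, side (strand f)}`. -/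
def Edge : Type :=
  {D : Set G.Flag // ∃ f, ¬ G.IsHalf f ∧ D = {f, G.side f, G.strand f, G.side (G.strand f)}}

/-- The half-ribbons: pairs of flags. -/
def HalfRibbon : Type := {D : Set G.Flag // ∃ f, G.IsHalf f ∧ D = {f, G.side f}}

instance : Finite G.Edge := by unfold Edge; infer_instance

noncomputable instance : Fintype G.Edge := Fintype.ofFinite _

/-- The number of vertices. -/
noncomputable def numVertices : ℕ := Nat.card G.Vertex

/-- The number of ribbon edges. -/
noncomputable def numEdges : ℕ := Nat.card G.Edge

/-- The number of half-ribbons. -/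
noncomputable def numHalf : ℕ := Nat.card G.HalfRibbon

/-- The number of connected components. -/
noncomputable def numComponents : ℕ := Nat.card G.Component

/-- The rank: vertices minus components. -/
noncomputable def rank : ℕ := G.numVertices - G.numComponents

/-- The nullity: edges minus rank. -/
noncomputable def nullity : ℕ := G.numEdges - G.rank

/-- The number of closed faces: boundary components that meet no half-ribbon.  A bare vertex is a
disc, whose boundary is one closed face. -/
noncomputable def numClosedFaces : ℕ :=
  Nat.card (G.Bare ⊕ {b : G.FlagBoundary // ∀ f, Quot.mk _ f = b → ¬ G.IsHalf f})

/-- The number of connected components of the boundary graph.  The boundary graph has the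
half-ribbons as vertices (of valence two) and the open faces as edges, so its components are the
boundary components that meet some half-ribbon. -/
noncomputable def numBoundaryGraphComponents : ℕ :=
  Nat.card {b : G.FlagBoundary // ∃ f, Quot.mk _ f = b ∧ G.IsHalf f}

/-- The number of boundary components of the underlying surface. -/
noncomputable def numBoundaryComponents : ℕ := Nat.card (G.Bare ⊕ G.FlagBoundary)

/-- Orientability: the two end points of each arc, of each attaching segment and of each strand
can be given opposite signs. -/
def Orientable : Prop :=
  ∃ ε : G.Flag → Bool, ∀ f, ε (G.corner f) ≠ ε f ∧ ε (G.side f) ≠ ε f ∧ ε (G.strand f) ≠ ε f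

open Classical in
/-- The orientability parameter: `0` if orientable, `1` otherwise. -/
noncomputable def nonorientability : ℕ := if G.Orientable then 0 else 1

/-- A bouquet: exactly one vertex. -/
def IsBouquet : Prop := G.numVertices = 1

/-- No ribbon edges (half-ribbons are allowed). -/
def Edgeless : Prop := IsEmpty G.Edge

end Basic

section Cut

variable (G : PinchedRibbonGraph)

/-- The set of flags of the edges in `A`. -/
def flagsOf (A : Finset G.Edge) : Set G.Flag := {f | ∃ d ∈ A, f ∈ d.1}

theorem edge_side {d : G.Edge} {f : G.Flag} (hf : f ∈ d.1) : G.side f ∈ d.1 := by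
  obtain ⟨D, f₀, h₀, rfl⟩ := d
  have h1 := G.side_side
  simp only [Set.mem_insert_iff, Set.mem_singleton_iff] at *
  grind

theorem edge_strand {d : G.Edge} {f : G.Flag} (hf : f ∈ d.1) : G.strand f ∈ d.1 := by
  obtain ⟨D, f₀, h₀, rfl⟩ := d
  have h1 := G.strand_strand
  have h2 := G.strand_side
  simp only [Set.mem_insert_iff, Set.mem_singleton_iff] at *
  grind

theorem flagsOf_side (A : Finset G.Edge) (f : G.Flag) :
    G.side f ∈ G.flagsOf A ↔ f ∈ G.flagsOf A := by
  constructor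
  · rintro ⟨d, hd, h⟩
    exact ⟨d, hd, by simpa only [G.side_side] using G.edge_side h⟩
  · rintro ⟨d, hd, h⟩
    exact ⟨d, hd, G.edge_side h⟩

theorem flagsOf_strand (A : Finset G.Edge) (f : G.Flag) :
    G.strand f ∈ G.flagsOf A ↔ f ∈ G.flagsOf A := by
  constructor
  · rintro ⟨d, hd, h⟩
    exact ⟨d, hd, by simpa only [G.strand_strand] using G.edge_strand h⟩
  · rintro ⟨d, hd, h⟩
    exact ⟨d, hd, G.edge_strand h⟩

open Classical in
/-- The cutting spanning subgraph with edge set `A`: all vertices and half-ribbons are kept, and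
every edge outside `A` is cut, which leaves two half-ribbons in its place. -/
noncomputable def cutSpanning (A : Finset G.Edge) : PinchedRibbonGraph where
  Bare := G.Bare
  Flag := G.Flag
  finite_bare := G.finite_bare
  finite_flag := G.finite_flag
  corner := G.corner
  side := G.side
  strand f := if f ∈ G.flagsOf A then G.strand f else G.side f
  corner_corner := G.corner_corner
  side_side := G.side_side
  strand_strand f := by
    have h1 := G.flagsOf_side A f
    have h2 := G.flagsOf_strand A f
    have h3 := G.side_side f
    have h4 := G.strand_strand f
    grind
  corner_ne := G.corner_ne
  side_ne := G.side_ne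
  strand_ne f := by
    have h1 := G.side_ne f
    have h2 := G.strand_ne f
    grind
  strand_side f := by
    have h1 := G.flagsOf_side A f
    have h2 := G.strand_side f
    grind

end Cut

/-! ### The polynomials, as functions of their arguments in a commutative ring -/

/-- The Bollobás–Riordan polynomial
`R_G = ∑_A (X-1)^(r(G)-r(A)) (Y-1)^(n(A)) Z^(k(A)-bc(A)+n(A)) W^(t(A))`, summed over the spanning
ribbon subgraphs `A` of the ribbon graph underlying `G`, where `bc` counts boundary components.
Half-ribbons play no role: a boundary curve that runs round a pinched half-ribbon is the boundary
curve that ignores it, so `bc` may be counted on the cutting spanning subgraph.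
The exponent of `Z` is the Euler genus of `A`, hence the truncated subtraction is exact.  With
respect to `W` the polynomial is taken modulo `W² = W`, so it is to be evaluated at idempotents. -/
noncomputable def brPoly {K : Type*} [CommRing K] (G : PinchedRibbonGraph) (X Y Z W : K) : K :=
  ∑ A : Finset G.Edge,
    (X - 1) ^ (G.rank - (G.cutSpanning A).rank) * (Y - 1) ^ (G.cutSpanning A).nullity *
      Z ^ ((G.cutSpanning A).numComponents + (G.cutSpanning A).nullity
            - (G.cutSpanning A).numBoundaryComponents) *
      W ^ (G.cutSpanning A).nonorientability

/-- The polynomial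
`R'_G = ∑_A (X-1)^(r(G)-r(A)) (Y-1)^(n(A)) Z^(k(A)-F_int(A)+n(A)-C_∂(A)) W^(t(A)) T^(f(A))`, summed
over the cutting spanning subgraphs `A`; it arises from the six-variable polynomial of ribbon graphs
with half-ribbons by setting its variable `S`, whose exponent is `C_∂(A)`, to `Z⁻¹`. -/
noncomputable def brPolyPinched {K : Type*} [CommRing K] (G : PinchedRibbonGraph)
    (X Y Z W T : K) : K :=
  ∑ A : Finset G.Edge,
    (X - 1) ^ (G.rank - (G.cutSpanning A).rank) * (Y - 1) ^ (G.cutSpanning A).nullity *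
      Z ^ ((G.cutSpanning A).numComponents + (G.cutSpanning A).nullity
            - ((G.cutSpanning A).numClosedFaces
                + (G.cutSpanning A).numBoundaryGraphComponents)) *
      W ^ (G.cutSpanning A).nonorientability * T ^ (G.cutSpanning A).numHalf

/-! ### Deletion and contraction of an edge -/

open Classical in
/-- First-return map to the complement of `D`: start at `g`, go along `c`, and as long as the flag
reached lies in `D`, cross by `x` and go along `c` again.  For sets `D` of the form
`{a, x a, b, x b}` at most two rounds are needed. -/
noncomputable def bypass {F : Type} (c x : F → F) (D : Set F) (g : F) : F :=
  let skip : F → F := fun h => if h ∈ D then c (x h) else h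
  skip (skip (c g))

theorem bypass_notMem {F : Type} {c x : F → F} {D : Set F} (hc : ∀ g, c (c g) = g)
    (hx : ∀ g, x (x g) = g) (hc' : ∀ g, c g ≠ g) (hx' : ∀ g, x g ≠ g) (a b : F)
    (hD : ∀ g, g ∈ D ↔ g = a ∨ g = x a ∨ g = b ∨ g = x b)
    {g : F} (hg : g ∉ D) : bypass c x D g ∉ D := by
  simp only [bypass]
  grind

theorem bypass_ne {F : Type} {c x : F → F} {D : Set F} (hc : ∀ g, c (c g) = g)
    (hx : ∀ g, x (x g) = g) (hc' : ∀ g, c g ≠ g) (hx' : ∀ g, x g ≠ g) (g : F) :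
    bypass c x D g ≠ g := by
  simp only [bypass]
  grind

theorem bypass_bypass {F : Type} {c x : F → F} {D : Set F} (hc : ∀ g, c (c g) = g)
    (hx : ∀ g, x (x g) = g) (hD : ∀ g, g ∈ D → x g ∈ D) {g : F} (hg : g ∉ D)
    (hg' : bypass c x D g ∉ D) : bypass c x D (bypass c x D g) = g := by
  simp only [bypass] at *
  grind

section Minor

variable (G : PinchedRibbonGraph)

theorem edge_side_notMem {d : G.Edge} {f : G.Flag} (hf : f ∉ d.1) : G.side f ∉ d.1 :=
  fun h => hf (by simpa only [G.side_side] using G.edge_side h)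

theorem edge_strand_notMem {d : G.Edge} {f : G.Flag} (hf : f ∉ d.1) : G.strand f ∉ d.1 :=
  fun h => hf (by simpa only [G.strand_strand] using G.edge_strand h)

/-- Common part of deletion and contraction: drop the flags of `d` and let the vertex boundaries
pass the places where the ribbon `d` was attached by means of `x`. -/
noncomputable def removeEdge (d : G.Edge) (x : G.Flag → G.Flag) (B : Type) (hB : Finite B)
    (hx : ∀ f, x (x f) = f) (hx' : ∀ f, x f ≠ f)
    (hd : ∃ a b, ∀ g, g ∈ d.1 ↔ g = a ∨ g = x a ∨ g = b ∨ g = x b) : PinchedRibbonGraph where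
  Bare := B
  Flag := {f : G.Flag // f ∉ d.1}
  finite_bare := hB
  finite_flag := inferInstance
  corner f := ⟨bypass G.corner x d.1 f.1, by
    obtain ⟨a, b, h⟩ := hd
    exact bypass_notMem G.corner_corner hx G.corner_ne hx' a b h f.2⟩
  side f := ⟨G.side f.1, G.edge_side_notMem f.2⟩
  strand f := ⟨G.strand f.1, G.edge_strand_notMem f.2⟩
  corner_corner f := by
    obtain ⟨a, b, h⟩ := hd
    refine Subtype.ext (bypass_bypass G.corner_corner hx ?_ f.2
      (bypass_notMem G.corner_corner hx G.corner_ne hx' a b h f.2))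
    intro g hg
    rw [h] at hg ⊢
    rcases hg with rfl | rfl | rfl | rfl <;> simp [hx]
  side_side f := Subtype.ext (G.side_side f.1)
  strand_strand f := Subtype.ext (G.strand_strand f.1)
  corner_ne f h := bypass_ne G.corner_corner hx G.corner_ne hx' f.1 (congrArg Subtype.val h)
  side_ne f h := G.side_ne f.1 (congrArg Subtype.val h)
  strand_ne f h := G.strand_ne f.1 (congrArg Subtype.val h)
  strand_side f := Subtype.ext (G.strand_side f.1)

/-- Deletion `G - d`: the ribbon is removed.  The vertices are unchanged; a vertex becomes bare if
all of its flags belong to `d`. -/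
noncomputable def delete (d : G.Edge) : PinchedRibbonGraph :=
  G.removeEdge d G.side
    (G.Bare ⊕ {q : Quot (fun f g : G.Flag => g = G.corner f ∨ g = G.side f) //
      ∀ f, Quot.mk _ f = q → f ∈ d.1})
    inferInstance G.side_side G.side_ne (by
      obtain ⟨D, f, h, rfl⟩ := d
      exact ⟨f, G.strand f, fun g => by simp⟩)

open Classical in
/-- The boundary of the region obtained by gluing the ribbon `d` to its end vertices: at a flag of
`d` follow the strand, at any other flag pass the attaching segment. -/
noncomputable def crossing (d : G.Edge) (f : G.Flag) : G.Flag :=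
  if f ∈ d.1 then G.strand f else G.side f

/-- Contraction `G / d`: the ribbon `d` and its end vertices are replaced by discs bounded by the
boundary curves of their union.  If `d` is not a loop this merges its two end vertices into one.  A
new vertex is bare if its boundary curve meets only flags of `d`. -/
noncomputable def contract (d : G.Edge) : PinchedRibbonGraph :=
  G.removeEdge d (G.crossing d)
    (G.Bare ⊕ {q : Quot (fun f g : G.Flag => g = G.corner f ∨ g = G.crossing d f) //
      ∀ f, Quot.mk _ f = q → f ∈ d.1})
    inferInstance
    (fun f => by
      have h1 := G.side_side f
      have h2 := G.strand_strand f
      have h3 := @edge_strand G d f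
      have h4 := @edge_side_notMem G d f
      simp only [crossing]
      grind)
    (fun f => by
      have h1 := G.side_ne f
      have h2 := G.strand_ne f
      simp only [crossing]
      grind)
    (by
      obtain ⟨D, f, h, rfl⟩ := d
      refine ⟨f, G.side f, fun g => ?_⟩
      simp only [crossing, Set.mem_insert_iff, Set.mem_singleton_iff, true_or, or_true, if_true,
        G.strand_side]
      tauto)

/-- A loop: all flags of the edge sit at the same vertex. -/
def IsLoop (d : G.Edge) : Prop := ∀ f ∈ d.1, ∀ g ∈ d.1, G.vertexOf f = G.vertexOf g

/-- A bridge: its removal disconnects a component. -/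
def IsBridge (d : G.Edge) : Prop := G.numComponents < (G.delete d).numComponents

/-- A regular edge: neither a bridge nor a loop. -/
def IsRegular (d : G.Edge) : Prop := ¬ G.IsBridge d ∧ ¬ G.IsLoop d

end Minor

/-- A class of pinched ribbon graphs closed under isomorphism, deletion of edges, and contraction of
edges that are not loops.  (Conventions that also allow the contraction of loops or the deletion of
vertices give fewer minor closed classes.) -/
structure MinorClosed (M : Set PinchedRibbonGraph) : Prop where
  iso : ∀ G H, G ∈ M → Iso G H → H ∈ M
  delete : ∀ G ∈ M, ∀ d : G.Edge, G.delete d ∈ M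
  contract : ∀ G ∈ M, ∀ d : G.Edge, ¬ G.IsLoop d → G.contract d ∈ M

/-! ### Disjoint unions and one-point joins -/

/-- The disjoint union of finitely many pinched ribbon graphs. -/
def disjointUnion {n : ℕ} (B : Fin n → PinchedRibbonGraph) : PinchedRibbonGraph where
  Bare := Σ i, (B i).Bare
  Flag := Σ i, (B i).Flag
  finite_bare := inferInstance
  finite_flag := inferInstance
  corner f := ⟨f.1, (B f.1).corner f.2⟩
  side f := ⟨f.1, (B f.1).side f.2⟩
  strand f := ⟨f.1, (B f.1).strand f.2⟩
  corner_corner f := by simp [corner_corner]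
  side_side f := by simp [side_side]
  strand_strand f := by simp [strand_strand]
  corner_ne f h := (B f.1).corner_ne f.2 (eq_of_heq (Sigma.mk.inj h).2)
  side_ne f h := (B f.1).side_ne f.2 (eq_of_heq (Sigma.mk.inj h).2)
  strand_ne f h := (B f.1).strand_ne f.2 (eq_of_heq (Sigma.mk.inj h).2)
  strand_side f := by simp [strand_side]

open Classical in
/-- The one-point join of `G` and `H` along the arc of `G` from `a` to `corner a` and the arc of `H`
from `b` to `corner b`: the two vertex discs carrying these arcs are merged there, so that the two
arcs become arcs from `a` to `b` and from `corner a` to `corner b`.  (The arc of `H` may be read in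
either direction, as `b` can be replaced by `corner b`.) -/
noncomputable def join (G H : PinchedRibbonGraph) (a : G.Flag) (b : H.Flag) :
    PinchedRibbonGraph where
  Bare := G.Bare ⊕ H.Bare
  Flag := G.Flag ⊕ H.Flag
  finite_bare := inferInstance
  finite_flag := inferInstance
  corner := Sum.elim
    (fun g => if g = a then Sum.inr b else if g = G.corner a then Sum.inr (H.corner b)
      else Sum.inl (G.corner g))
    (fun h => if h = b then Sum.inl a else if h = H.corner b then Sum.inl (G.corner a)
      else Sum.inr (H.corner h))
  side := Sum.map G.side H.side
  strand := Sum.map G.strand H.strand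
  corner_corner f := by
    have h1 := G.corner_corner
    have h2 := H.corner_corner
    have h3 := G.corner_ne
    have h4 := H.corner_ne
    rcases f with f | f <;> simp only [Sum.elim_inl, Sum.elim_inr] <;> grind
  side_side f := by rcases f with f | f <;> simp [side_side]
  strand_strand f := by rcases f with f | f <;> simp [strand_strand]
  corner_ne f := by
    have h3 := G.corner_ne
    have h4 := H.corner_ne
    rcases f with f | f <;> simp only [Sum.elim_inl, Sum.elim_inr] <;> grind
  side_ne f := by rcases f with f | f <;> simp [side_ne]
  strand_ne f := by rcases f with f | f <;> simp [strand_ne]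
  strand_side f := by rcases f with f | f <;> simp [strand_side]

/-! ### Chord diagrams -/

/-- The bouquet of a signed chord diagram with `m + 2` end points `0, 1, …, m + 1` in this cyclic
order on a circle, where `π` matches the two ends of each chord and `tw p` says whether the chord at
`p` is twisted (negative).  The flags `(p, false)` and `(p, true)` are the first and the second end
point of the segment at `p`; the strands of an untwisted ribbon join first to second end points,
those of a twisted ribbon join first to first and second to second. -/
def chordDiagram (m : ℕ) (π : Fin (m + 2) → Fin (m + 2)) (tw : Fin (m + 2) → Bool)
    (hπ : ∀ p, π (π p) = p) (hne : ∀ p, π p ≠ p) (htw : ∀ p, tw (π p) = tw p) :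
    PinchedRibbonGraph where
  Bare := Empty
  Flag := Fin (m + 2) × Bool
  finite_bare := inferInstance
  finite_flag := inferInstance
  corner f := if f.2 then (f.1 + 1, false) else (f.1 - 1, true)
  side f := (f.1, !f.2)
  strand f := (π f.1, xor (!f.2) (tw f.1))
  corner_corner f := by rcases f with ⟨p, _ | _⟩ <;> simp
  side_side f := by simp
  strand_strand f := by
    rcases f with ⟨p, b⟩
    simp only [hπ, htw]
    cases b <;> cases tw p <;> rfl
  corner_ne f h := by rcases f with ⟨p, _ | _⟩ <;> simp at h
  side_ne f h := by rcases f with ⟨p, _ | _⟩ <;> simp at h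
  strand_ne f h := hne f.1 (congrArg Prod.fst h)
  strand_side f := by
    rcases f with ⟨p, b⟩
    cases b <;> cases tw p <;> simp

/-- One positive chord. -/
def positiveChord : PinchedRibbonGraph :=
  chordDiagram 0 (fun p => p + 1) (fun _ => false) (by decide) (by decide) (by decide)

/-- One negative (twisted) chord. -/
def negativeChord : PinchedRibbonGraph :=
  chordDiagram 0 (fun p => p + 1) (fun _ => true) (by decide) (by decide) (by decide)

/-- Two intersecting positive chords. -/
def crossedChords : PinchedRibbonGraph :=
  chordDiagram 2 (fun p => p + 2) (fun _ => false) (by decide) (by decide) (by decide)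

end PinchedRibbonGraph

/-! Let `phi` be σ^r τ^n T^|f⁰| α^k R, with R taken at the arguments of the theorem. The first
identity says that F = `phi` on the class. It is proved by checking that `phi` obeys every rule
imposed on F, and that these rules determine F.

`phi` obeys the rules. In the sum over edge sets, those avoiding a regular edge e give R(G-e) and
those containing it give R(G/e). If e is a bridge, adding e to a set changes only the exponent of
X-1, by one, so a factor X comes out. Nullity and Euler genus add up over disjoint unions and joins
of bouquets. The orientability parameter does not add, but idempotence of W repairs this. Condition
4 says exactly that `phi` and F agree on the twisted loop and on two interlaced loops. All this
rests on counting orbits of pairs of involutions on flags: `card_quot_switch_add_one` and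
`card_quot_switch_le` for adding a ribbon, `card_quot_bypass` for removing one.

The rules determine F, by induction on the number of flags. A non-loop edge is removed by deletion
and contraction. If all edges are loops, the graph is a disjoint union of bouquets. For a bouquet B,
split the vertex in two, joined by a new edge e, so that B = G/e for a graph G with two vertices. If
an edge d of B now also joins the two vertices, F(G) can be expanded along e and along d:
τF(G-e)+σF(B) = τF(G-d)+σF(G/d). Both deletions have as many flags as B but still contain a
non-loop, so they reduce to smaller graphs. As σ is a unit, the claim for B follows from the claim
for G/d (`good_of_slidesTo`). Passing from B to G/d slides a stretch of ribbon ends along a ribbon.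

Such slides bring a bouquet to a form that is a join or one of three explicit bouquets. A
half-ribbon splits off at once. A twisted ribbon can be exchanged for one whose ends are neighbours.
If nothing is twisted, two slides produce two interlaced ribbons with four consecutive ends. Each of
these occupies a stretch of the boundary left by only two arcs (`Pocket`), hence is a join factor
(`Pocket.iso_join`), unless it is the whole bouquet.

The second identity holds term by term. Cutting an edge creates two half-ribbons, so f(A)+2n(A) =
|f⁰|+2n(G)+2(r(G)-r(A)), and the powers of t cancel. -/

namespace PinchedRibbonGraph

/-! ### Classes of flags under involutions -/

section Classes

variable {F : Type}

/-- Equality in `Quot r` is used throughout as connectedness under `r`, so no equivalence relation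
has to be built. -/
theorem conn_of_le {r r' : F → F → Prop} (h : ∀ y z, r y z → Quot.mk r' y = Quot.mk r' z)
    {y z : F} (hyz : Quot.mk r y = Quot.mk r z) : Quot.mk r' y = Quot.mk r' z :=
  congrArg (Quot.lift (Quot.mk r') h) hyz

theorem mem_iff_of_conn {r : F → F → Prop} {C : Set F} (h : ∀ y z, r y z → (y ∈ C ↔ z ∈ C))
    {y z : F} (hyz : Quot.mk r y = Quot.mk r z) : y ∈ C ↔ z ∈ C :=
  iff_of_eq (congrArg (Quot.lift (· ∈ C) fun y z hr => propext (h y z hr)) hyz)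

theorem card_quot_congr {r r' : F → F → Prop} (h : ∀ y z, r y z → Quot.mk r' y = Quot.mk r' z)
    (h' : ∀ y z, r' y z → Quot.mk r y = Quot.mk r z) : Nat.card (Quot r) = Nat.card (Quot r') :=
  Nat.card_congr
    { toFun := Quot.lift (Quot.mk r') h
      invFun := Quot.lift (Quot.mk r) h'
      left_inv := by rintro ⟨y⟩; rfl
      right_inv := by rintro ⟨y⟩; rfl }

theorem card_quot_le [Finite F] {r r' : F → F → Prop}
    (h : ∀ y z, r y z → Quot.mk r' y = Quot.mk r' z) : Nat.card (Quot r') ≤ Nat.card (Quot r) :=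
  Nat.card_le_card_of_surjective (Quot.lift (Quot.mk r') h)
    (by rintro ⟨y⟩; exact ⟨Quot.mk r y, rfl⟩)

theorem card_quot_adjoin_eq {r : F → F → Prop} {p q : F} (h : Quot.mk r p = Quot.mk r q) :
    Nat.card (Quot fun y z => r y z ∨ y = p ∧ z = q) = Nat.card (Quot r) :=
  card_quot_congr (by rintro y z (hr | ⟨rfl, rfl⟩); exacts [Quot.sound hr, h])
    fun y z hr => Quot.sound (Or.inl hr)

open Classical in
-- One new connection between two classes merges them and touches nothing else. The bijection sends
-- `none` to the class of `q` that disappears.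
theorem card_quot_adjoin_add_one [Finite F] {r : F → F → Prop} {p q : F}
    (h : Quot.mk r p ≠ Quot.mk r q) :
    Nat.card (Quot fun y z => r y z ∨ y = p ∧ z = q) + 1 = Nat.card (Quot r) := by
  rw [← Finite.card_option]
  let r' : F → F → Prop := fun y z => r y z ∨ y = p ∧ z = q
  -- The merged class is represented by the old class of `p`.
  let g : F → Quot r := fun y => if Quot.mk r y = Quot.mk r q then Quot.mk r p else Quot.mk r y
  have hg : ∀ y z, r' y z → g y = g z := by
    rintro y z (hr | ⟨rfl, rfl⟩)
    · have : Quot.mk r y = Quot.mk r z := Quot.sound hr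
      simp only [g, this]
    · simp [g]
  have hi : ∀ y, Quot.mk r y ≠ Quot.mk r q → g y = Quot.mk r y := fun y hy => by simp [g, hy]
  refine Nat.card_congr
    { toFun := fun o => o.elim (Quot.mk r q) (Quot.lift g hg)
      invFun := fun c => if c = Quot.mk r q then none
        else some (Quot.lift (Quot.mk r') (fun y z hr => Quot.sound (Or.inl hr)) c)
      left_inv := ?_
      right_inv := ?_ }
  · rintro (_ | y)
    · simp
    · induction y using Quot.ind with | _ y
      by_cases hy : Quot.mk r y = Quot.mk r q
      · have h1 : g y = Quot.mk r p := by simp [g, hy]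
        have h2 : Quot.mk r' y = Quot.mk r' q :=
          conn_of_le (fun y z hr => Quot.sound (Or.inl hr)) hy
        have h3 : Quot.mk r' p = Quot.mk r' q := Quot.sound (Or.inr ⟨rfl, rfl⟩)
        simp only [Option.elim_some, h1, h, if_false]
        exact congrArg some (h3.trans h2.symm)
      · simp only [Option.elim_some, hi y hy, hy, if_false]
        rfl
  · rintro ⟨y⟩
    by_cases hy : Quot.mk r y = Quot.mk r q
    · simp [hy]
    · simp [hy]
      exact hi y hy

theorem card_quot_le_adjoin_add_one [Finite F] (r : F → F → Prop) (p q : F) :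
    Nat.card (Quot r) ≤ Nat.card (Quot fun y z => r y z ∨ y = p ∧ z = q) + 1 := by
  by_cases h : Quot.mk r p = Quot.mk r q
  · rw [card_quot_adjoin_eq h]; omega
  · rw [card_quot_adjoin_add_one h]

end Classes

/-! ### Parity arguments -/

section Parity

variable {F : Type} [Finite F]

theorem even_ncard_of_involution {g : F → F} {C : Set F} (hg : ∀ y, g (g y) = y)
    (hg' : ∀ y, g y ≠ y) (hC : ∀ y ∈ C, g y ∈ C) : Even C.ncard := by
  classical
  have := Fintype.ofFinite F
  have h : ∑ _y ∈ C.toFinset, (1 : ZMod 2) = 0 :=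
    Finset.sum_involution (fun y _ => g y) (fun _ _ => by decide) (fun y _ _ => hg' y)
      (fun y hy => by simpa using hC y (by simpa using hy)) (fun y _ => hg y)
  rw [Set.ncard_eq_toFinset_card', ← ZMod.natCast_eq_zero_iff_even]
  simpa using h

/-- A path cannot have a single end. `c` pairs off `C`, so `C` is even. If `s p` were outside, `s`
would pair off `C` without `p`, and `C` would be odd. -/
theorem apply_mem_of_involution {c s : F → F} (hc : ∀ y, c (c y) = y) (hc' : ∀ y, c y ≠ y)
    (hs : ∀ y, s (s y) = y) (hs' : ∀ y, s y ≠ y) {C : Set F} {p : F} (hp : p ∈ C)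
    (h : ∀ y ∈ C, c y ∈ C) (h' : ∀ y ∈ C, y ≠ p → y ≠ s p → s y ∈ C) : s p ∈ C := by
  by_contra hsp
  have h1 := even_ncard_of_involution hc hc' h
  have h2 : Even (C \ {p}).ncard := by
    refine even_ncard_of_involution hs hs' ?_
    rintro y ⟨hy, hyp⟩
    have hyp' : y ≠ p := hyp
    have h3 : y ≠ s p := by rintro rfl; exact hsp hy
    refine ⟨h' y hy hyp' h3, ?_⟩
    intro (h4 : s y = p)
    exact h3 (by rw [← h4, hs])
  have h3 := Set.ncard_sdiff_singleton_add_one hp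
  rw [← h3] at h1
  exact (Nat.even_add_one.1 h1) h2

/-- Signed version of the parity argument. Read the colours as ±1: pairing by `c` makes the total
over `C` zero, and so does pairing by `s` away from `p` and `s p`. Hence these two cancel as well.
-/
theorem flip_of_involution {c s : F → F} (hc : ∀ y, c (c y) = y) (hc' : ∀ y, c y ≠ y)
    (hs : ∀ y, s (s y) = y) (hs' : ∀ y, s y ≠ y) {C : Set F} {p : F} (hp : p ∈ C)
    (hcC : ∀ y ∈ C, c y ∈ C) (hsC : ∀ y ∈ C, s y ∈ C) {ε : F → Bool}
    (h : ∀ y ∈ C, ε (c y) ≠ ε y) (h' : ∀ y ∈ C, y ≠ p → y ≠ s p → ε (s y) ≠ ε y) :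
    ε (s p) ≠ ε p := by
  classical
  have := Fintype.ofFinite F
  let g : F → ℤ := fun y => if ε y then 1 else -1
  have hg : ∀ y z, ε z ≠ ε y → g y + g z = 0 := by
    intro y z hyz
    cases hy : ε y <;> cases hz : ε z <;> simp_all [g]
  have hg' : ∀ y, g y ≠ 0 := by intro y; simp only [g]; split_ifs <;> decide
  have h1 : ∑ y ∈ C.toFinset, g y = 0 :=
    Finset.sum_involution (fun y _ => c y) (fun y hy => hg _ _ (h y (by simpa using hy)))
      (fun y _ _ => hc' y) (fun y hy => by simpa using hcC y (by simpa using hy)) (fun y _ => hc y)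
  have h2 : ∑ y ∈ (C.toFinset.erase p).erase (s p), g y = 0 := by
    refine Finset.sum_involution (fun y _ => s y) ?_ (fun y _ _ => hs' y) ?_ (fun y _ => hs y)
    · intro y hy
      simp only [Finset.mem_erase, Set.mem_toFinset] at hy
      exact hg _ _ (h' y hy.2.2 hy.2.1 hy.1)
    · intro y hy
      simp only [Finset.mem_erase, Set.mem_toFinset] at hy ⊢
      refine ⟨fun e => hy.2.1 ?_, fun e => hy.1 ?_, hsC y hy.2.2⟩
      · rw [← hs y, e, hs]
      · rw [← hs y, e]
  rw [← Finset.add_sum_erase _ _ (Set.mem_toFinset.2 hp), ← Finset.add_sum_erase _ g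
    (Finset.mem_erase.2 ⟨hs' p, Set.mem_toFinset.2 (hsC p hp)⟩), h2] at h1
  intro e
  have : g (s p) = g p := by simp only [g, e]
  have := hg' p
  omega

end Parity

/-! ### Two-colourings -/

/-- Orbits of two fixed-point-free involutions are alternating cycles or infinite lines, so they can
be coloured alternately. The two colours in an orbit are the two cycles of the product `ρ`. -/
theorem exists_two_colouring {F : Type} {c s : F → F} (hc : ∀ y, c (c y) = y)
    (hc' : ∀ y, c y ≠ y) (hs : ∀ y, s (s y) = y) (hs' : ∀ y, s y ≠ y) :
    ∃ ε : F → Bool, ∀ y, ε (c y) ≠ ε y ∧ ε (s y) ≠ ε y := by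
  classical
  let ρ : Equiv.Perm F :=
    { toFun := fun y => c (s y)
      invFun := fun y => s (c y)
      left_inv := fun y => by simp only [hc, hs]
      right_inv := fun y => by simp only [hc, hs] }
  have hρ : ∀ y, ρ y = c (s y) := fun y => rfl
  have hρ' : ∀ y, ρ⁻¹ y = s (c y) := fun y => rfl
  have hpow : ∀ (n : ℕ) y, s ((ρ ^ n) y) = (ρ⁻¹ ^ n) (s y) := by
    intro n
    induction n with
    | zero => intro y; simp
    | succ n ih =>
      intro y
      rw [pow_succ', pow_succ', Equiv.Perm.mul_apply, Equiv.Perm.mul_apply, ← ih, hρ, hρ']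
  have hzpow : ∀ (n : ℤ) y, s ((ρ ^ n) y) = (ρ ^ (-n)) (s y) := by
    intro n y
    obtain ⟨m, rfl | rfl⟩ := n.eq_nat_or_neg
    · simpa using hpow m y
    · have h1 := hpow m ((ρ ^ (-(m : ℤ))) y)
      rw [← zpow_natCast, ← Equiv.Perm.mul_apply, ← zpow_add, add_neg_cancel, zpow_zero,
        Equiv.Perm.one_apply] at h1
      rw [h1, neg_neg, zpow_natCast, ← Equiv.Perm.mul_apply, inv_pow, mul_inv_cancel,
        Equiv.Perm.one_apply]
  -- `s` conjugates `ρ` to its inverse. If `ρ ^ n` took `y` to `s y`, the midpoint of this run would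
  -- be a fixed point of `s` for even `n`, of `c` for odd `n`.
  have hns : ∀ y, ¬ ρ.SameCycle y (s y) := by
    rintro y ⟨n, hn⟩
    obtain ⟨j, rfl | rfl⟩ := Int.even_or_odd' n
    · apply hs' ((ρ ^ j) y)
      rw [hzpow, ← hn, ← Equiv.Perm.mul_apply, ← zpow_add]
      congr 2; ring
    · apply hc' (s ((ρ ^ j) y))
      rw [← hρ, hzpow, ← hn, ← Equiv.Perm.mul_apply, ← Equiv.Perm.mul_apply, ← zpow_add,
        ← zpow_one_add]
      congr 2
      ring
  have hsc : ∀ y z, ρ.SameCycle y z → ρ.SameCycle (s y) (s z) := by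
    rintro y z ⟨n, rfl⟩
    exact ⟨-n, (hzpow n y).symm⟩
  have hcs : ∀ y, ρ.SameCycle (s y) (c y) := fun y => ⟨1, by simp [hρ, hs]⟩
  let r : F → F → Prop := fun y z => z = c y ∨ z = s y
  have hr : ∀ y z, Quot.mk r y = Quot.mk r z → ρ.SameCycle y z ∨ ρ.SameCycle (s y) z := by
    intro y z h
    refine (mem_iff_of_conn (C := {z | ρ.SameCycle y z ∨ ρ.SameCycle (s y) z}) ?_ h).1
      (Or.inl (Equiv.Perm.SameCycle.refl _ _))
    have key : ∀ a, (ρ.SameCycle y a ∨ ρ.SameCycle (s y) a) →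
        (ρ.SameCycle y (s a) ∨ ρ.SameCycle (s y) (s a)) := by
      rintro a (h | h)
      · exact Or.inr (hsc _ _ h)
      · left; simpa [hs] using hsc _ _ h
    have key' : ∀ a, (ρ.SameCycle y a ∨ ρ.SameCycle (s y) a) →
        (ρ.SameCycle y (c a) ∨ ρ.SameCycle (s y) (c a)) := fun a ha =>
      (key a ha).imp (·.trans (hcs a)) (·.trans (hcs a))
    rintro a b (rfl | rfl)
    · exact ⟨key' a, fun h => by simpa only [Set.mem_ofPred_eq, hc] using key' _ h⟩
    · exact ⟨key a, fun h => by simpa only [Set.mem_ofPred_eq, hs] using key _ h⟩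
  -- A base point in each orbit; the colour tells whether a flag lies on the `ρ`-cycle of its base
  -- point.
  let w : F → F := fun y => (Quot.mk r y).out
  have hw : ∀ y, Quot.mk r (w y) = Quot.mk r y := fun y => Quot.out_eq _
  refine ⟨fun y => decide (ρ.SameCycle (w y) y), fun y => ?_⟩
  have h1 : w (s y) = w y := congrArg Quot.out (Quot.sound (Or.inr rfl) : Quot.mk r y = _).symm
  have h2 : w (c y) = w y := congrArg Quot.out (Quot.sound (Or.inl rfl) : Quot.mk r y = _).symm
  have h3 : ρ.SameCycle (w y) (s y) ↔ ¬ ρ.SameCycle (w y) y := by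
    constructor
    · intro h h'
      exact hns y (h'.symm.trans h)
    · intro h
      rcases hr _ _ (hw y) with h' | h'
      · exact absurd h' h
      · simpa [hs] using hsc _ _ h'
  have h4 : ρ.SameCycle (w y) (c y) ↔ ρ.SameCycle (w y) (s y) :=
    ⟨fun h => h.trans (hcs y).symm, fun h => h.trans (hcs y)⟩
  simp only [h1, h2, ne_eq, decide_eq_decide, h4, h3]
  tauto

/-! ### Switching two pairs of an involution -/

section Switch

variable {F : Type} [Finite F] {c t t' : F → F} {p q : F}

/-- Two cycles, each cut at one `t`-pair and reconnected crosswise, become one cycle. It is used for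
boundary curves when a ribbon is added, and for vertex boundaries and boundary curves in a join. -/
theorem card_quot_switch_add_one (hc : ∀ y, c (c y) = y) (hc' : ∀ y, c y ≠ y)
    (ht : ∀ y, t (t y) = y) (ht0 : ∀ y, t y ≠ y)
    (ht2 : ∀ y, t' (t' y) = y) (hp : t' p = q) (hp' : t' (t p) = t q)
    (ht' : ∀ y, y ≠ p → y ≠ t p → y ≠ q → y ≠ t q → t' y = t y)
    (h : Quot.mk (fun y z => z = c y ∨ z = t y) p ≠ Quot.mk _ q) :
    Nat.card (Quot fun y z => z = c y ∨ z = t' y) + 1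
      = Nat.card (Quot fun y z => z = c y ∨ z = t y) := by
  rw [← card_quot_adjoin_add_one h]
  congr 1
  set r : F → F → Prop := fun y z => z = c y ∨ z = t y with hr
  set r' : F → F → Prop := fun y z => z = c y ∨ z = t' y with hr'
  -- The relation that `t` and `t'` have in common: the four switched flags keep only their
  -- `c`-neighbours.
  let r₀ : F → F → Prop := fun y z =>
    z = c y ∨ z = t y ∧ y ≠ p ∧ y ≠ t p ∧ y ≠ q ∧ y ≠ t q
  have h0 : ∀ y z, r₀ y z → Quot.mk r y = Quot.mk r z := by
    rintro y z (rfl | ⟨rfl, -⟩)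
    exacts [Quot.sound (Or.inl rfl), Quot.sound (Or.inr rfl)]
  have h0' : ∀ y z, r₀ y z → Quot.mk r' y = Quot.mk r' z := by
    rintro y z (rfl | ⟨rfl, h1, h2, h3, h4⟩)
    · exact Quot.sound (Or.inl rfl)
    · exact Quot.sound (Or.inr (ht' y h1 h2 h3 h4).symm)
  have hq : Quot.mk r q = Quot.mk r (t q) := Quot.sound (Or.inr rfl)
  -- The cycle of `p` opened at the pair `p`, `t p` is still connected, by parity: the other opened
  -- pair lies in another class.
  have key : Quot.mk r₀ (t p) = Quot.mk r₀ p := by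
    refine apply_mem_of_involution (C := {y | Quot.mk r₀ y = Quot.mk r₀ p}) hc hc' ht ht0 rfl ?_ ?_
    · intro y hy
      exact (Quot.sound (Or.inl rfl) : Quot.mk r₀ y = Quot.mk r₀ (c y)).symm.trans hy
    · intro y hy h1 h2
      have h3 := conn_of_le h0 hy
      refine (Quot.sound (Or.inr ⟨rfl, h1, h2, ?_, ?_⟩) :
        Quot.mk r₀ y = Quot.mk r₀ (t y)).symm.trans hy
      · rintro rfl; exact h h3.symm
      · rintro rfl; exact h (h3.symm.trans hq.symm)
  have hpq : Quot.mk r' p = Quot.mk r' q := Quot.sound (Or.inr hp.symm)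
  have hpq' : Quot.mk r' (t p) = Quot.mk r' (t q) := Quot.sound (Or.inr hp'.symm)
  have hpp : Quot.mk r' (t p) = Quot.mk r' p := conn_of_le h0' key
  refine card_quot_congr ?_ ?_
  · have hle : ∀ {y z}, Quot.mk r y = Quot.mk r z →
        Quot.mk (fun y z => r y z ∨ y = p ∧ z = q) y = Quot.mk _ z :=
      fun h => conn_of_le (fun _ _ hr => Quot.sound (Or.inl hr)) h
    have e1 : Quot.mk (fun y z => r y z ∨ y = p ∧ z = q) p = Quot.mk _ q :=
      Quot.sound (Or.inr ⟨rfl, rfl⟩)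
    have e2 := hle hq
    have e3 : Quot.mk (fun y z => r y z ∨ y = p ∧ z = q) p = Quot.mk _ (t p) :=
      hle (Quot.sound (Or.inr rfl))
    rintro y z (rfl | rfl)
    · exact hle (Quot.sound (Or.inl rfl))
    · by_cases h1 : y = p
      · subst h1; rw [hp]; exact e1
      by_cases h2 : y = t p
      · subst h2; rw [hp']; exact (e3.symm.trans e1).trans e2
      by_cases h3 : y = q
      · subst h3; rw [← hp, ht2]; exact (hp ▸ e1).symm
      by_cases h4 : y = t q
      · subst h4; rw [← hp', ht2, hp']; exact ((e3.symm.trans e1).trans e2).symm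
      · rw [ht' y h1 h2 h3 h4]; exact hle (Quot.sound (Or.inr rfl))
  · rintro y z ((rfl | rfl) | ⟨rfl, rfl⟩)
    · exact Quot.sound (Or.inl rfl)
    · by_cases h1 : y = p
      · subst h1; exact hpp.symm
      by_cases h2 : y = t p
      · subst h2; rw [ht]; exact hpp
      by_cases h3 : y = q
      · subst h3; exact hpq.symm.trans (hpp.symm.trans hpq')
      by_cases h4 : y = t q
      · subst h4; rw [ht]; exact (hpq.symm.trans (hpp.symm.trans hpq')).symm
      · exact Quot.sound (Or.inr (ht' y h1 h2 h3 h4).symm)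
    · exact hpq

/-- Adjoining `p ~ q` to the old relation or `p ~ t p` to the new one gives the same classes, since
either way all four flags are connected. A single adjoined pair merges at most two classes. -/
theorem card_quot_switch_le (ht : ∀ y, t (t y) = y)
    (ht2 : ∀ y, t' (t' y) = y) (hp : t' p = q) (hp' : t' (t p) = t q)
    (ht' : ∀ y, y ≠ p → y ≠ t p → y ≠ q → y ≠ t q → t' y = t y) :
    Nat.card (Quot fun y z => z = c y ∨ z = t' y)
      ≤ Nat.card (Quot fun y z => z = c y ∨ z = t y) + 1 := by
  have key : ∀ (r : F → F → Prop), (Quot.mk r p = Quot.mk r q) → Quot.mk r p = Quot.mk r (t p) →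
      Quot.mk r q = Quot.mk r (t q) → ∀ y,
      (Quot.mk r y = Quot.mk r (t y) ∨ Quot.mk r y = Quot.mk r (t' y)) →
      Quot.mk r y = Quot.mk r (t y) ∧ Quot.mk r y = Quot.mk r (t' y) := by
    intro r h1 h2 h3 y hy
    by_cases e1 : y = p
    · grind
    by_cases e2 : y = t p
    · grind
    by_cases e3 : y = q
    · grind
    by_cases e4 : y = t q
    · grind
    · grind
  let r : F → F → Prop := fun y z => (z = c y ∨ z = t y) ∨ y = p ∧ z = q
  let r' : F → F → Prop := fun y z => (z = c y ∨ z = t' y) ∨ y = p ∧ z = t p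
  have h1 : ∀ y, Quot.mk r y = Quot.mk r (t y) := fun y => Quot.sound (Or.inl (Or.inr rfl))
  have h2 : Quot.mk r p = Quot.mk r q := Quot.sound (Or.inr ⟨rfl, rfl⟩)
  have h1' : ∀ y, Quot.mk r' y = Quot.mk r' (t' y) := fun y => Quot.sound (Or.inl (Or.inr rfl))
  have h2' : Quot.mk r' p = Quot.mk r' (t p) := Quot.sound (Or.inr ⟨rfl, rfl⟩)
  have h3' : Quot.mk r' p = Quot.mk r' q := hp ▸ h1' p
  have h4' : Quot.mk r' q = Quot.mk r' (t q) :=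
    h3'.symm.trans (h2'.trans ((h1' (t p)).trans (congrArg _ hp')))
  have e : Nat.card (Quot r) = Nat.card (Quot r') := by
    refine card_quot_congr ?_ ?_
    · rintro y z ((rfl | rfl) | ⟨rfl, rfl⟩)
      · exact Quot.sound (Or.inl (Or.inl rfl))
      · exact (key r' h3' h2' h4' y (Or.inr (h1' y))).1
      · exact h3'
    · rintro y z ((rfl | rfl) | ⟨rfl, rfl⟩)
      · exact Quot.sound (Or.inl (Or.inl rfl))
      · exact (key r h2 (h1 _) (h1 _) y (Or.inl (h1 y))).2
      · exact h1 _
  calc Nat.card (Quot fun y z => z = c y ∨ z = t' y) ≤ Nat.card (Quot r') + 1 :=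
        card_quot_le_adjoin_add_one _ _ _
    _ = Nat.card (Quot r) + 1 := by rw [e]
    _ ≤ _ := Nat.add_le_add_right (card_quot_le fun _ _ hr => Quot.sound (Or.inl hr)) 1

end Switch

/-! ### Bypassing a set of flags -/

section Bypass

variable {F : Type} {c x : F → F} {D : Set F} {a b : F} {R : F → F → Prop}

theorem bypass_of_notMem {y : F} (h : c y ∉ D) : bypass c x D y = c y := by
  simp [bypass, h]

theorem bypass_of_mem {y : F} (h : c y ∈ D) (h' : c (x (c y)) ∉ D) :
    bypass c x D y = c (x (c y)) := by
  simp [bypass, h, h']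

/-- A walk still in `D` after the two rounds never leaves it: its orbit under `c` and `x` consists
of one `x`-pair or of all of `D`. -/
theorem bypass_mem_closed (hc : ∀ g, c (c g) = g) (hx : ∀ g, x (x g) = g) (hc' : ∀ g, c g ≠ g)
    (hx' : ∀ g, x g ≠ g) (hD : ∀ g, g ∈ D ↔ g = a ∨ g = x a ∨ g = b ∨ g = x b) {y : F}
    (hy : y ∈ D) (hy' : bypass c x D y ∈ D) :
    (c y ∈ D ∧ bypass c x D (c y) ∈ D) ∧ (x y ∈ D ∧ bypass c x D (x y) ∈ D) := by
  have h1 : c y ∈ D := by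
    by_contra h
    exact h (bypass_of_notMem h ▸ hy')
  have h2 : x y ∈ D := by grind
  by_cases h : c y = x y
  · have h3 : c (x y) = y := by rw [← h, hc]
    simp only [bypass]
    grind
  · have h3 : ∀ g ∈ D, g = y ∨ g = x y ∨ g = c y ∨ g = x (c y) := by grind
    have h4 : c (x (c y)) ∈ D := by
      by_contra h4
      exact h4 (bypass_of_mem h1 h4 ▸ hy')
    have h5 : c (x (c y)) = x y := by grind
    have h6 : c (x y) = x (c y) := by grind
    simp only [bypass]
    grind

theorem bypass_corner (hc : ∀ g, c (c g) = g) (hx : ∀ g, x (x g) = g) (hc' : ∀ g, c g ≠ g)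
    (hx' : ∀ g, x g ≠ g) (hD : ∀ g, g ∈ D ↔ g = a ∨ g = x a ∨ g = b ∨ g = x b) {y : F}
    (hy : y ∈ D) (hcy : c y ∈ D) (hy' : bypass c x D y ∉ D) :
    bypass c x D (c y) = bypass c x D (bypass c x D y) := by
  simp only [bypass] at *
  grind

theorem bypass_cross (hc : ∀ g, c (c g) = g) (hx : ∀ g, x (x g) = g) (hc' : ∀ g, c g ≠ g)
    (hx' : ∀ g, x g ≠ g) (hD : ∀ g, g ∈ D ↔ g = a ∨ g = x a ∨ g = b ∨ g = x b) {y : F}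
    (hy : y ∈ D) (hy' : bypass c x D y ∉ D) :
    bypass c x D (x y) = bypass c x D (bypass c x D y) := by
  simp only [bypass] at *
  grind

open Classical in
theorem conn_bypass (hR' : ∀ y ∈ D, R y (x y)) (y : F) :
    Quot.mk (fun y z => z = c y ∨ R y z) y = Quot.mk _ (bypass c x D y) := by
  have h1 : ∀ y, Quot.mk (fun y z => z = c y ∨ R y z) y = Quot.mk _ (c y) :=
    fun y => Quot.sound (Or.inl rfl)
  have h2 : ∀ y, Quot.mk (fun y z => z = c y ∨ R y z) y
      = Quot.mk _ (if y ∈ D then c (x y) else y) := by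
    intro y
    split_ifs with h
    · exact (Quot.sound (r := fun y z => z = c y ∨ R y z) (Or.inr (hR' y h))).trans (h1 _)
    · rfl
  exact (h1 y).trans ((h2 _).trans (h2 _))

open Classical in
-- The common counting lemma for deletion and contraction. `R` collects all connections other than
-- `c`, and on `D` it must be exactly `x`. Taking first returns outside `D` keeps every class except
-- those contained in `D`, and these are the new bare vertices.
theorem card_quot_bypass [Finite F] (hc : ∀ g, c (c g) = g) (hx : ∀ g, x (x g) = g)
    (hc' : ∀ g, c g ≠ g) (hx' : ∀ g, x g ≠ g)
    (hD : ∀ g, g ∈ D ↔ g = a ∨ g = x a ∨ g = b ∨ g = x b)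
    (hR : ∀ y z, R y z → (y ∈ D ↔ z ∈ D)) (hRx : ∀ y ∈ D, ∀ z, R y z → z = x y)
    (hR' : ∀ y ∈ D, R y (x y)) :
    Nat.card (Quot fun y z => z = c y ∨ R y z)
      = Nat.card {q : Quot (fun y z => z = c y ∨ z = x y) // ∀ f, Quot.mk _ f = q → f ∈ D}
        + Nat.card (Quot fun y z : {f // f ∉ D} => z.1 = bypass c x D y.1 ∨ R y.1 z.1) := by
  let β := bypass c x D
  let r : F → F → Prop := fun y z => z = c y ∨ R y z
  let r₁ : F → F → Prop := fun y z => z = c y ∨ z = x y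
  let r₂ : {f // f ∉ D} → {f // f ∉ D} → Prop := fun y z => z.1 = β y.1 ∨ R y.1 z.1
  have hβ : ∀ y ∉ D, β y ∉ D := fun y hy => bypass_notMem hc hx hc' hx' a b hD hy
  have hβy : ∀ y, Quot.mk r y = Quot.mk r (β y) := conn_bypass hR'
  have hclosed : ∀ y ∈ D, β y ∈ D → ∀ f, Quot.mk r₁ y = Quot.mk r₁ f →
      (f ∈ D ∧ β f ∈ D) ∧ Quot.mk r y = Quot.mk r f := by
    intro y hy hy' f hf
    refine (mem_iff_of_conn (C := {f | (f ∈ D ∧ β f ∈ D) ∧ Quot.mk r y = Quot.mk r f})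
      ?_ hf).1 ⟨⟨hy, hy'⟩, rfl⟩
    have k1 : ∀ g, ((g ∈ D ∧ β g ∈ D) ∧ Quot.mk r y = Quot.mk r g) →
        ((c g ∈ D ∧ β (c g) ∈ D) ∧ Quot.mk r y = Quot.mk r (c g)) := fun g hg =>
      ⟨(bypass_mem_closed hc hx hc' hx' hD hg.1.1 hg.1.2).1,
        hg.2.trans (Quot.sound (Or.inl rfl))⟩
    have k2 : ∀ g, ((g ∈ D ∧ β g ∈ D) ∧ Quot.mk r y = Quot.mk r g) →
        ((x g ∈ D ∧ β (x g) ∈ D) ∧ Quot.mk r y = Quot.mk r (x g)) := fun g hg =>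
      ⟨(bypass_mem_closed hc hx hc' hx' hD hg.1.1 hg.1.2).2,
        hg.2.trans (Quot.sound (Or.inr (hR' g hg.1.1)))⟩
    rintro g z (rfl | rfl)
    · exact ⟨k1 g, fun h => by
        have := k1 _ h
        rw [hc] at this
        exact this⟩
    · exact ⟨k2 g, fun h => by
        have := k2 _ h
        rw [hx] at this
        exact this⟩
  -- A flag of `D` is sent to the class of the flag at which its walk leaves `D`, or to its closed
  -- orbit if it does not leave.
  let h : F → {q : Quot r₁ // ∀ f, Quot.mk r₁ f = q → f ∈ D} ⊕ Quot r₂ := fun y =>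
    if hy : y ∉ D then Sum.inr (Quot.mk r₂ ⟨y, hy⟩)
    else if hy' : β y ∉ D then Sum.inr (Quot.mk r₂ ⟨β y, hy'⟩)
    else Sum.inl ⟨Quot.mk r₁ y, fun f hf =>
      (hclosed y (not_not.1 hy) (not_not.1 hy') f hf.symm).1.1⟩
  have h1 : ∀ y (hy : y ∉ D), h y = Sum.inr (Quot.mk r₂ ⟨y, hy⟩) := fun y hy => dif_pos hy
  have h2 : ∀ y (_ : y ∈ D) (hy' : β y ∉ D), h y = Sum.inr (Quot.mk r₂ ⟨β y, hy'⟩) :=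
    fun y hy hy' => (dif_neg (not_not.2 hy)).trans (dif_pos hy')
  have h3 : ∀ y (hy : y ∈ D) (hy' : β y ∈ D), h y = Sum.inl ⟨Quot.mk r₁ y, fun f hf =>
      (hclosed y hy hy' f hf.symm).1.1⟩ :=
    fun y hy hy' => (dif_neg (not_not.2 hy)).trans (dif_neg (not_not.2 hy'))
  have hh : ∀ y z, r y z → h y = h z := by
    rintro y z (rfl | hyz)
    · by_cases hy : y ∈ D <;> by_cases hcy : c y ∈ D
      · by_cases hy' : β y ∈ D
        · rw [h3 y hy hy', h3 _ hcy (bypass_mem_closed hc hx hc' hx' hD hy hy').1.2]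
          exact congrArg Sum.inl (Subtype.ext (Quot.sound (Or.inl rfl)))
        · have hy2 : β (c y) ∉ D := fun h' => by
            have := (bypass_mem_closed hc hx hc' hx' hD hcy h').1.2
            rw [hc] at this
            exact hy' this
          rw [h2 y hy hy', h2 _ hcy hy2]
          refine congrArg Sum.inr (Quot.sound (Or.inl ?_))
          exact bypass_corner hc hx hc' hx' hD hy hcy hy'
      · have e : β y = c y := bypass_of_notMem hcy
        rw [h2 y hy (e ▸ hcy), h1 _ hcy]
        simp only [e]
      · have e : β (c y) = y := (bypass_of_notMem (by rwa [hc])).trans (hc y)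
        rw [h1 y hy, h2 _ hcy (by rwa [e])]
        simp only [e]
      · have e : β y = c y := bypass_of_notMem hcy
        rw [h1 y hy, h1 _ hcy]
        exact congrArg Sum.inr (Quot.sound (Or.inl e.symm))
    · by_cases hy : y ∈ D
      · have hz := (hR y z hyz).1 hy
        obtain rfl := hRx y hy z hyz
        by_cases hy' : β y ∈ D
        · rw [h3 y hy hy', h3 _ hz (bypass_mem_closed hc hx hc' hx' hD hy hy').2.2]
          exact congrArg Sum.inl (Subtype.ext (Quot.sound (Or.inr rfl)))
        · have hy2 : β (x y) ∉ D := fun h' => by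
            have := (bypass_mem_closed hc hx hc' hx' hD hz h').2.2
            rw [hx] at this
            exact hy' this
          rw [h2 y hy hy', h2 _ hz hy2]
          refine congrArg Sum.inr (Quot.sound (Or.inl ?_))
          exact bypass_cross hc hx hc' hx' hD hy hy'
      · have hz : z ∉ D := fun hz => hy ((hR y z hyz).2 hz)
        rw [h1 y hy, h1 z hz]
        exact congrArg Sum.inr (Quot.sound (Or.inr hyz))
  have hr2 : ∀ y z : {f // f ∉ D}, Quot.mk r₂ y = Quot.mk r₂ z →
      Quot.mk r y.1 = Quot.mk r z.1 := by
    intro y z e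
    refine congrArg (Quot.lift (fun w : {f // f ∉ D} => Quot.mk r w.1) ?_) e
    rintro y z (e | e)
    · rw [e]; exact hβy y
    · exact Quot.sound (Or.inr e)
  have hinr : ∀ y, (y ∉ D ∨ β y ∉ D) → ∃ w : {f // f ∉ D}, h y = Sum.inr (Quot.mk r₂ w) ∧
      Quot.mk r y = Quot.mk r w.1 := by
    intro y hy
    by_cases hyD : y ∈ D
    · have hy' := hy.resolve_left (not_not.2 hyD)
      exact ⟨⟨β y, hy'⟩, h2 y hyD hy', hβy y⟩
    · exact ⟨⟨y, hyD⟩, h1 y hyD, rfl⟩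
  rw [← Nat.card_sum]
  refine Nat.card_congr (Equiv.ofBijective (Quot.lift h hh) ⟨?_, ?_⟩)
  · rintro ⟨y⟩ ⟨z⟩ (e : h y = h z)
    by_cases hy : y ∈ D ∧ β y ∈ D
    · by_cases hz : z ∈ D ∧ β z ∈ D
      · rw [h3 y hy.1 hy.2, h3 z hz.1 hz.2] at e
        exact (hclosed y hy.1 hy.2 z (congrArg Subtype.val (Sum.inl.inj e))).2
      · obtain ⟨w, e', -⟩ := hinr z (not_and_or.1 hz)
        rw [h3 y hy.1 hy.2, e'] at e
        cases e
    · obtain ⟨w, e', e2⟩ := hinr y (not_and_or.1 hy)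
      by_cases hz : z ∈ D ∧ β z ∈ D
      · rw [h3 z hz.1 hz.2, e'] at e
        cases e
      · obtain ⟨w', e3, e4⟩ := hinr z (not_and_or.1 hz)
        rw [e', e3] at e
        exact e2.trans ((hr2 _ _ (Sum.inr.inj e)).trans e4.symm)
  · rintro (⟨⟨y⟩, hy⟩ | y)
    · refine ⟨Quot.mk r y, ?_⟩
      have hyD : y ∈ D := hy y rfl
      have hy' : β y ∈ D := hy _ (conn_bypass (R := fun y z => z = x y) (fun y _ => rfl) y).symm
      exact h3 y hyD hy'
    · induction y using Quot.ind with | _ y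
      exact ⟨Quot.mk r y.1, h1 y.1 y.2⟩

open Classical in
-- Orientations pass through the removal of `D`, because a detour through `D` consists of pairs of
-- sign changes.
theorem exists_flip_iff_bypass (hc : ∀ g, c (c g) = g) (hx : ∀ g, x (x g) = g)
    (hc' : ∀ g, c g ≠ g) (hx' : ∀ g, x g ≠ g)
    (hD : ∀ g, g ∈ D ↔ g = a ∨ g = x a ∨ g = b ∨ g = x b)
    (hR : ∀ y z, R y z → (y ∈ D ↔ z ∈ D)) (hRx : ∀ y ∈ D, ∀ z, R y z → z = x y)
    (hR' : ∀ y ∈ D, R y (x y)) :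
    (∃ ε : F → Bool, ∀ y, ε (c y) ≠ ε y ∧ ∀ z, R y z → ε z ≠ ε y) ↔
      ∃ ε : F → Bool, ∀ y ∉ D, ε (bypass c x D y) ≠ ε y ∧ ∀ z, R y z → ε z ≠ ε y := by
  constructor
  · rintro ⟨ε, hε⟩
    refine ⟨ε, fun y hy => ⟨?_, (hε y).2⟩⟩
    have h1 : ∀ z, ε (if z ∈ D then c (x z) else z) = ε z := by
      intro z
      split_ifs with hz
      · have h1 := (hε (c (x z))).1
        have h2 := (hε z).2 _ (hR' z hz)
        rw [hc] at h1
        revert h1 h2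
        cases ε z <;> cases ε (x z) <;> cases ε (c (x z)) <;> simp
      · rfl
    have h2 : ε (bypass c x D y) = ε (c y) := (h1 _).trans (h1 _)
    rw [h2]
    exact (hε y).1
  · rintro ⟨ε, hε⟩
    obtain ⟨κ, hκ⟩ := exists_two_colouring hc hc' hx hx'
    let β := bypass c x D
    -- The extension of the signs to `D` is forced: opposite to the exit flag. Orbits closed inside
    -- `D` take any alternating colouring.
    let δ : F → Bool := fun y => if y ∉ D then ε y else if β y ∉ D then !(ε (β y)) else κ y
    have d1 : ∀ y ∉ D, δ y = ε y := fun y hy => if_pos hy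
    have d2 : ∀ y ∈ D, β y ∉ D → δ y = !(ε (β y)) := fun y hy hy' =>
      (if_neg (not_not.2 hy)).trans (if_pos hy')
    have d3 : ∀ y ∈ D, β y ∈ D → δ y = κ y := fun y hy hy' =>
      (if_neg (not_not.2 hy)).trans (if_neg (not_not.2 hy'))
    refine ⟨δ, fun y => ⟨?_, fun z hyz => ?_⟩⟩
    · by_cases hy : y ∈ D <;> by_cases hcy : c y ∈ D
      · by_cases hy' : β y ∈ D
        · rw [d3 y hy hy', d3 _ hcy (bypass_mem_closed hc hx hc' hx' hD hy hy').1.2]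
          exact (hκ y).1
        · have hy2 : β (c y) ∉ D := fun h' => by
            have := (bypass_mem_closed hc hx hc' hx' hD hcy h').1.2
            rw [hc] at this
            exact hy' this
          rw [d2 y hy hy', d2 _ hcy hy2]
          have e : β (c y) = β (β y) := bypass_corner hc hx hc' hx' hD hy hcy hy'
          rw [e]
          simpa using (hε (β y) hy').1
      · have e : β y = c y := bypass_of_notMem hcy
        rw [d2 y hy (e ▸ hcy), d1 _ hcy, e]
        simp
      · have e : β (c y) = y := (bypass_of_notMem (by rwa [hc])).trans (hc y)
        rw [d1 y hy, d2 _ hcy (by rwa [e]), e]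
        simp
      · have e : β y = c y := bypass_of_notMem hcy
        rw [d1 y hy, d1 _ hcy, ← e]
        exact (hε y hy).1
    · by_cases hy : y ∈ D
      · have hz := (hR y z hyz).1 hy
        obtain rfl := hRx y hy z hyz
        by_cases hy' : β y ∈ D
        · rw [d3 y hy hy', d3 _ hz (bypass_mem_closed hc hx hc' hx' hD hy hy').2.2]
          exact (hκ y).2
        · have hy2 : β (x y) ∉ D := fun h' => by
            have := (bypass_mem_closed hc hx hc' hx' hD hz h').2.2
            rw [hx] at this
            exact hy' this
          rw [d2 y hy hy', d2 _ hz hy2]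
          have e : β (x y) = β (β y) := bypass_cross hc hx hc' hx' hD hy hy'
          rw [e]
          simpa using (hε (β y) hy').1
      · have hz : z ∉ D := fun hz => hy ((hR y z hyz).2 hz)
        rw [d1 y hy, d1 z hz]
        exact (hε y hy).2 z hyz

end Bypass

/-! ### Edge sets as sets of flags -/

section EdgeSets

variable (G : PinchedRibbonGraph)

/-- The four flags of the ribbon through `f`. -/
def quad (f : G.Flag) : Set G.Flag := {f, G.side f, G.strand f, G.side (G.strand f)}

theorem mem_quad {f g : G.Flag} :
    g ∈ G.quad f ↔ g = f ∨ g = G.side f ∨ g = G.strand f ∨ g = G.side (G.strand f) := by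
  simp [quad]

/-- The edge through a flag. -/
def edgeOf (f : G.Flag) (h : ¬ G.IsHalf f) : G.Edge := ⟨G.quad f, f, h, rfl⟩

theorem mem_edgeOf (f : G.Flag) (h : ¬ G.IsHalf f) : f ∈ (G.edgeOf f h).1 := Or.inl rfl

theorem isHalf_side {f : G.Flag} : G.IsHalf (G.side f) ↔ G.IsHalf f := by
  have h1 := G.strand_side f
  have h2 := G.side_side
  simp only [IsHalf]
  grind

theorem isHalf_strand {f : G.Flag} : G.IsHalf (G.strand f) ↔ G.IsHalf f := by
  have h1 := G.strand_side f
  have h2 := G.side_side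
  have h3 := G.strand_strand
  simp only [IsHalf]
  grind

theorem quad_eq {f g : G.Flag} (h : g ∈ G.quad f) : G.quad g = G.quad f := by
  have h1 := G.strand_side
  have h2 := G.side_side
  have h3 := G.strand_strand
  ext y
  rw [mem_quad] at *
  rw [mem_quad]
  grind

theorem not_isHalf_of_mem {d : G.Edge} {f : G.Flag} (hf : f ∈ d.1) : ¬ G.IsHalf f := by
  obtain ⟨D, g, hg, rfl⟩ := d
  rcases hf with rfl | rfl | rfl | rfl
  · exact hg
  · rwa [isHalf_side]
  · rwa [isHalf_strand]
  · rwa [isHalf_side, isHalf_strand]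

theorem edge_eq_quad {d : G.Edge} {f : G.Flag} (hf : f ∈ d.1) : d.1 = G.quad f := by
  obtain ⟨D, g, hg, rfl⟩ := d
  exact (G.quad_eq hf).symm

theorem edge_eq_of_mem {d d' : G.Edge} {f : G.Flag} (hf : f ∈ d.1) (hf' : f ∈ d'.1) : d = d' :=
  Subtype.ext ((G.edge_eq_quad hf).trans (G.edge_eq_quad hf').symm)

theorem exists_mem_edge (d : G.Edge) : ∃ f, f ∈ d.1 := by
  obtain ⟨D, g, hg, rfl⟩ := d
  exact ⟨g, Or.inl rfl⟩

theorem ncard_quad {f : G.Flag} (h : ¬ G.IsHalf f) : (G.quad f).ncard = 4 := by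
  have h1 := G.side_ne
  have h2 := G.strand_ne
  have h3 := G.side_side
  simp only [IsHalf] at h
  have e : ∀ y, G.side y ≠ y := h1
  rw [quad, Set.ncard_insert_of_notMem, Set.ncard_insert_of_notMem, Set.ncard_pair]
  all_goals try simp only [Set.mem_insert_iff, Set.mem_singleton_iff]
  all_goals grind

/-- Edge numbers are compared through numbers of flags from here on, as flags survive cutting,
deletion and contraction while the type `Edge` changes. -/
theorem four_mul_numEdges : 4 * G.numEdges = {f | ¬ G.IsHalf f}.ncard := by
  have e : {f // ¬ G.IsHalf f} ≃ Σ d : G.Edge, d.1 :=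
    { toFun := fun f => ⟨G.edgeOf f.1 f.2, f.1, G.mem_edgeOf _ _⟩
      invFun := fun p => ⟨p.2.1, G.not_isHalf_of_mem p.2.2⟩
      left_inv := fun f => rfl
      right_inv := by
        rintro ⟨d, f, hf⟩
        exact Sigma.subtype_ext
          (G.edge_eq_of_mem (G.mem_edgeOf f (G.not_isHalf_of_mem hf)) hf) rfl }
  have h := Nat.card_congr e
  rw [Nat.card_sigma] at h
  have h4 : ∀ d : G.Edge, Nat.card d.1 = 4 := by
    intro d
    obtain ⟨f, hf⟩ := G.exists_mem_edge d
    rw [Nat.card_coe_set_eq, G.edge_eq_quad hf]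
    exact G.ncard_quad (G.not_isHalf_of_mem hf)
  simp only [h4, Finset.sum_const, Finset.card_univ, smul_eq_mul] at h
  rw [numEdges, Nat.card_eq_fintype_card, mul_comm, ← h, ← Nat.card_coe_set_eq]
  rfl

instance : Finite G.HalfRibbon := by unfold HalfRibbon; infer_instance

theorem two_mul_numHalf : 2 * G.numHalf = {f | G.IsHalf f}.ncard := by
  have := Fintype.ofFinite G.HalfRibbon
  have hm : ∀ (d : G.HalfRibbon) f, f ∈ d.1 → G.IsHalf f ∧ d.1 = {f, G.side f} := by
    rintro ⟨D, g, hg, rfl⟩ f (rfl | rfl)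
    · exact ⟨hg, rfl⟩
    · exact ⟨G.isHalf_side.2 hg, by
        simp only [G.side_side]
        exact Set.pair_comm _ _⟩
  have e : {f // G.IsHalf f} ≃ Σ d : G.HalfRibbon, d.1 :=
    { toFun := fun f => ⟨⟨{f.1, G.side f.1}, f.1, f.2, rfl⟩, f.1, Or.inl rfl⟩
      invFun := fun p => ⟨p.2.1, (hm _ _ p.2.2).1⟩
      left_inv := fun f => rfl
      right_inv := by
        rintro ⟨d, f, hf⟩
        exact Sigma.subtype_ext (Subtype.ext (hm _ _ hf).2.symm) rfl }
  have h := Nat.card_congr e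
  rw [Nat.card_sigma] at h
  have h4 : ∀ d : G.HalfRibbon, Nat.card d.1 = 2 := by
    rintro ⟨D, g, hg, rfl⟩
    rw [Nat.card_coe_set_eq, Set.ncard_pair (G.side_ne g).symm]
  simp only [h4, Finset.sum_const, Finset.card_univ, smul_eq_mul] at h
  rw [numHalf, Nat.card_eq_fintype_card, mul_comm, ← h, ← Nat.card_coe_set_eq]
  rfl

/-- The sets of flags that are unions of edges. -/
structure IsEdgeSet (S : Set G.Flag) : Prop where
  side : ∀ f ∈ S, G.side f ∈ S
  strand : ∀ f ∈ S, G.strand f ∈ S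
  not_isHalf : ∀ f ∈ S, ¬ G.IsHalf f

/-- All unions of edges. -/
noncomputable def edgeSets : Finset (Set G.Flag) := (Set.toFinite {S | G.IsEdgeSet S}).toFinset

theorem mem_edgeSets {S : Set G.Flag} : S ∈ G.edgeSets ↔ G.IsEdgeSet S := by
  simp [edgeSets]

theorem isEdgeSet_flagsOf (A : Finset G.Edge) : G.IsEdgeSet (G.flagsOf A) where
  side f h := (G.flagsOf_side A f).2 h
  strand f h := (G.flagsOf_strand A f).2 h
  not_isHalf _ := fun ⟨_, _, h⟩ => G.not_isHalf_of_mem h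

variable {G}

theorem IsEdgeSet.quad_subset {S : Set G.Flag} (hS : G.IsEdgeSet S) {f : G.Flag} (hf : f ∈ S) :
    G.quad f ⊆ S := by
  rintro g (rfl | rfl | rfl | rfl)
  exacts [hf, hS.side _ hf, hS.strand _ hf, hS.side _ (hS.strand _ hf)]

theorem IsEdgeSet.exists_flagsOf {S : Set G.Flag} (hS : G.IsEdgeSet S) :
    ∃ A, G.flagsOf A = S := by
  classical
  refine ⟨Finset.univ.filter (fun d => d.1 ⊆ S), ?_⟩
  ext f
  constructor
  · rintro ⟨d, hd, hf⟩
    exact (Finset.mem_filter.1 hd).2 hf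
  · intro hf
    exact ⟨G.edgeOf f (hS.not_isHalf f hf), Finset.mem_filter.2 ⟨Finset.mem_univ _,
      hS.quad_subset hf⟩, G.mem_edgeOf _ _⟩

theorem flagsOf_injective : Function.Injective G.flagsOf := by
  have key : ∀ A B : Finset G.Edge, G.flagsOf A = G.flagsOf B → A ⊆ B := by
    intro A B h d hd
    obtain ⟨f, hf⟩ := G.exists_mem_edge d
    obtain ⟨d', hd', hf'⟩ : f ∈ G.flagsOf B := h ▸ ⟨d, hd, hf⟩
    rwa [G.edge_eq_of_mem hf hf']
  exact fun A B h => (key A B h).antisymm (key B A h.symm)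

/-- Summing over unions of edges inside the flag set lets the subgraphs of `G`, of a deletion and of
a contraction be compared as sets of flags. -/
theorem sum_flagsOf {K : Type*} [AddCommMonoid K] (g : Set G.Flag → K) :
    ∑ A : Finset G.Edge, g (G.flagsOf A) = ∑ S ∈ G.edgeSets, g S :=
  Finset.sum_bij (fun A _ => G.flagsOf A) (fun A _ => G.mem_edgeSets.2 (G.isEdgeSet_flagsOf A))
    (fun _ _ _ _ h => flagsOf_injective h)
    (fun S hS => by
      obtain ⟨A, hA⟩ := (G.mem_edgeSets.1 hS).exists_flagsOf
      exact ⟨A, Finset.mem_univ _, hA⟩) (fun _ _ => rfl)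

theorem IsEdgeSet.empty : G.IsEdgeSet ∅ := ⟨by simp, by simp, by simp⟩

theorem IsEdgeSet.union {S S' : Set G.Flag} (h : G.IsEdgeSet S) (h' : G.IsEdgeSet S') :
    G.IsEdgeSet (S ∪ S') where
  side f hf := hf.imp (h.side f) (h'.side f)
  strand f hf := hf.imp (h.strand f) (h'.strand f)
  not_isHalf f hf := hf.elim (h.not_isHalf f) (h'.not_isHalf f)

theorem isEdgeSet_edge (d : G.Edge) : G.IsEdgeSet d.1 :=
  ⟨fun _ => G.edge_side, fun _ => G.edge_strand, fun _ => G.not_isHalf_of_mem⟩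

theorem isEdgeSet_quad {f : G.Flag} (h : ¬ G.IsHalf f) : G.IsEdgeSet (G.quad f) :=
  isEdgeSet_edge (G.edgeOf f h)

variable (G) in
theorem isEdgeSet_top : G.IsEdgeSet {f | ¬ G.IsHalf f} :=
  ⟨fun _ h => (G.isHalf_side).not.2 h, fun _ h => (G.isHalf_strand).not.2 h, fun _ h => h⟩

theorem edgeSet_induction {P : Set G.Flag → Prop} (h0 : P ∅)
    (h1 : ∀ S p, G.IsEdgeSet S → p ∉ S → ¬ G.IsHalf p → P S → P (S ∪ G.quad p))
    {S : Set G.Flag} (hS : G.IsEdgeSet S) : P S := by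
  classical
  obtain ⟨A, rfl⟩ := hS.exists_flagsOf
  induction A using Finset.induction_on with
  | empty => convert h0; simp [flagsOf]
  | insert d A hd ih =>
    obtain ⟨p, hp⟩ := G.exists_mem_edge d
    have := h1 _ p (G.isEdgeSet_flagsOf A) ?_ (G.not_isHalf_of_mem hp) (ih (G.isEdgeSet_flagsOf A))
    · convert this
      rw [← G.edge_eq_quad hp]
      ext f
      simp [flagsOf, or_comm]
    · rintro ⟨d', hd', hp'⟩
      exact hd (G.edge_eq_of_mem hp hp' ▸ hd')

end EdgeSets

/-! ### Numerical data of the cutting spanning subgraphs -/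

section Stats

variable (G : PinchedRibbonGraph) (S : Set G.Flag)

open Classical in
/-- The strands of the cutting spanning subgraph. -/
noncomputable def cutStrand (f : G.Flag) : G.Flag := if f ∈ S then G.strand f else G.side f

/-- The number of components of the cutting spanning subgraph. -/
noncomputable def compNum : ℕ := Nat.card G.Bare +
  Nat.card (Quot fun f g : G.Flag => g = G.corner f ∨ g = G.side f ∨ g = G.cutStrand S f)

/-- The number of boundary components of the cutting spanning subgraph. -/
noncomputable def bdNum : ℕ := Nat.card G.Bare +
  Nat.card (Quot fun f g : G.Flag => g = G.corner f ∨ g = G.cutStrand S f)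

/-- The cutting spanning subgraph is orientable. -/
def OrientableOn : Prop := ∃ ε : G.Flag → Bool, ∀ f,
  ε (G.corner f) ≠ ε f ∧ ε (G.side f) ≠ ε f ∧ ε (G.cutStrand S f) ≠ ε f

open Classical in
/-- The orientability parameter of the cutting spanning subgraph. -/
noncomputable def nonorNum : ℕ := if G.OrientableOn S then 0 else 1

/-- The number of edges in a union of edges. -/
noncomputable def edgeNum : ℕ := S.ncard / 4

/-- The nullity of the cutting spanning subgraph. -/
noncomputable def nullNum : ℕ := G.edgeNum S - (G.numVertices - G.compNum S)

variable {G S}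

theorem cutStrand_of_mem {f : G.Flag} (h : f ∈ S) : G.cutStrand S f = G.strand f := if_pos h

theorem cutStrand_of_notMem {f : G.Flag} (h : f ∉ S) : G.cutStrand S f = G.side f := if_neg h

variable (G) in
theorem cutStrand_empty : G.cutStrand ∅ = G.side := funext fun _ => if_neg (fun h => h)

variable (G) in
theorem cutStrand_top : G.cutStrand {f | ¬ G.IsHalf f} = G.strand := by
  funext f
  by_cases h : G.IsHalf f
  · rw [cutStrand_of_notMem (by simpa using h)]; exact Eq.symm h
  · exact cutStrand_of_mem h

theorem IsEdgeSet.side_mem_iff (hS : G.IsEdgeSet S) {f : G.Flag} : G.side f ∈ S ↔ f ∈ S :=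
  ⟨fun h => by simpa only [G.side_side] using hS.side _ h, hS.side f⟩

theorem IsEdgeSet.strand_mem_iff (hS : G.IsEdgeSet S) {f : G.Flag} : G.strand f ∈ S ↔ f ∈ S :=
  ⟨fun h => by simpa only [G.strand_strand] using hS.strand _ h, hS.strand f⟩

theorem IsEdgeSet.cutStrand_cutStrand (hS : G.IsEdgeSet S) (f : G.Flag) :
    G.cutStrand S (G.cutStrand S f) = f := by
  by_cases h : f ∈ S
  · rw [cutStrand_of_mem h, cutStrand_of_mem (hS.strand f h), G.strand_strand]
  · rw [cutStrand_of_notMem h, cutStrand_of_notMem (hS.side_mem_iff.not.2 h), G.side_side]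

theorem cutStrand_ne (f : G.Flag) : G.cutStrand S f ≠ f := by
  by_cases h : f ∈ S
  · rw [cutStrand_of_mem h]; exact G.strand_ne f
  · rw [cutStrand_of_notMem h]; exact G.side_ne f

theorem compNum_flagsOf (A : Finset G.Edge) :
    (G.cutSpanning A).numComponents = G.compNum (G.flagsOf A) :=
  @Nat.card_sum G.Bare (Quot _) G.finite_bare _

theorem bdNum_flagsOf (A : Finset G.Edge) :
    (G.cutSpanning A).numBoundaryComponents = G.bdNum (G.flagsOf A) :=
  @Nat.card_sum G.Bare (Quot _) G.finite_bare _

theorem nonorNum_flagsOf (A : Finset G.Edge) :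
    (G.cutSpanning A).nonorientability = G.nonorNum (G.flagsOf A) := rfl

variable (G) in
theorem numVertices_eq : G.numVertices = Nat.card G.Bare +
    Nat.card (Quot fun f g : G.Flag => g = G.corner f ∨ g = G.side f) :=
  Nat.card_sum

variable (G) in
theorem numVertices_eq_bdNum : G.numVertices = G.bdNum ∅ := by
  rw [numVertices_eq, bdNum, cutStrand_empty]

variable (G) in
theorem numVertices_eq_compNum : G.numVertices = G.compNum ∅ := by
  rw [numVertices_eq, compNum, cutStrand_empty]
  simp only [or_self]

variable (G) in
theorem numComponents_eq : G.numComponents = G.compNum {f | ¬ G.IsHalf f} := by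
  rw [compNum, cutStrand_top]
  exact Nat.card_sum

theorem isHalf_cutSpanning {A : Finset G.Edge} {f : G.Flag} :
    (G.cutSpanning A).IsHalf f ↔ f ∉ G.flagsOf A := by
  change G.cutStrand (G.flagsOf A) f = G.side f ↔ _
  by_cases h : f ∈ G.flagsOf A
  · rw [cutStrand_of_mem h]
    exact iff_of_false ((G.isEdgeSet_flagsOf A).not_isHalf f h) (not_not.2 h)
  · simp [cutStrand_of_notMem h, h]

theorem four_mul_numEdges_cutSpanning (A : Finset G.Edge) :
    4 * (G.cutSpanning A).numEdges = (G.flagsOf A).ncard := by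
  refine (four_mul_numEdges _).trans (congrArg Set.ncard (Set.ext fun f => ?_))
  exact (not_congr isHalf_cutSpanning).trans not_not

theorem IsEdgeSet.four_mul_edgeNum (hS : G.IsEdgeSet S) : 4 * G.edgeNum S = S.ncard := by
  obtain ⟨A, rfl⟩ := hS.exists_flagsOf
  have := four_mul_numEdges_cutSpanning A
  rw [edgeNum]
  omega

variable (G) in
theorem numEdges_eq : G.numEdges = G.edgeNum {f | ¬ G.IsHalf f} := by
  have := G.isEdgeSet_top.four_mul_edgeNum
  have := G.four_mul_numEdges
  omega

theorem edgeNum_flagsOf (A : Finset G.Edge) :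
    (G.cutSpanning A).numEdges = G.edgeNum (G.flagsOf A) := by
  have := (G.isEdgeSet_flagsOf A).four_mul_edgeNum
  have := four_mul_numEdges_cutSpanning A
  omega

theorem rank_cutSpanning (A : Finset G.Edge) :
    (G.cutSpanning A).rank = G.numVertices - G.compNum (G.flagsOf A) := by
  rw [rank, compNum_flagsOf]
  rfl

theorem nullNum_flagsOf (A : Finset G.Edge) :
    (G.cutSpanning A).nullity = G.nullNum (G.flagsOf A) := by
  rw [nullity, rank_cutSpanning, edgeNum_flagsOf, nullNum]

variable (G) in
theorem nullity_eq : G.nullity = G.nullNum {f | ¬ G.IsHalf f} := by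
  rw [nullity, rank, nullNum, numEdges_eq, numComponents_eq]

variable (G S) in
theorem compNum_le : G.compNum S ≤ G.numVertices := by
  rw [numVertices_eq, compNum]
  refine Nat.add_le_add_left (card_quot_le ?_) _
  rintro y z (rfl | rfl)
  exacts [Quot.sound (Or.inl rfl), Quot.sound (Or.inr (Or.inl rfl))]

variable (G S) in
theorem numComponents_le : G.numComponents ≤ G.compNum S := by
  rw [numComponents_eq, compNum, compNum, cutStrand_top]
  refine Nat.add_le_add_left (card_quot_le ?_) _
  rintro y z (rfl | rfl | rfl)
  · exact Quot.sound (Or.inl rfl)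
  · exact Quot.sound (Or.inr (Or.inl rfl))
  · by_cases h : y ∈ S
    · rw [cutStrand_of_mem h]; exact Quot.sound (Or.inr (Or.inr rfl))
    · rw [cutStrand_of_notMem h]; exact Quot.sound (Or.inr (Or.inl rfl))

theorem cutStrand_union_quad {p f : G.Flag} :
    f ∈ G.quad p ∧ G.cutStrand (S ∪ G.quad p) f = G.strand f ∨
      f ∉ G.quad p ∧ G.cutStrand (S ∪ G.quad p) f = G.cutStrand S f := by
  by_cases h : f ∈ G.quad p
  · exact Or.inl ⟨h, cutStrand_of_mem (Or.inr h)⟩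
  · by_cases h' : f ∈ S
    · exact Or.inr ⟨h, by rw [cutStrand_of_mem h', cutStrand_of_mem (Or.inl h')]⟩
    · exact Or.inr ⟨h, by rw [cutStrand_of_notMem h', cutStrand_of_notMem (by simp [h, h'])]⟩

/-- Modulo `side`, the strands of the added ribbon amount to a single new connection between its two
ends. -/
theorem card_quot_union_quad (hS : G.IsEdgeSet S) {p : G.Flag} (hp : p ∉ S) :
    Nat.card (Quot fun f g => g = G.corner f ∨ g = G.side f ∨ g = G.cutStrand (S ∪ G.quad p) f)
      = Nat.card (Quot fun f g => (g = G.corner f ∨ g = G.side f ∨ g = G.cutStrand S f) ∨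
          f = p ∧ g = G.strand p) := by
  refine card_quot_congr ?_ ?_
  · set r : G.Flag → G.Flag → Prop := fun f g =>
      (g = G.corner f ∨ g = G.side f ∨ g = G.cutStrand S f) ∨ f = p ∧ g = G.strand p
    have hs : ∀ y, Quot.mk r y = Quot.mk r (G.side y) :=
      fun y => Quot.sound (Or.inl (Or.inr (Or.inl rfl)))
    have ht : Quot.mk r p = Quot.mk r (G.strand p) := Quot.sound (Or.inr ⟨rfl, rfl⟩)
    rintro y z (rfl | rfl | rfl)
    · exact Quot.sound (Or.inl (Or.inl rfl))
    · exact hs y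
    · rcases cutStrand_union_quad (S := S) (p := p) (f := y) with ⟨h, e⟩ | ⟨h, e⟩
      · rw [e]
        rcases h with rfl | rfl | rfl | rfl
        · exact ht
        · rw [G.strand_side, ← hs, ← hs]; exact ht
        · rw [G.strand_strand]; exact ht.symm
        · rw [G.strand_side, G.strand_strand, ← hs, ← hs]; exact ht.symm
      · rw [e]
        exact Quot.sound (Or.inl (Or.inr (Or.inr rfl)))
  · set r : G.Flag → G.Flag → Prop := fun f g =>
      g = G.corner f ∨ g = G.side f ∨ g = G.cutStrand (S ∪ G.quad p) f
    have hs : ∀ y, Quot.mk r y = Quot.mk r (G.side y) := fun y => Quot.sound (Or.inr (Or.inl rfl))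
    have ht : Quot.mk r p = Quot.mk r (G.strand p) :=
      Quot.sound (Or.inr (Or.inr (cutStrand_of_mem (Or.inr (Or.inl rfl))).symm))
    rintro y z ((rfl | rfl | rfl) | ⟨rfl, rfl⟩)
    · exact Quot.sound (Or.inl rfl)
    · exact hs y
    · rcases cutStrand_union_quad (S := S) (p := p) (f := y) with ⟨h, e⟩ | ⟨h, e⟩
      · have hy : y ∉ S := fun hy => hp (by
          have := hS.quad_subset hy
          rw [G.quad_eq h] at this
          exact this (Or.inl rfl))
        rw [cutStrand_of_notMem hy]
        exact hs y
      · exact Quot.sound (Or.inr (Or.inr e.symm))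
    · exact ht

/-- The ends of an edge outside `S` lie in the same component of the subgraph with edges `S`. -/
def Joined (S : Set G.Flag) (p : G.Flag) : Prop :=
  Quot.mk (fun f g => g = G.corner f ∨ g = G.side f ∨ g = G.cutStrand S f) p
    = Quot.mk _ (G.strand p)

theorem compNum_union_quad_of_joined (hS : G.IsEdgeSet S) {p : G.Flag} (hp : p ∉ S)
    (h : Joined S p) : G.compNum (S ∪ G.quad p) = G.compNum S := by
  rw [compNum, card_quot_union_quad hS hp, card_quot_adjoin_eq h, compNum]

theorem compNum_union_quad_add_one (hS : G.IsEdgeSet S) {p : G.Flag} (hp : p ∉ S)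
    (h : ¬ Joined S p) : G.compNum (S ∪ G.quad p) + 1 = G.compNum S := by
  rw [compNum, card_quot_union_quad hS hp, compNum, ← card_quot_adjoin_add_one h, add_assoc]

/-- For the boundary curves, adding a ribbon replaces the pairs across its two attaching segments by
the pairs along its two strands, which is a switch in the sense of `card_quot_switch_add_one`. -/
theorem switch_cutStrand (hS : G.IsEdgeSet S) {p : G.Flag} (hp : p ∉ S) :
    G.cutStrand (S ∪ G.quad p) p = G.strand p ∧
    G.cutStrand (S ∪ G.quad p) (G.cutStrand S p) = G.cutStrand S (G.strand p) ∧
    ∀ y, y ≠ p → y ≠ G.cutStrand S p → y ≠ G.strand p → y ≠ G.cutStrand S (G.strand p) →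
      G.cutStrand (S ∪ G.quad p) y = G.cutStrand S y := by
  have h1 : G.cutStrand S p = G.side p := cutStrand_of_notMem hp
  have h2 : G.cutStrand S (G.strand p) = G.side (G.strand p) :=
    cutStrand_of_notMem (hS.strand_mem_iff.not.2 hp)
  rw [h1, h2]
  refine ⟨cutStrand_of_mem (Or.inr (Or.inl rfl)), ?_, ?_⟩
  · rw [cutStrand_of_mem (Or.inr (Or.inr (Or.inl rfl))), G.strand_side]
  · intro y h3 h4 h5 h6
    rcases cutStrand_union_quad (S := S) (p := p) (f := y) with ⟨h, -⟩ | ⟨-, e⟩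
    · rcases h with rfl | rfl | rfl | rfl <;> simp_all
    · exact e

theorem bdNum_union_quad_le (hS : G.IsEdgeSet S) {p : G.Flag} (hp : p ∉ S)
    (hp' : ¬ G.IsHalf p) : G.bdNum (S ∪ G.quad p) ≤ G.bdNum S + 1 := by
  obtain ⟨h1, h2, h3⟩ := switch_cutStrand hS hp
  have := card_quot_switch_le (c := G.corner) hS.cutStrand_cutStrand
    (hS.union (isEdgeSet_quad hp')).cutStrand_cutStrand h1 h2 h3
  simp only [bdNum]
  omega

theorem bdNum_union_quad_add_one (hS : G.IsEdgeSet S) {p : G.Flag} (hp : p ∉ S)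
    (hp' : ¬ G.IsHalf p) (h : ¬ Joined S p) : G.bdNum (S ∪ G.quad p) + 1 = G.bdNum S := by
  obtain ⟨h1, h2, h3⟩ := switch_cutStrand hS hp
  have := card_quot_switch_add_one G.corner_corner G.corner_ne hS.cutStrand_cutStrand cutStrand_ne
    (hS.union (isEdgeSet_quad hp')).cutStrand_cutStrand h1 h2 h3 (fun e => h (conn_of_le (by
      rintro y z (rfl | rfl)
      exacts [Quot.sound (Or.inl rfl), Quot.sound (Or.inr (Or.inr rfl))]) e))
  simp only [bdNum]
  omega

theorem edgeNum_union_quad (hS : G.IsEdgeSet S) {p : G.Flag} (hp : p ∉ S)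
    (hp' : ¬ G.IsHalf p) : G.edgeNum (S ∪ G.quad p) = G.edgeNum S + 1 := by
  have hd : Disjoint S (G.quad p) := by
    rw [Set.disjoint_left]
    intro y hy h
    have := hS.quad_subset hy
    rw [G.quad_eq h] at this
    exact hp (this (Or.inl rfl))
  rw [edgeNum, Set.ncard_union_eq hd, G.ncard_quad hp', edgeNum]
  omega

/-- Euler genus and nullity are nonnegative, so every truncated subtraction below is exact. An added
edge either joins two components and two boundary curves, or keeps the components and creates at
most one boundary curve. -/
theorem IsEdgeSet.bounds (hS : G.IsEdgeSet S) :
    G.bdNum S + G.numVertices ≤ 2 * G.compNum S + G.edgeNum S ∧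
      G.numVertices ≤ G.compNum S + G.edgeNum S := by
  refine edgeSet_induction (P := fun S =>
    G.bdNum S + G.numVertices ≤ 2 * G.compNum S + G.edgeNum S ∧
      G.numVertices ≤ G.compNum S + G.edgeNum S) ?_ ?_ hS
  · rw [← numVertices_eq_bdNum, ← numVertices_eq_compNum]
    omega
  · intro S p hS hp hp' ⟨ih, ih'⟩
    have h1 := edgeNum_union_quad hS hp hp'
    by_cases h : Joined S p
    · have h2 := compNum_union_quad_of_joined hS hp h
      have h3 := bdNum_union_quad_le hS hp hp'
      omega
    · have h2 := compNum_union_quad_add_one hS hp h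
      have h3 := bdNum_union_quad_add_one hS hp hp' h
      omega

theorem IsEdgeSet.nullNum_add (hS : G.IsEdgeSet S) :
    G.nullNum S + G.numVertices = G.edgeNum S + G.compNum S := by
  have := hS.bounds
  have := G.compNum_le S
  rw [nullNum]
  omega

variable (G) in
theorem nullity_add : G.nullity + G.numVertices = G.numEdges + G.numComponents := by
  rw [nullity_eq, numComponents_eq, numEdges_eq]
  exact G.isEdgeSet_top.nullNum_add

theorem IsEdgeSet.bdNum_le (hS : G.IsEdgeSet S) : G.bdNum S ≤ G.compNum S + G.nullNum S := by
  have := hS.bounds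
  have := hS.nullNum_add
  omega

end Stats

/-! ### The polynomial as a sum over unions of edges -/

section Poly

variable {K : Type*} [CommRing K] (G : PinchedRibbonGraph)

/-- The summand of the Bollobás–Riordan polynomial, in the variables `X - 1`, `Y - 1`, `Z`, `W`. -/
noncomputable def term (x y z w : K) (S : Set G.Flag) : K :=
  x ^ (G.compNum S - G.numComponents) * y ^ G.nullNum S *
    z ^ (G.compNum S + G.nullNum S - G.bdNum S) * w ^ G.nonorNum S

variable {G}

theorem rank_sub_rank (A : Finset G.Edge) :
    G.rank - (G.cutSpanning A).rank = G.compNum (G.flagsOf A) - G.numComponents := by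
  have h1 := G.compNum_le (G.flagsOf A)
  have h2 := G.numComponents_le (G.flagsOf A)
  rw [rank_cutSpanning, rank]
  omega

theorem brPoly_eq_sum (X Y Z W : K) :
    G.brPoly X Y Z W = ∑ S ∈ G.edgeSets, G.term (X - 1) (Y - 1) Z W S := by
  rw [← sum_flagsOf, brPoly]
  refine Finset.sum_congr rfl fun A _ => ?_
  rw [term, rank_sub_rank, nullNum_flagsOf, compNum_flagsOf, bdNum_flagsOf, nonorNum_flagsOf]

theorem numClosedFaces_add : G.numClosedFaces + G.numBoundaryGraphComponents
    = G.numBoundaryComponents := by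
  classical
  rw [numClosedFaces, numBoundaryGraphComponents, numBoundaryComponents]
  have : Finite G.FlagBoundary := by unfold FlagBoundary; infer_instance
  rw [Nat.card_sum, Nat.card_sum, add_assoc, ← Nat.card_sum]
  congr 1
  refine Nat.card_congr ?_
  refine (Equiv.sumCongr (Equiv.refl _) (Equiv.subtypeEquivRight fun b => ?_)).trans
    (Equiv.sumCompl fun b : G.FlagBoundary => ∀ f, Quot.mk _ f = b → ¬ G.IsHalf f)
  simp only [not_forall, not_not, exists_prop]

/-- Cutting does not change the flag set, and each graph has two flags per half-ribbon and four per
edge. -/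
theorem numHalf_cutSpanning (A : Finset G.Edge) :
    (G.cutSpanning A).numHalf + 2 * (G.cutSpanning A).numEdges = G.numHalf + 2 * G.numEdges := by
  have key : ∀ H : PinchedRibbonGraph, 2 * H.numHalf + 4 * H.numEdges = Nat.card H.Flag := by
    intro H
    rw [two_mul_numHalf, four_mul_numEdges, ← Set.ncard_add_ncard_compl {f | H.IsHalf f}]
    rfl
  have h1 := key G
  have h2 : _ = Nat.card G.Flag := key (G.cutSpanning A)
  omega

/-- The identity holds summand by summand. The exponents of `Z` agree since closed faces and
components of the boundary graph together are all the boundary components. -/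
theorem brPoly_eq_brPolyPinched (X' X Y' Y Z W : K) (t : Kˣ)
    (hX : X' - 1 = (X - 1) * ((t⁻¹ : Kˣ) : K) ^ 2) (hY : Y' - 1 = (t : K) ^ 2 * (Y - 1)) :
    G.brPoly X Y Z W
      = ((t⁻¹ : Kˣ) : K) ^ (G.numHalf + 2 * G.nullity) * G.brPolyPinched X' Y' Z W t := by
  rw [brPoly, brPolyPinched, Finset.mul_sum]
  refine Finset.sum_congr rfl fun A _ => ?_
  rw [numClosedFaces_add, hX, hY]
  have h1 := numHalf_cutSpanning A
  have h2 := G.nullity_add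
  have h3 : (G.cutSpanning A).nullity + G.numVertices = _ := (G.cutSpanning A).nullity_add
  have h4 := rank_sub_rank A
  rw [← compNum_flagsOf] at h4
  have h5 := G.numComponents_le (G.flagsOf A)
  rw [← compNum_flagsOf] at h5
  set a := G.rank - (G.cutSpanning A).rank
  set b := (G.cutSpanning A).nullity
  -- From f(A) + 2|A| = f + 2|E|, with |A| = r(A) + n(A) and |E| = r + n.
  have h6 : (G.cutSpanning A).numHalf + 2 * b = G.numHalf + 2 * G.nullity + 2 * a := by omega
  have h7 : ((t⁻¹ : Kˣ) : K) ^ (G.numHalf + 2 * G.nullity) * ((t⁻¹ : Kˣ) : K) ^ (2 * a) *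
      ((t : K) ^ (2 * b) * (t : K) ^ (G.cutSpanning A).numHalf) = 1 := by
    rw [← pow_add, ← pow_add, add_comm (2 * b), h6, ← mul_pow, Units.inv_mul, one_pow]
  rw [mul_pow, mul_pow, ← pow_mul, ← pow_mul]
  linear_combination (-1 : K) * (X - 1) ^ a * (Y - 1) ^ b *
    Z ^ ((G.cutSpanning A).numComponents + b - (G.cutSpanning A).numBoundaryComponents) *
    W ^ (G.cutSpanning A).nonorientability * h7

end Poly

/-! ### Deletion and contraction -/

theorem nonorNum_congr {G H : PinchedRibbonGraph} {S : Set G.Flag} {T : Set H.Flag}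
    (h : G.OrientableOn S ↔ H.OrientableOn T) : G.nonorNum S = H.nonorNum T := by
  classical
  simp only [nonorNum, h]

section RemoveEdge

variable {G : PinchedRibbonGraph} {d : G.Edge}

theorem card_quot_of_iff {F : Type} {r r' : F → F → Prop} (h : ∀ y z, r y z ↔ r' y z) :
    Nat.card (Quot r) = Nat.card (Quot r') :=
  card_quot_congr (fun y z hr => Quot.sound ((h y z).1 hr))
    fun y z hr => Quot.sound ((h y z).2 hr)

theorem val_mem_image {D S' : Set G.Flag} {T : Set {f // f ∉ D}} (f : {f // f ∉ D}) :
    (f.1 ∈ Subtype.val '' T ↔ f ∈ T) ∧ (S' ⊆ D → (f.1 ∈ Subtype.val '' T ∪ S' ↔ f ∈ T)) := by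
  have h : f.1 ∈ Subtype.val '' T ↔ f ∈ T := Subtype.val_injective.mem_set_image
  refine ⟨h, fun hS => ?_⟩
  rw [Set.mem_union, h]
  exact or_iff_left (fun h => f.2 (hS h))

variable {x : G.Flag → G.Flag} {B : Type} {hB : Finite B}
  {hx : ∀ f, x (x f) = f} {hx' : ∀ f, x f ≠ f}
  {hd : ∃ a b, ∀ g, g ∈ d.1 ↔ g = a ∨ g = x a ∨ g = b ∨ g = x b}

theorem isHalf_removeEdge (f : {f // f ∉ d.1}) :
    (G.removeEdge d x B hB hx hx' hd).IsHalf f ↔ G.IsHalf f.1 :=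
  Subtype.ext_iff

theorem isEdgeSet_removeEdge {T : Set {f // f ∉ d.1}} :
    (G.removeEdge d x B hB hx hx' hd).IsEdgeSet T ↔ G.IsEdgeSet (Subtype.val '' T) := by
  constructor
  · intro h
    refine ⟨?_, ?_, ?_⟩
    · rintro _ ⟨f, hf, rfl⟩
      exact ⟨_, h.side f hf, rfl⟩
    · rintro _ ⟨f, hf, rfl⟩
      exact ⟨_, h.strand f hf, rfl⟩
    · rintro _ ⟨f, hf, rfl⟩
      exact fun h' => h.not_isHalf f hf ((isHalf_removeEdge f).2 h')
  · intro h
    refine ⟨fun f hf => ?_, fun f hf => ?_, fun f hf h' => ?_⟩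
    · exact (val_mem_image (S' := ∅) _).1.1 (h.side _ ⟨f, hf, rfl⟩)
    · exact (val_mem_image (S' := ∅) _).1.1 (h.strand _ ⟨f, hf, rfl⟩)
    · exact h.not_isHalf _ ⟨f, hf, rfl⟩ ((isHalf_removeEdge f).1 h')

theorem cutStrand_removeEdge {T : Set {f // f ∉ d.1}} {S : Set G.Flag}
    (hS : ∀ f : {f // f ∉ d.1}, f.1 ∈ S ↔ f ∈ T) (f : {f // f ∉ d.1}) :
    ((G.removeEdge d x B hB hx hx' hd).cutStrand T f).1 = G.cutStrand S f.1 := by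
  by_cases h : f ∈ T
  · rw [cutStrand_of_mem ((hS f).2 h)]
    exact congrArg Subtype.val (cutStrand_of_mem (G := G.removeEdge d x B hB hx hx' hd) h)
  · rw [cutStrand_of_notMem (fun h' => h ((hS f).1 h'))]
    exact congrArg Subtype.val (cutStrand_of_notMem (G := G.removeEdge d x B hB hx hx' hd) h)

theorem edgeNum_removeEdge (T : Set {f // f ∉ d.1}) :
    (G.removeEdge d x B hB hx hx' hd).edgeNum T = G.edgeNum (Subtype.val '' T) :=
  congrArg (· / 4) (Set.ncard_image_of_injective T Subtype.val_injective).symm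

theorem top_eq_removeEdge : {f | ¬ G.IsHalf f} = Subtype.val ''
    {f : {f // f ∉ d.1} | ¬ (G.removeEdge d x B hB hx hx' hd).IsHalf f} ∪ d.1 := by
  ext f
  constructor
  · intro hf
    by_cases h : f ∈ d.1
    · exact Or.inr h
    · exact Or.inl ⟨⟨f, h⟩, fun h' => hf ((isHalf_removeEdge _).1 h'), rfl⟩
  · rintro (⟨f, hf, rfl⟩ | hf)
    · exact fun h' => hf ((isHalf_removeEdge _).2 h')
    · exact G.not_isHalf_of_mem hf

theorem numHalf_removeEdge : (G.removeEdge d x B hB hx hx' hd).numHalf = G.numHalf := by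
  have h1 := two_mul_numHalf (G.removeEdge d x B hB hx hx' hd)
  have h2 := G.two_mul_numHalf
  have h3 : {f | G.IsHalf f} = Subtype.val ''
      {f : {f // f ∉ d.1} | (G.removeEdge d x B hB hx hx' hd).IsHalf f} := by
    ext f
    constructor
    · intro hf
      exact ⟨⟨f, fun h => G.not_isHalf_of_mem h hf⟩, (isHalf_removeEdge _).2 hf, rfl⟩
    · rintro ⟨f, hf, rfl⟩
      exact (isHalf_removeEdge _).1 hf
  rw [h3, Set.ncard_image_of_injective _ Subtype.val_injective] at h2
  have : 2 * (G.removeEdge d x B hB hx hx' hd).numHalf = 2 * G.numHalf := h1.trans h2.symm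
  omega

theorem notMem_image {p : G.Flag} (hp : p ∈ d.1) (T : Set {f // f ∉ d.1}) :
    p ∉ Subtype.val '' T := by
  rintro ⟨f, -, rfl⟩
  exact f.2 hp

theorem numEdges_removeEdge :
    (G.removeEdge d x B hB hx hx' hd).numEdges + 1 = G.numEdges := by
  obtain ⟨p, hp⟩ := G.exists_mem_edge d
  have h1 := isEdgeSet_removeEdge.1 (isEdgeSet_top (G.removeEdge d x B hB hx hx' hd))
  have h2 := edgeNum_union_quad h1 (notMem_image hp _) (G.not_isHalf_of_mem hp)
  rw [← G.edge_eq_quad hp] at h2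
  have h3 : G.numEdges = _ := G.numEdges_eq.trans (congrArg G.edgeNum
    (top_eq_removeEdge (d := d) (x := x) (hx := hx) (hx' := hx') (hd := hd) (hB := hB)))
  exact ((h3.trans h2).trans (congrArg (· + 1)
    ((edgeNum_removeEdge _).symm.trans (numEdges_eq _).symm))).symm

theorem card_flag_removeEdge :
    Nat.card (G.removeEdge d x B hB hx hx' hd).Flag + 4 = Nat.card G.Flag := by
  obtain ⟨p, hp⟩ := G.exists_mem_edge d
  have h1 : d.1.ncard = 4 := by
    rw [G.edge_eq_quad hp]; exact G.ncard_quad (G.not_isHalf_of_mem hp)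
  rw [← Set.ncard_add_ncard_compl d.1, h1, add_comm]
  rfl

/-- Deletion and contraction leave the same flags, sides and strands, so both index the same edge
sets: those of `G` avoiding `d`, or, with `d` added, those containing it. -/
theorem sum_edgeSets_eq {K : Type*} [AddCommMonoid K] (g : Set G.Flag → K) :
    ∑ S ∈ G.edgeSets, g S
      = ∑ T ∈ (G.removeEdge d x B hB hx hx' hd).edgeSets, g (Subtype.val '' T) +
        ∑ T ∈ (G.removeEdge d x B hB hx hx' hd).edgeSets, g (Subtype.val '' T ∪ d.1) := by
  classical
  obtain ⟨p, hp⟩ := G.exists_mem_edge d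
  have hval : ∀ S : Set G.Flag,
      Subtype.val '' (Subtype.val ⁻¹' S : Set {f // f ∉ d.1}) = S \ d.1 := by
    intro S
    ext f
    constructor
    · rintro ⟨f, hf, rfl⟩
      exact ⟨hf, f.2⟩
    · rintro ⟨hf, hf'⟩
      exact ⟨⟨f, hf'⟩, hf, rfl⟩
  have hdiff : ∀ S, G.IsEdgeSet S → G.IsEdgeSet (S \ d.1) := fun S hS =>
    ⟨fun f hf => ⟨hS.side f hf.1, G.edge_side_notMem hf.2⟩,
      fun f hf => ⟨hS.strand f hf.1, G.edge_strand_notMem hf.2⟩, fun f hf => hS.not_isHalf f hf.1⟩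
  have hmem : ∀ S, S ∈ G.edgeSets → (Subtype.val ⁻¹' S : Set {f // f ∉ d.1}) ∈
      (G.removeEdge d x B hB hx hx' hd).edgeSets := by
    intro S hS
    refine (mem_edgeSets _).2 (isEdgeSet_removeEdge.2 ?_)
    rw [hval]
    exact hdiff S ((mem_edgeSets _).1 hS)
  have hinj : Function.Injective (Set.image Subtype.val : Set {f // f ∉ d.1} → Set G.Flag) :=
    Set.image_injective.2 Subtype.val_injective
  rw [← Finset.sum_filter_not_add_sum_filter G.edgeSets (p ∈ ·)]
  congr 1
  · refine (Finset.sum_bij (fun T _ => Subtype.val '' T) ?_ (fun _ _ _ _ h => hinj h) ?_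
      fun _ _ => rfl).symm
    · intro T hT
      rw [Finset.mem_filter, mem_edgeSets]
      exact ⟨isEdgeSet_removeEdge.1 ((mem_edgeSets _).1 hT), notMem_image hp T⟩
    · intro S hS
      rw [Finset.mem_filter] at hS
      refine ⟨_, hmem S hS.1, ?_⟩
      rw [hval]
      refine sdiff_eq_left.2 (Set.disjoint_left.2 fun f hf hf' => hS.2 ?_)
      have h1 := (G.mem_edgeSets.1 hS.1).quad_subset hf
      rw [← G.edge_eq_quad hf'] at h1
      exact h1 hp
  · refine (Finset.sum_bij (fun T _ => Subtype.val '' T ∪ d.1) ?_ ?_ ?_ fun _ _ => rfl).symm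
    · intro T hT
      rw [Finset.mem_filter, mem_edgeSets]
      exact ⟨(isEdgeSet_removeEdge.1 ((mem_edgeSets _).1 hT)).union (isEdgeSet_edge d), Or.inr hp⟩
    · intro T _ T' _ h
      ext f
      rw [← (val_mem_image f).2 subset_rfl, ← (val_mem_image (T := T') f).2 subset_rfl]
      exact Set.ext_iff.1 h f.1
    · intro S hS
      rw [Finset.mem_filter] at hS
      refine ⟨_, hmem S hS.1, ?_⟩
      rw [hval]
      refine Set.sdiff_union_of_subset ?_
      rw [G.edge_eq_quad hp]
      exact (G.mem_edgeSets.1 hS.1).quad_subset hS.2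

theorem card_quot_removeEdge (R : G.Flag → G.Flag → Prop)
    (hR : ∀ y z, R y z → (y ∈ d.1 ↔ z ∈ d.1)) (hRx : ∀ y ∈ d.1, ∀ z, R y z → z = x y)
    (hR' : ∀ y ∈ d.1, R y (x y)) :
    Nat.card (Quot fun y z => z = G.corner y ∨ R y z)
      = Nat.card {q : Quot (fun y z => z = G.corner y ∨ z = x y) //
          ∀ f, Quot.mk _ f = q → f ∈ d.1}
        + Nat.card (Quot fun y z : {f // f ∉ d.1} =>
          z = (G.removeEdge d x B hB hx hx' hd).corner y ∨ R y.1 z.1) := by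
  have hd' := hd
  obtain ⟨a, b, hD⟩ := hd'
  rw [card_quot_bypass (a := a) (b := b) G.corner_corner hx G.corner_ne hx' hD hR hRx hR']
  congr 1
  refine card_quot_of_iff fun y z => or_congr_left ?_
  exact ⟨fun h => Subtype.ext h, fun h => congrArg Subtype.val h⟩

open Classical in
theorem orientableOn_removeEdge {T : Set {f // f ∉ d.1}} {S : Set G.Flag}
    (hS : ∀ f : {f // f ∉ d.1}, f.1 ∈ S ↔ f ∈ T) (R : G.Flag → G.Flag → Prop)
    (hR : ∀ y z, R y z → (y ∈ d.1 ↔ z ∈ d.1)) (hRx : ∀ y ∈ d.1, ∀ z, R y z → z = x y)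
    (hR' : ∀ y ∈ d.1, R y (x y))
    (hRS : ∀ y ∉ d.1, ∀ z, R y z ↔ z = G.side y ∨ z = G.cutStrand S y) :
    (G.removeEdge d x B hB hx hx' hd).OrientableOn T ↔
      ∃ ε : G.Flag → Bool, ∀ y, ε (G.corner y) ≠ ε y ∧ ∀ z, R y z → ε z ≠ ε y := by
  have hd' := hd
  obtain ⟨a, b, hD⟩ := hd'
  rw [exists_flip_iff_bypass (a := a) (b := b) G.corner_corner hx G.corner_ne hx' hD hR hRx hR']
  have hc := cutStrand_removeEdge (x := x) (hx := hx) (hx' := hx') (hB := hB) (hd := hd) hS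
  constructor
  · rintro ⟨ε, hε⟩
    -- The value on the flags of `d` is arbitrary: only flags outside `d` are compared.
    let δ : G.Flag → Bool := fun y => if h : y ∉ d.1 then ε ⟨y, h⟩ else true
    have hδ : ∀ y : {f // f ∉ d.1}, δ y.1 = ε y := fun y => dif_pos y.2
    have hδ' : ∀ y z : {f // f ∉ d.1}, ε y ≠ ε z → δ y.1 ≠ δ z.1 := fun y z h => by
      rwa [hδ, hδ]
    refine ⟨δ, fun y hy => ?_⟩
    obtain ⟨h1, h2, h3⟩ := hε ⟨y, hy⟩
    refine ⟨hδ' _ _ h1, fun z hz => ?_⟩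
    rcases (hRS y hy z).1 hz with rfl | rfl
    · exact hδ' _ _ h2
    · rw [← hc ⟨y, hy⟩]
      exact hδ' _ _ h3
  · rintro ⟨ε, hε⟩
    refine ⟨fun y => ε y.1, fun y => ⟨(hε y.1 y.2).1, ?_, ?_⟩⟩
    · exact (hε y.1 y.2).2 _ ((hRS _ y.2 _).2 (Or.inl rfl))
    · refine (hε y.1 y.2).2 _ ((hRS _ y.2 _).2 (Or.inr (hc y)))

end RemoveEdge

/-! ### Statistics of a deletion -/

section Delete

variable {G : PinchedRibbonGraph} (d : G.Edge)

theorem exists_side_orbits : ∃ a b, ∀ g, g ∈ d.1 ↔ g = a ∨ g = G.side a ∨ g = b ∨ g = G.side b := by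
  obtain ⟨p, hp⟩ := G.exists_mem_edge d
  exact ⟨p, G.strand p, fun g => by rw [G.edge_eq_quad hp, mem_quad]⟩

/-- In a subgraph avoiding `d` the cut ribbon has strands equal to its sides, so the removed flags
carry just the involution `side`, as `card_quot_bypass` demands. -/
theorem delete_relation {S : Set G.Flag} (hSd : Disjoint S d.1) :
    (∀ y z, (z = G.side y ∨ z = G.cutStrand S y) → (y ∈ d.1 ↔ z ∈ d.1)) ∧
    (∀ y ∈ d.1, G.cutStrand S y = G.side y) := by
  have h1 := fun f => (isEdgeSet_edge d).side_mem_iff (f := f)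
  have h2 := fun f => (isEdgeSet_edge d).strand_mem_iff (f := f)
  refine ⟨?_, fun y hy => cutStrand_of_notMem fun h => Set.disjoint_left.1 hSd h hy⟩
  rintro y z (rfl | rfl)
  · exact (h1 _).symm
  · by_cases h : y ∈ S
    · rw [cutStrand_of_mem h, h2]
    · rw [cutStrand_of_notMem h, h1]

theorem disjoint_image {D : Set G.Flag} (T : Set {f // f ∉ D}) : Disjoint (Subtype.val '' T) D :=
  Set.disjoint_left.2 fun _ ⟨f, _, hf⟩ h => f.2 (hf ▸ h)

theorem isEdgeSet_delete {T : Set (G.delete d).Flag} :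
    (G.delete d).IsEdgeSet T ↔ G.IsEdgeSet (Subtype.val '' T) := isEdgeSet_removeEdge

theorem cutStrand_delete (T : Set (G.delete d).Flag) (f : (G.delete d).Flag) :
    ((G.delete d).cutStrand T f).1 = G.cutStrand (Subtype.val '' T) f.1 :=
  cutStrand_removeEdge (fun f => (val_mem_image (S' := ∅) f).1) f

theorem compNum_delete (T : Set (G.delete d).Flag) :
    (G.delete d).compNum T = G.compNum (Subtype.val '' T) := by
  obtain ⟨h1, h2⟩ := delete_relation d (disjoint_image T)
  rw [compNum, compNum, card_quot_removeEdge (d := d) (x := G.side) (B := (G.delete d).Bare)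
    (hB := (G.delete d).finite_bare) (hx := G.side_side) (hx' := G.side_ne)
    (hd := exists_side_orbits d)
    (fun y z => z = G.side y ∨ z = G.cutStrand (Subtype.val '' T) y) h1
    (fun y hy z hz => hz.elim id fun h => h.trans (h2 y hy)) (fun y _ => Or.inl rfl), ← add_assoc]
  congr 1
  · exact Nat.card_sum
  · refine card_quot_of_iff fun y z => or_congr_right (or_congr Subtype.ext_iff ?_)
    rw [← cutStrand_delete]
    exact Subtype.ext_iff

theorem bdNum_delete (T : Set (G.delete d).Flag) :
    (G.delete d).bdNum T = G.bdNum (Subtype.val '' T) := by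
  obtain ⟨h1, h2⟩ := delete_relation d (disjoint_image T)
  rw [bdNum, bdNum, card_quot_removeEdge (d := d) (x := G.side) (B := (G.delete d).Bare)
    (hB := (G.delete d).finite_bare) (hx := G.side_side) (hx' := G.side_ne)
    (hd := exists_side_orbits d)
    (fun y z => z = G.cutStrand (Subtype.val '' T) y) (fun y z h => h1 y z (Or.inr h))
    (fun y hy z hz => hz.trans (h2 y hy)) (fun y hy => (h2 y hy).symm), ← add_assoc]
  congr 1
  · exact Nat.card_sum
  · refine card_quot_of_iff fun y z => or_congr_right ?_
    rw [← cutStrand_delete]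
    exact Subtype.ext_iff

theorem orientableOn_delete (T : Set (G.delete d).Flag) :
    (G.delete d).OrientableOn T ↔ G.OrientableOn (Subtype.val '' T) := by
  obtain ⟨h1, h2⟩ := delete_relation d (disjoint_image T)
  refine (orientableOn_removeEdge (fun f => (val_mem_image (S' := ∅) f).1)
    (fun y z => z = G.side y ∨ z = G.cutStrand (Subtype.val '' T) y) h1
    (fun y hy z hz => hz.elim id fun h => h.trans (h2 y hy)) (fun y _ => Or.inl rfl)
    fun _ _ _ => Iff.rfl).trans ?_
  simp only [OrientableOn, forall_eq_or_imp, forall_eq]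

theorem numVertices_delete : (G.delete d).numVertices = G.numVertices := by
  rw [numVertices_eq_compNum, compNum_delete d ∅,
    numVertices_eq_compNum]
  exact congrArg G.compNum (Set.image_empty _)

theorem edgeNum_delete (T : Set (G.delete d).Flag) :
    (G.delete d).edgeNum T = G.edgeNum (Subtype.val '' T) := edgeNum_removeEdge T

theorem nullNum_delete (T : Set (G.delete d).Flag) :
    (G.delete d).nullNum T = G.nullNum (Subtype.val '' T) := by
  rw [nullNum, nullNum, compNum_delete d T, edgeNum_delete, numVertices_delete]

theorem nonorNum_delete (T : Set (G.delete d).Flag) :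
    (G.delete d).nonorNum T = G.nonorNum (Subtype.val '' T) := by
  exact nonorNum_congr (orientableOn_delete d T)

theorem numHalf_delete : (G.delete d).numHalf = G.numHalf := numHalf_removeEdge

theorem numEdges_delete : (G.delete d).numEdges + 1 = G.numEdges := numEdges_removeEdge

theorem card_flag_delete : Nat.card (G.delete d).Flag + 4 = Nat.card G.Flag :=
  card_flag_removeEdge

theorem top_eq_delete :
    {f | ¬ G.IsHalf f} = Subtype.val '' {f : (G.delete d).Flag | ¬ (G.delete d).IsHalf f} ∪ d.1 :=
  top_eq_removeEdge

end Delete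

/-! ### Loops and bridges -/

section Loops

variable {G : PinchedRibbonGraph} {d : G.Edge}

theorem vertexOf_corner (f : G.Flag) : G.vertexOf (G.corner f) = G.vertexOf f :=
  (congrArg Sum.inr (Quot.sound (Or.inl rfl) : Quot.mk _ f = Quot.mk _ (G.corner f))).symm

theorem vertexOf_side (f : G.Flag) : G.vertexOf (G.side f) = G.vertexOf f :=
  (congrArg Sum.inr (Quot.sound (Or.inr rfl) : Quot.mk _ f = Quot.mk _ (G.side f))).symm

theorem isLoop_iff {p : G.Flag} (hp : p ∈ d.1) :
    G.IsLoop d ↔ G.vertexOf p = G.vertexOf (G.strand p) := by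
  refine ⟨fun h => h _ hp _ (G.edge_strand hp), fun h => ?_⟩
  have key : ∀ f ∈ d.1, G.vertexOf f = G.vertexOf p := by
    intro f hf
    rw [G.edge_eq_quad hp] at hf
    rcases hf with rfl | rfl | rfl | rfl
    · rfl
    · exact vertexOf_side _
    · exact h.symm
    · exact (vertexOf_side _).trans h.symm
  exact fun f hf g hg => (key f hf).trans (key g hg).symm

/-- A vertex meets at most one end of a non-loop. This is what makes the parity lemmas applicable to
contractions. -/
theorem eq_or_eq_side_of_not_isLoop (h : ¬ G.IsLoop d) {p y : G.Flag} (hp : p ∈ d.1)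
    (hy : y ∈ d.1) (e : G.vertexOf y = G.vertexOf p) : y = p ∨ y = G.side p := by
  rw [isLoop_iff hp] at h
  rw [G.edge_eq_quad hp] at hy
  rcases hy with rfl | rfl | rfl | rfl
  · exact Or.inl rfl
  · exact Or.inr rfl
  · exact absurd e.symm h
  · exact absurd (e.symm.trans (vertexOf_side _)) h

theorem vertexOf_eq_iff {p q : G.Flag} : G.vertexOf p = G.vertexOf q ↔
    Quot.mk (fun f g => g = G.corner f ∨ g = G.side f) p = Quot.mk _ q :=
  ⟨Sum.inr.inj, congrArg _⟩

theorem joined_of_isLoop (h : G.IsLoop d) {p : G.Flag} (hp : p ∈ d.1) (S : Set G.Flag) :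
    Joined S p := by
  refine conn_of_le ?_ (vertexOf_eq_iff.1 ((isLoop_iff hp).1 h))
  rintro y z (rfl | rfl)
  exacts [Quot.sound (Or.inl rfl), Quot.sound (Or.inr (Or.inl rfl))]

theorem Joined.mono {S S' : Set G.Flag} (h : S ⊆ S') {p : G.Flag} (hp : Joined S p) :
    Joined S' p := by
  refine conn_of_le ?_ hp
  rintro y z (rfl | rfl | rfl)
  · exact Quot.sound (Or.inl rfl)
  · exact Quot.sound (Or.inr (Or.inl rfl))
  · by_cases hy : y ∈ S
    · rw [cutStrand_of_mem hy]
      exact Quot.sound (Or.inr (Or.inr (cutStrand_of_mem (h hy)).symm))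
    · rw [cutStrand_of_notMem hy]
      exact Quot.sound (Or.inr (Or.inl rfl))

theorem joined_empty_iff {p : G.Flag} (hp : p ∈ d.1) : Joined ∅ p ↔ G.IsLoop d := by
  refine ⟨fun h => (isLoop_iff hp).2 (vertexOf_eq_iff.2 (conn_of_le ?_ h)),
    fun h => joined_of_isLoop h hp _⟩
  rw [cutStrand_empty]
  rintro y z (rfl | rfl | rfl)
  exacts [Quot.sound (Or.inl rfl), Quot.sound (Or.inr rfl), Quot.sound (Or.inr rfl)]

/-- Restoring `d` to the full edge set of the deletion changes the number of components by zero or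
one, according to whether its ends are already joined. -/
theorem isBridge_iff {p : G.Flag} (hp : p ∈ d.1) :
    (G.IsBridge d ↔ ¬ Joined (Subtype.val '' {f : (G.delete d).Flag | ¬ (G.delete d).IsHalf f}) p) ∧
    (¬ G.IsBridge d → (G.delete d).numComponents = G.numComponents) := by
  have h1 := (isEdgeSet_delete d).1 (isEdgeSet_top (G.delete d))
  have h2 := notMem_image hp {f : (G.delete d).Flag | ¬ (G.delete d).IsHalf f}
  have h3 : (G.delete d).numComponents = _ :=
    (numComponents_eq _).trans (compNum_delete d _)
  have h4 : G.numComponents = _ := (numComponents_eq _).trans (congrArg G.compNum (top_eq_delete d))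
  rw [IsBridge]
  by_cases h : Joined (Subtype.val '' {f : (G.delete d).Flag | ¬ (G.delete d).IsHalf f}) p
  · have h5 := compNum_union_quad_of_joined h1 h2 h
    rw [← G.edge_eq_quad hp] at h5
    have h6 := h4.trans h5
    simp [h, h3, h6]
  · have h5 := compNum_union_quad_add_one h1 h2 h
    rw [← G.edge_eq_quad hp] at h5
    have h6 := (congrArg (· + 1) h4).trans (h5.trans h3.symm)
    simp only [h, not_false_eq_true, iff_true]
    exact ⟨Nat.lt_of_succ_le h6.le, fun h7 => absurd (Nat.lt_of_succ_le h6.le) h7⟩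

theorem not_isLoop_of_isBridge (h : G.IsBridge d) : ¬ G.IsLoop d := by
  obtain ⟨p, hp⟩ := G.exists_mem_edge d
  exact fun h' => (isBridge_iff hp).1.1 h (joined_of_isLoop h' hp _)

theorem not_joined_of_isBridge (h : G.IsBridge d) {p : G.Flag} (hp : p ∈ d.1) {S : Set G.Flag}
    (hS : G.IsEdgeSet S) (hSd : Disjoint S d.1) : ¬ Joined S p := by
  refine fun h' => (isBridge_iff hp).1.1 h (h'.mono fun f hf => ?_)
  have hf' : f ∉ d.1 := Set.disjoint_left.1 hSd hf
  exact ⟨⟨f, hf'⟩, fun h => hS.not_isHalf f hf ((isHalf_removeEdge _).1 h), rfl⟩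

open Classical in
-- A ribbon between two components never obstructs orientability: the signs of one component can all
-- be reversed to suit it.
theorem orientableOn_union_quad {S : Set G.Flag} {p : G.Flag}
    (h : ¬ Joined S p) : G.OrientableOn (S ∪ G.quad p) ↔ G.OrientableOn S := by
  constructor
  · rintro ⟨ε, hε⟩
    refine ⟨ε, fun y => ⟨(hε y).1, (hε y).2.1, ?_⟩⟩
    by_cases hy : y ∈ S
    · have := (hε y).2.2
      rwa [cutStrand_of_mem (Or.inl hy), ← cutStrand_of_mem hy] at this
    · rw [cutStrand_of_notMem hy]
      exact (hε y).2.1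
  · rintro ⟨ε, hε⟩
    let r : G.Flag → G.Flag → Prop :=
      fun f g => g = G.corner f ∨ g = G.side f ∨ g = G.cutStrand S f
    -- Reverse the signs on the component of `p`, but only if the new strand at `p` has equal signs
    -- at its ends.
    let m : G.Flag → Bool := fun y =>
      (decide (ε (G.strand p) = ε p)) && decide (Quot.mk r y = Quot.mk r p)
    have hm : ∀ y z, r y z → m y = m z := by
      intro y z hyz
      have : Quot.mk r y = Quot.mk r z := Quot.sound hyz
      simp only [m, this]
    have hmp : m (G.strand p) = false := by
      have : Quot.mk r (G.strand p) ≠ Quot.mk r p := fun e => h e.symm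
      simp [m, this]
    have hms : ∀ y, m (G.side y) = m y := fun y => (hm _ _ (Or.inr (Or.inl rfl))).symm
    let δ : G.Flag → Bool := fun y => xor (m y) (ε y)
    have hδ : ∀ y z, r y z → ε z ≠ ε y → δ z ≠ δ y := by
      intro y z hyz hz
      simp only [δ, hm y z hyz]
      cases m z <;> simpa using hz
    have hs : ∀ y, δ (G.side y) ≠ δ y := fun y => hδ y _ (Or.inr (Or.inl rfl)) (hε y).2.1
    have hp1 : δ (G.strand p) ≠ δ p := by
      simp only [δ, hmp]
      by_cases he : ε (G.strand p) = ε p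
      · have : m p = true := by simp [m, he]
        rw [this, he]
        cases ε p <;> simp
      · have : m p = false := by simp [m, he]
        rw [this]
        simpa using he
    have hp2 : δ (G.side (G.strand p)) ≠ δ (G.side p) := by
      have h1 := hs p
      have h2 := hs (G.strand p)
      revert h1 h2 hp1
      cases δ (G.strand p) <;> cases δ p <;> cases δ (G.side p) <;>
        cases δ (G.side (G.strand p)) <;> simp
    refine ⟨δ, fun y => ⟨hδ y _ (Or.inl rfl) (hε y).1, hs y, ?_⟩⟩
    rcases cutStrand_union_quad (S := S) (p := p) (f := y) with ⟨hy, e⟩ | ⟨hy, e⟩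
    · rw [e]
      rcases hy with rfl | rfl | rfl | rfl
      · exact hp1
      · rw [G.strand_side]; exact hp2
      · rw [G.strand_strand]; exact hp1.symm
      · rw [G.strand_side, G.strand_strand]; exact hp2.symm
    · rw [e]
      exact hδ y _ (Or.inr (Or.inr rfl)) (hε y).2.2

end Loops

/-! ### Statistics of a contraction -/

section Contract

variable {G : PinchedRibbonGraph} {d : G.Edge}

theorem isEdgeSet_contract {T : Set (G.contract d).Flag} :
    (G.contract d).IsEdgeSet T ↔ G.IsEdgeSet (Subtype.val '' T) := isEdgeSet_removeEdge

theorem cutStrand_contract (T : Set (G.contract d).Flag) (f : (G.contract d).Flag) :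
    ((G.contract d).cutStrand T f).1 = G.cutStrand (Subtype.val '' T ∪ d.1) f.1 :=
  cutStrand_removeEdge (fun f => (val_mem_image f).2 subset_rfl) f

theorem crossing_of_mem {f : G.Flag} (h : f ∈ d.1) : G.crossing d f = G.strand f := if_pos h

theorem crossing_of_notMem {f : G.Flag} (h : f ∉ d.1) : G.crossing d f = G.side f := if_neg h

theorem crossing_crossing (f : G.Flag) : G.crossing d (G.crossing d f) = f := by
  by_cases h : f ∈ d.1
  · rw [crossing_of_mem h, crossing_of_mem (G.edge_strand h), G.strand_strand]
  · rw [crossing_of_notMem h, crossing_of_notMem (G.edge_side_notMem h), G.side_side]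

theorem crossing_ne (f : G.Flag) : G.crossing d f ≠ f := by
  by_cases h : f ∈ d.1
  · rw [crossing_of_mem h]; exact G.strand_ne f
  · rw [crossing_of_notMem h]; exact G.side_ne f

theorem exists_crossing_orbits :
    ∃ a b, ∀ g, g ∈ d.1 ↔ g = a ∨ g = G.crossing d a ∨ g = b ∨ g = G.crossing d b := by
  obtain ⟨p, hp⟩ := G.exists_mem_edge d
  refine ⟨p, G.side p, fun g => ?_⟩
  rw [crossing_of_mem hp, crossing_of_mem (G.edge_side hp), G.edge_eq_quad hp, mem_quad,
    G.strand_side]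
  tauto

theorem contract_relation {S : Set G.Flag} (hSd : d.1 ⊆ S) :
    (∀ y z, (y ∉ d.1 ∧ z = G.side y ∨ z = G.cutStrand S y) → (y ∈ d.1 ↔ z ∈ d.1)) ∧
    (∀ y ∈ d.1, G.cutStrand S y = G.crossing d y) := by
  have h1 := fun f => (isEdgeSet_edge d).side_mem_iff (f := f)
  have h2 := fun f => (isEdgeSet_edge d).strand_mem_iff (f := f)
  refine ⟨?_, fun y hy => by rw [cutStrand_of_mem (hSd hy), crossing_of_mem hy]⟩
  rintro y z (⟨_, rfl⟩ | rfl)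
  · exact (h1 _).symm
  · by_cases h : y ∈ S
    · rw [cutStrand_of_mem h, h2]
    · rw [cutStrand_of_notMem h, h1]

theorem IsEdgeSet.union_edge {T : Set (G.contract d).Flag} (hT : (G.contract d).IsEdgeSet T) :
    G.IsEdgeSet (Subtype.val '' T ∪ d.1) :=
  (isEdgeSet_contract.1 hT).union (isEdgeSet_edge d)

/-- Boundary curves never use `side` on the flags of `d` once `d` is present, so loops need not be
excluded here. -/
theorem bdNum_contract (T : Set (G.contract d).Flag) :
    (G.contract d).bdNum T = G.bdNum (Subtype.val '' T ∪ d.1) := by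
  obtain ⟨h1, h2⟩ := contract_relation (Set.subset_union_right (s := Subtype.val '' T))
  rw [bdNum, bdNum, card_quot_removeEdge (d := d) (x := G.crossing d) (B := (G.contract d).Bare)
    (hB := (G.contract d).finite_bare) (hx := crossing_crossing) (hx' := crossing_ne)
    (hd := exists_crossing_orbits)
    (fun y z => z = G.cutStrand (Subtype.val '' T ∪ d.1) y) (fun y z h => h1 y z (Or.inr h))
    (fun y hy z hz => hz.trans (h2 y hy)) (fun y hy => (h2 y hy).symm), ← add_assoc]
  congr 1
  · exact Nat.card_sum
  · refine card_quot_of_iff fun y z => or_congr_right ?_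
    rw [← cutStrand_contract]
    exact Subtype.ext_iff

/-- The attaching segments of `d` disappear in the contraction. For a non-loop nothing is
disconnected thereby: walking the other way round the end vertex still joins `y` to `side y`. -/
theorem compNum_contract (hd : ¬ G.IsLoop d) (T : Set (G.contract d).Flag) :
    (G.contract d).compNum T = G.compNum (Subtype.val '' T ∪ d.1) := by
  set S := Subtype.val '' T ∪ d.1 with hS
  obtain ⟨h1, h2⟩ := contract_relation (Set.subset_union_right (s := Subtype.val '' T))
  have h3 : Nat.card (Quot fun f g => g = G.corner f ∨ g = G.side f ∨ g = G.cutStrand S f)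
      = Nat.card (Quot fun f g => g = G.corner f ∨ (f ∉ d.1 ∧ g = G.side f ∨
          g = G.cutStrand S f)) := by
    refine card_quot_congr ?_ ?_
    · rintro y z (rfl | rfl | rfl)
      · exact Quot.sound (Or.inl rfl)
      · by_cases hy : y ∈ d.1
        -- Connections within a vertex without the segments of `d`. As `y` and `side y` are the only
        -- flags of `d` at this vertex, parity keeps them connected.
        · let r₀ : G.Flag → G.Flag → Prop := fun f g => g = G.corner f ∨ f ∉ d.1 ∧ g = G.side f
          have key : Quot.mk r₀ (G.side y) = Quot.mk r₀ y := by
            refine apply_mem_of_involution (C := {f | Quot.mk r₀ f = Quot.mk r₀ y})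
              G.corner_corner G.corner_ne G.side_side G.side_ne rfl ?_ ?_
            · intro f hf
              exact (Quot.sound (Or.inl rfl) : Quot.mk r₀ f = _).symm.trans hf
            · intro f hf hfy hfy'
              refine (Quot.sound (Or.inr ⟨fun hfd => ?_, rfl⟩) : Quot.mk r₀ f = _).symm.trans hf
              have : G.vertexOf f = G.vertexOf y := vertexOf_eq_iff.2 (conn_of_le (by
                rintro a b (rfl | ⟨-, rfl⟩)
                exacts [Quot.sound (Or.inl rfl), Quot.sound (Or.inr rfl)]) hf)
              exact (eq_or_eq_side_of_not_isLoop hd hy hfd this).elim hfy hfy'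
          refine (conn_of_le ?_ key).symm
          rintro a b (rfl | h)
          exacts [Quot.sound (Or.inl rfl), Quot.sound (Or.inr (Or.inl h))]
        · exact Quot.sound (Or.inr (Or.inl ⟨hy, rfl⟩))
      · exact Quot.sound (Or.inr (Or.inr rfl))
    · rintro y z (rfl | ⟨-, rfl⟩ | rfl)
      · exact Quot.sound (Or.inl rfl)
      · exact Quot.sound (Or.inr (Or.inl rfl))
      · exact Quot.sound (Or.inr (Or.inr rfl))
  rw [compNum, compNum, h3,
    card_quot_removeEdge (d := d) (x := G.crossing d) (B := (G.contract d).Bare)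
    (hB := (G.contract d).finite_bare) (hx := crossing_crossing) (hx' := crossing_ne)
    (hd := exists_crossing_orbits)
    (fun y z => y ∉ d.1 ∧ z = G.side y ∨ z = G.cutStrand S y) h1
    (fun y hy z hz => hz.elim (fun h => absurd hy h.1) fun h => h.trans (h2 y hy))
    (fun y hy => Or.inr (h2 y hy).symm), ← add_assoc]
  congr 1
  · exact Nat.card_sum
  · refine card_quot_of_iff fun y z => or_congr_right (or_congr ?_ ?_)
    · rw [and_iff_right y.2]
      exact Subtype.ext_iff
    · rw [hS, ← cutStrand_contract]
      exact Subtype.ext_iff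

/-- The sign change across an attaching segment of `d` is no longer required explicitly. Around the
end vertex all other changes are required, and the signed parity count forces the missing one. -/
theorem orientableOn_contract (hd : ¬ G.IsLoop d) (T : Set (G.contract d).Flag) :
    (G.contract d).OrientableOn T ↔ G.OrientableOn (Subtype.val '' T ∪ d.1) := by
  set S := Subtype.val '' T ∪ d.1 with hS
  obtain ⟨h1, h2⟩ := contract_relation (Set.subset_union_right (s := Subtype.val '' T))
  refine (orientableOn_removeEdge (fun f => (val_mem_image f).2 subset_rfl)
    (fun y z => y ∉ d.1 ∧ z = G.side y ∨ z = G.cutStrand S y) h1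
    (fun y hy z hz => hz.elim (fun h => absurd hy h.1) fun h => h.trans (h2 y hy))
    (fun y hy => Or.inr (h2 y hy).symm)
    fun y hy z => by rw [and_iff_right hy]).trans ?_
  constructor
  · rintro ⟨ε, hε⟩
    refine ⟨ε, fun y => ⟨(hε y).1, ?_, (hε y).2 _ (Or.inr rfl)⟩⟩
    by_cases hy : y ∈ d.1
    · refine flip_of_involution (C := {f | G.vertexOf f = G.vertexOf y}) G.corner_corner
        G.corner_ne G.side_side G.side_ne rfl (fun f hf => (vertexOf_corner f).trans hf)
        (fun f hf => (vertexOf_side f).trans hf) (fun f _ => (hε f).1) fun f hf hfy hfy' => ?_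
      refine (hε f).2 _ (Or.inl ⟨fun hfd => ?_, rfl⟩)
      exact (eq_or_eq_side_of_not_isLoop hd hy hfd hf).elim hfy hfy'
    · exact (hε y).2 _ (Or.inl ⟨hy, rfl⟩)
  · rintro ⟨ε, hε⟩
    refine ⟨ε, fun y => ⟨(hε y).1, ?_⟩⟩
    rintro z (⟨-, rfl⟩ | rfl)
    exacts [(hε y).2.1, (hε y).2.2]

theorem edgeNum_contract {T : Set (G.contract d).Flag} (hT : (G.contract d).IsEdgeSet T) :
    G.edgeNum (Subtype.val '' T ∪ d.1) = (G.contract d).edgeNum T + 1 := by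
  obtain ⟨p, hp⟩ := G.exists_mem_edge d
  have h := edgeNum_union_quad (isEdgeSet_contract.1 hT) (notMem_image hp T)
    (G.not_isHalf_of_mem hp)
  rw [← G.edge_eq_quad hp] at h
  rw [h]
  exact congrArg (· + 1) (edgeNum_removeEdge T).symm

theorem numVertices_contract (hd : ¬ G.IsLoop d) :
    (G.contract d).numVertices + 1 = G.numVertices := by
  obtain ⟨p, hp⟩ := G.exists_mem_edge d
  rw [numVertices_eq_compNum, compNum_contract hd ∅, numVertices_eq_compNum,
    ← compNum_union_quad_add_one IsEdgeSet.empty (Set.notMem_empty p)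
      ((joined_empty_iff hp).not.2 hd), ← G.edge_eq_quad hp]
  exact congrArg (G.compNum · + 1) (congrArg (· ∪ d.1) (Set.image_empty _))

theorem nullNum_contract (hd : ¬ G.IsLoop d) {T : Set (G.contract d).Flag}
    (hT : (G.contract d).IsEdgeSet T) :
    (G.contract d).nullNum T = G.nullNum (Subtype.val '' T ∪ d.1) := by
  have h1 := hT.nullNum_add
  have h2 := hT.union_edge.nullNum_add
  rw [edgeNum_contract hT, ← compNum_contract hd T] at h2
  have h3 := numVertices_contract hd
  omega

theorem nonorNum_contract (hd : ¬ G.IsLoop d) (T : Set (G.contract d).Flag) :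
    (G.contract d).nonorNum T = G.nonorNum (Subtype.val '' T ∪ d.1) := by
  exact nonorNum_congr (orientableOn_contract hd T)

theorem numComponents_contract (hd : ¬ G.IsLoop d) :
    (G.contract d).numComponents = G.numComponents := by
  rw [numComponents_eq, compNum_contract hd _, numComponents_eq]
  exact congrArg G.compNum top_eq_removeEdge.symm

theorem numHalf_contract : (G.contract d).numHalf = G.numHalf := numHalf_removeEdge

theorem numEdges_contract : (G.contract d).numEdges + 1 = G.numEdges := numEdges_removeEdge

theorem card_flag_contract : Nat.card (G.contract d).Flag + 4 = Nat.card G.Flag :=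
  card_flag_removeEdge

end Contract

/-! ### Deletion–contraction for the Bollobás–Riordan polynomial -/

section Recursion

variable {K : Type*} [CommRing K] {G : PinchedRibbonGraph} {d : G.Edge}

theorem term_contract (hd : ¬ G.IsLoop d) {T : Set (G.contract d).Flag}
    (hT : (G.contract d).IsEdgeSet T) (x y z w : K) :
    (G.contract d).term x y z w T = G.term x y z w (Subtype.val '' T ∪ d.1) := by
  rw [term, term, compNum_contract hd T, nullNum_contract hd hT, bdNum_contract T,
    nonorNum_contract hd T, numComponents_contract hd]

theorem term_delete (h : (G.delete d).numComponents = G.numComponents) (T : Set (G.delete d).Flag)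
    (x y z w : K) :
    (G.delete d).term x y z w T = G.term x y z w (Subtype.val '' T) := by
  rw [term, term, compNum_delete d T, nullNum_delete d T, bdNum_delete d T,
    nonorNum_delete d T, h]

theorem brPoly_of_isRegular (hd : G.IsRegular d) (X Y Z W : K) :
    G.brPoly X Y Z W = (G.delete d).brPoly X Y Z W + (G.contract d).brPoly X Y Z W := by
  obtain ⟨p, hp⟩ := G.exists_mem_edge d
  rw [brPoly_eq_sum, brPoly_eq_sum, brPoly_eq_sum]
  have h1 : ∀ T ∈ (G.delete d).edgeSets, (G.delete d).term (X - 1) (Y - 1) Z W T = _ := fun T _ =>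
    term_delete ((isBridge_iff hp).2 hd.1) T (X - 1) (Y - 1) Z W
  have h2 : ∀ T ∈ (G.contract d).edgeSets, (G.contract d).term (X - 1) (Y - 1) Z W T = _ :=
    fun T hT => term_contract hd.2 ((mem_edgeSets _).1 hT) (X - 1) (Y - 1) Z W
  rw [Finset.sum_congr rfl h1, Finset.sum_congr rfl h2]
  have h3 : (G.delete d).edgeSets = (G.contract d).edgeSets := by
    ext T
    rw [mem_edgeSets]
    exact (isEdgeSet_delete d).trans (isEdgeSet_contract.symm.trans (mem_edgeSets _).symm)
  exact (sum_edgeSets_eq (hB := (G.delete d).finite_bare) (hx := G.side_side) (hx' := G.side_ne)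
    (hd := exists_side_orbits d) (G.term (X - 1) (Y - 1) Z W)).trans
    (congrArg (_ + ·) (Finset.sum_congr h3 fun _ _ => rfl))

/-- For an edge set avoiding the bridge, adding the bridge lowers the numbers of components and of
boundary curves by one and preserves nullity and orientability. The two summands are thus in ratio
`X - 1` to 1. -/
theorem brPoly_of_isBridge (hd : G.IsBridge d) (X Y Z W : K) :
    G.brPoly X Y Z W = X * (G.contract d).brPoly X Y Z W := by
  obtain ⟨p, hp⟩ := G.exists_mem_edge d
  have hl := not_isLoop_of_isBridge hd
  rw [brPoly_eq_sum, brPoly_eq_sum]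
  have h2 : ∀ T ∈ (G.contract d).edgeSets, (G.contract d).term (X - 1) (Y - 1) Z W T = _ :=
    fun T hT => term_contract hl ((mem_edgeSets _).1 hT) (X - 1) (Y - 1) Z W
  rw [Finset.sum_congr rfl h2]
  refine (sum_edgeSets_eq (d := d) (hB := (G.contract d).finite_bare)
    (hx := crossing_crossing) (hx' := crossing_ne) (hd := exists_crossing_orbits)
    (G.term (X - 1) (Y - 1) Z W)).trans ?_
  change ∑ T ∈ (G.contract d).edgeSets, _ + ∑ T ∈ (G.contract d).edgeSets, _ = _
  rw [← Finset.sum_add_distrib, Finset.mul_sum]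
  refine Finset.sum_congr rfl fun T hT => ?_
  have hT' := (mem_edgeSets _).1 hT
  have hS := isEdgeSet_contract.1 hT'
  have hpS := notMem_image hp T
  have hj := not_joined_of_isBridge hd hp hS (disjoint_image T)
  have e1 := compNum_union_quad_add_one hS hpS hj
  have e2 := bdNum_union_quad_add_one hS hpS (G.not_isHalf_of_mem hp) hj
  have e3 := edgeNum_union_quad hS hpS (G.not_isHalf_of_mem hp)
  have e4 := hS.nullNum_add
  have e5 := hT'.union_edge.nullNum_add
  have e6 : G.nonorNum (Subtype.val '' T ∪ d.1) = G.nonorNum (Subtype.val '' T) := by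
    have h := nonorNum_congr (orientableOn_union_quad hj)
    rwa [← G.edge_eq_quad hp] at h
  have e7 := G.numComponents_le (Subtype.val '' T ∪ d.1)
  rw [← G.edge_eq_quad hp] at e1 e2 e3
  have e8 : G.nullNum (Subtype.val '' T) = G.nullNum (Subtype.val '' T ∪ d.1) := by omega
  rw [term, term, e6, e8, ← e1, ← e2,
    show ∀ a b : ℕ, a + 1 + G.nullNum (Subtype.val '' T ∪ d.1) - (b + 1)
      = a + G.nullNum (Subtype.val '' T ∪ d.1) - b from fun a b => by omega,
    Nat.sub_add_comm e7, pow_succ]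
  ring

end Recursion

/-! ### Isomorphisms -/

section Iso

variable {G H : PinchedRibbonGraph} (φ : G.Flag ≃ H.Flag)

theorem cutStrand_iso (hs : ∀ f, φ (G.side f) = H.side (φ f))
    (ht : ∀ f, φ (G.strand f) = H.strand (φ f)) (S : Set G.Flag) (f : G.Flag) :
    φ (G.cutStrand S f) = H.cutStrand (φ '' S) (φ f) := by
  have h : φ f ∈ φ '' S ↔ f ∈ S := φ.injective.mem_set_image
  by_cases hf : f ∈ S
  · rw [cutStrand_of_mem hf, cutStrand_of_mem (h.2 hf), ht]
  · rw [cutStrand_of_notMem hf, cutStrand_of_notMem (h.not.2 hf), hs]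

theorem isEdgeSet_iso (hs : ∀ f, φ (G.side f) = H.side (φ f))
    (ht : ∀ f, φ (G.strand f) = H.strand (φ f)) {S : Set G.Flag} (hS : G.IsEdgeSet S) :
    H.IsEdgeSet (φ '' S) := by
  refine ⟨?_, ?_, ?_⟩
  · rintro _ ⟨f, hf, rfl⟩
    exact ⟨_, hS.side f hf, hs f⟩
  · rintro _ ⟨f, hf, rfl⟩
    exact ⟨_, hS.strand f hf, ht f⟩
  · rintro _ ⟨f, hf, rfl⟩ h
    exact hS.not_isHalf f hf (φ.injective (by rw [hs, ht]; exact h))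

theorem Iso.symm (h : Iso G H) : Iso H G := by
  obtain ⟨⟨b⟩, φ, h⟩ := h
  refine ⟨⟨b.symm⟩, φ.symm, fun f => ?_⟩
  obtain ⟨h1, h2, h3⟩ := h (φ.symm f)
  simp only [Equiv.apply_symm_apply] at h1 h2 h3
  exact ⟨φ.symm_apply_eq.2 h1.symm, φ.symm_apply_eq.2 h2.symm, φ.symm_apply_eq.2 h3.symm⟩

/-- The numerical data that enter the recipe theorem. -/
structure SameData {K : Type*} [CommRing K] (G H : PinchedRibbonGraph) (X Y Z W : K) : Prop where
  numVertices : G.numVertices = H.numVertices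
  numComponents : G.numComponents = H.numComponents
  numEdges : G.numEdges = H.numEdges
  numHalf : G.numHalf = H.numHalf
  brPoly : G.brPoly X Y Z W = H.brPoly X Y Z W

theorem Iso.sameData {K : Type*} [CommRing K] (h : Iso G H) (X Y Z W : K) :
    SameData G H X Y Z W := by
  obtain ⟨⟨b⟩, φ, h⟩ := h
  have hc := fun f => (h f).1
  have hs := fun f => (h f).2.1
  have ht := fun f => (h f).2.2
  have hS := cutStrand_iso φ hs ht
  have hb : Nat.card G.Bare = Nat.card H.Bare := Nat.card_congr b
  have hbd : ∀ S, G.bdNum S = H.bdNum (φ '' S) := by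
    intro S
    rw [bdNum, bdNum, hb]
    congr 1
    refine Nat.card_congr (Quot.congr φ fun y z => ?_)
    rw [← hc, ← hS, φ.apply_eq_iff_eq, φ.apply_eq_iff_eq]
  have hk : ∀ S, G.compNum S = H.compNum (φ '' S) := by
    intro S
    rw [compNum, compNum, hb]
    congr 1
    refine Nat.card_congr (Quot.congr φ fun y z => ?_)
    rw [← hc, ← hS, ← hs, φ.apply_eq_iff_eq, φ.apply_eq_iff_eq, φ.apply_eq_iff_eq]
  have ho : ∀ S, G.nonorNum S = H.nonorNum (φ '' S) := by
    intro S
    refine nonorNum_congr ⟨?_, ?_⟩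
    · rintro ⟨ε, hε⟩
      refine ⟨fun y => ε (φ.symm y), fun y => ?_⟩
      obtain ⟨y, rfl⟩ := φ.surjective y
      rw [← hc, ← hS, ← hs]
      simpa using hε y
    · rintro ⟨ε, hε⟩
      refine ⟨fun y => ε (φ y), fun y => ?_⟩
      have h := hε (φ y)
      rwa [← hc, ← hS, ← hs] at h
  have he : ∀ S, G.edgeNum S = H.edgeNum (φ '' S) := fun S =>
    congrArg (· / 4) (Set.ncard_image_of_injective S φ.injective).symm
  have hh : ∀ f, G.IsHalf f ↔ H.IsHalf (φ f) := fun f => by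
    rw [IsHalf, IsHalf, ← hs, ← ht, φ.apply_eq_iff_eq]
  have htop : φ '' {f | ¬ G.IsHalf f} = {f | ¬ H.IsHalf f} := by
    ext f
    obtain ⟨f, rfl⟩ := φ.surjective f
    rw [φ.injective.mem_set_image]
    exact not_congr (hh f)
  have hv : G.numVertices = H.numVertices := by
    rw [numVertices_eq_bdNum, hbd, Set.image_empty, ← numVertices_eq_bdNum]
  have hk' : G.numComponents = H.numComponents := by
    rw [numComponents_eq, hk, htop, ← numComponents_eq]
  refine ⟨hv, hk', by rw [numEdges_eq, he, htop, ← numEdges_eq], ?_, ?_⟩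
  · have h1 := G.two_mul_numHalf
    have h2 := H.two_mul_numHalf
    have h3 : φ '' {f | G.IsHalf f} = {f | H.IsHalf f} := by
      ext f
      obtain ⟨f, rfl⟩ := φ.surjective f
      rw [φ.injective.mem_set_image]
      exact hh f
    rw [← h3, Set.ncard_image_of_injective _ φ.injective] at h2
    omega
  · rw [brPoly_eq_sum, brPoly_eq_sum]
    refine Finset.sum_bij (fun S _ => φ '' S)
      (fun S hS => (mem_edgeSets _).2 (isEdgeSet_iso φ hs ht ((mem_edgeSets _).1 hS)))
      (fun _ _ _ _ h => φ.injective.image_injective h) (fun S hS => ?_) fun S hS => ?_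
    · refine ⟨φ.symm '' S, (mem_edgeSets _).2 (isEdgeSet_iso φ.symm ?_ ?_ ((mem_edgeSets _).1 hS)),
        ?_⟩
      · intro f
        rw [φ.symm_apply_eq, hs, φ.apply_symm_apply]
      · intro f
        rw [φ.symm_apply_eq, ht, φ.apply_symm_apply]
      · rw [← Set.image_comp]; simp
    · rw [term, term, nullNum, nullNum, ← hk, ← hbd, ← ho, ← he, hv, hk']

end Iso

/-! ### Disjoint unions -/

section DisjointUnion

theorem card_quot_sigma {ι : Type} [Fintype ι] {F : ι → Type} [∀ i, Finite (F i)]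
    {R : (Σ i, F i) → (Σ i, F i) → Prop} {r : ∀ i, F i → F i → Prop}
    (h1 : ∀ y z, R y z → (⟨y.1, Quot.mk _ y.2⟩ : Σ i, Quot (r i)) = ⟨z.1, Quot.mk _ z.2⟩)
    (h2 : ∀ i y z, r i y z → R ⟨i, y⟩ ⟨i, z⟩) :
    Nat.card (Quot R) = ∑ i, Nat.card (Quot (r i)) := by
  rw [← Nat.card_sigma]
  exact Nat.card_congr
    { toFun := Quot.lift (fun y => (⟨y.1, Quot.mk _ y.2⟩ : Σ i, Quot (r i))) h1
      invFun := fun p => Quot.lift (fun y => Quot.mk R ⟨p.1, y⟩)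
        (fun y z h => Quot.sound (h2 p.1 y z h)) p.2
      left_inv := by rintro ⟨y⟩; rfl
      right_inv := by rintro ⟨i, ⟨y⟩⟩; rfl }

theorem ncard_sigma {ι : Type} [Fintype ι] {F : ι → Type} [∀ i, Finite (F i)]
    (S : Set (Σ i, F i)) : S.ncard = ∑ i, (Sigma.mk i ⁻¹' S : Set (F i)).ncard := by
  simp only [← Nat.card_coe_set_eq]
  rw [← Nat.card_sigma]
  exact Nat.card_congr
    { toFun := fun y => ⟨y.1.1, y.1.2, y.2⟩
      invFun := fun p => ⟨⟨p.1, p.2.1⟩, p.2.2⟩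
      left_inv := fun _ => rfl
      right_inv := fun _ => rfl }

variable {n : ℕ} {B : Fin n → PinchedRibbonGraph} {S : Set (disjointUnion B).Flag}

/-- The flags of the `i`-th summand that belong to `S`. -/
def part (S : Set (disjointUnion B).Flag) (i : Fin n) : Set (B i).Flag :=
  {f | (show (disjointUnion B).Flag from Sigma.mk i f) ∈ S}

theorem cutStrand_disjointUnion (f : (disjointUnion B).Flag) :
    (disjointUnion B).cutStrand S f = ⟨f.1, (B f.1).cutStrand (part S f.1) f.2⟩ := by
  by_cases h : f ∈ S
  · rw [cutStrand_of_mem h, cutStrand_of_mem (by exact h)]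
    rfl
  · rw [cutStrand_of_notMem h, cutStrand_of_notMem (by exact h)]
    rfl

theorem isEdgeSet_disjointUnion :
    (disjointUnion B).IsEdgeSet S ↔ ∀ i, (B i).IsEdgeSet (part S i) := by
  have hh : ∀ i f, (disjointUnion B).IsHalf ⟨i, f⟩ ↔ (B i).IsHalf f := fun i f =>
    ⟨fun h => eq_of_heq (Sigma.mk.inj h).2, fun h => congrArg (Sigma.mk i) h⟩
  constructor
  · exact fun h i => ⟨fun f hf => h.side _ hf, fun f hf => h.strand _ hf,
      fun f hf h' => h.not_isHalf _ hf ((hh i f).2 h')⟩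
  · exact fun h => ⟨fun f hf => (h f.1).side _ hf, fun f hf => (h f.1).strand _ hf,
      fun f hf h' => (h f.1).not_isHalf _ hf ((hh f.1 f.2).1 h')⟩

theorem compNum_disjointUnion (S : Set (disjointUnion B).Flag) :
    (disjointUnion B).compNum S = ∑ i, (B i).compNum (part S i) := by
  simp only [compNum, Finset.sum_add_distrib]
  congr 1
  · exact Nat.card_sigma
  · refine card_quot_sigma ?_ ?_
    · rintro y z (rfl | rfl | h)
      · exact congrArg (Sigma.mk y.1) (Quot.sound (Or.inl rfl))
      · exact congrArg (Sigma.mk y.1) (Quot.sound (Or.inr (Or.inl rfl)))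
      · obtain rfl := h.trans (cutStrand_disjointUnion (S := S) y)
        exact congrArg (Sigma.mk y.1) (Quot.sound (Or.inr (Or.inr rfl)))
    · rintro i y z (rfl | rfl | rfl)
      · exact Or.inl rfl
      · exact Or.inr (Or.inl rfl)
      · exact Or.inr (Or.inr (cutStrand_disjointUnion (S := S) ⟨i, y⟩).symm)

theorem bdNum_disjointUnion (S : Set (disjointUnion B).Flag) :
    (disjointUnion B).bdNum S = ∑ i, (B i).bdNum (part S i) := by
  simp only [bdNum, Finset.sum_add_distrib]
  congr 1
  · exact Nat.card_sigma
  · refine card_quot_sigma ?_ ?_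
    · rintro y z (rfl | h)
      · exact congrArg (Sigma.mk y.1) (Quot.sound (Or.inl rfl))
      · obtain rfl := h.trans (cutStrand_disjointUnion (S := S) y)
        exact congrArg (Sigma.mk y.1) (Quot.sound (Or.inr rfl))
    · rintro i y z (rfl | rfl)
      · exact Or.inl rfl
      · exact Or.inr (cutStrand_disjointUnion (S := S) ⟨i, y⟩).symm

theorem orientableOn_disjointUnion (S : Set (disjointUnion B).Flag) :
    (disjointUnion B).OrientableOn S ↔ ∀ i, (B i).OrientableOn (part S i) := by
  constructor
  · rintro ⟨ε, hε⟩ i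
    refine ⟨fun y => ε ⟨i, y⟩, fun y => ?_⟩
    obtain ⟨h1, h2, h3⟩ := hε ⟨i, y⟩
    exact ⟨h1, h2, (congrArg ε (cutStrand_disjointUnion (S := S) ⟨i, y⟩)).symm.trans_ne h3⟩
  · intro h
    choose ε hε using h
    refine ⟨fun y => ε y.1 y.2, fun y => ?_⟩
    rw [cutStrand_disjointUnion]
    exact hε y.1 y.2

theorem edgeNum_disjointUnion (hS : (disjointUnion B).IsEdgeSet S) :
    (disjointUnion B).edgeNum S = ∑ i, (B i).edgeNum (part S i) := by
  have h1 := hS.four_mul_edgeNum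
  have h2 : S.ncard = ∑ i, (part S i).ncard := ncard_sigma S
  simp only [← (isEdgeSet_disjointUnion.1 hS _).four_mul_edgeNum, ← Finset.mul_sum] at h2
  omega

theorem numVertices_disjointUnion : (disjointUnion B).numVertices = ∑ i, (B i).numVertices := by
  simp only [numVertices_eq_bdNum, bdNum_disjointUnion]
  rfl

theorem top_disjointUnion (i : Fin n) :
    part {f | ¬ (disjointUnion B).IsHalf f} i = {f | ¬ (B i).IsHalf f} := by
  ext f
  exact not_congr ⟨fun h => eq_of_heq (Sigma.mk.inj h).2, fun h => congrArg (Sigma.mk i) h⟩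

theorem numComponents_disjointUnion :
    (disjointUnion B).numComponents = ∑ i, (B i).numComponents := by
  simp only [numComponents_eq, compNum_disjointUnion, top_disjointUnion]

theorem numEdges_disjointUnion : (disjointUnion B).numEdges = ∑ i, (B i).numEdges := by
  simp only [numEdges_eq, edgeNum_disjointUnion (isEdgeSet_top _), top_disjointUnion]

theorem numHalf_disjointUnion : (disjointUnion B).numHalf = ∑ i, (B i).numHalf := by
  have h1 := (disjointUnion B).two_mul_numHalf
  have h2 : {f | (disjointUnion B).IsHalf f}.ncard
      = ∑ i, (part {f | (disjointUnion B).IsHalf f} i).ncard := ncard_sigma _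
  have h3 : ∀ i, part {f | (disjointUnion B).IsHalf f} i = {f | (B i).IsHalf f} := by
    intro i
    ext f
    exact ⟨fun h => eq_of_heq (Sigma.mk.inj h).2, fun h => congrArg (Sigma.mk i) h⟩
  simp only [h3, ← two_mul_numHalf, ← Finset.mul_sum] at h2
  omega

theorem nullNum_disjointUnion (hS : (disjointUnion B).IsEdgeSet S) :
    (disjointUnion B).nullNum S = ∑ i, (B i).nullNum (part S i) := by
  have h1 := hS.nullNum_add
  have h2 := Finset.sum_congr (s₁ := Finset.univ) rfl
    fun i _ => (isEdgeSet_disjointUnion.1 hS i).nullNum_add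
  rw [Finset.sum_add_distrib, Finset.sum_add_distrib, ← numVertices_disjointUnion,
    ← edgeNum_disjointUnion hS, ← compNum_disjointUnion] at h2
  omega

variable {K : Type*} [CommRing K]

/-- Orientability of a union or join is a conjunction, so the parameter is a maximum and not a sum.
At an idempotent only the vanishing of the exponent matters. -/
theorem pow_eq_pow_of_idempotent {v : K} (hv : v = v ^ 2) {a b : ℕ} (h : a = 0 ↔ b = 0) :
    v ^ a = v ^ b := by
  have key : ∀ a : ℕ, v ^ (a + 1) = v := by
    intro a
    induction a with
    | zero => simp
    | succ a ih => rw [pow_succ, ih, ← sq, ← hv]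
  rcases a with _ | a <;> rcases b with _ | b
  · rfl
  · omega
  · omega
  · rw [key, key]

theorem nonorNum_eq_zero {G : PinchedRibbonGraph} {S : Set G.Flag} :
    G.nonorNum S = 0 ↔ G.OrientableOn S := by
  classical
  simp [nonorNum]

/-- All exponents but that of `w` are sums. The subtractions distribute over these sums because each
is exact in every summand. -/
theorem term_disjointUnion {w : K} (hw : w = w ^ 2) (hS : (disjointUnion B).IsEdgeSet S)
    (x y z : K) : (disjointUnion B).term x y z w S
      = ∏ i, (B i).term x y z w (part S i) := by
  have hw' : w ^ (disjointUnion B).nonorNum S = w ^ ∑ i, (B i).nonorNum (part S i) := by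
    refine pow_eq_pow_of_idempotent hw ?_
    rw [nonorNum_eq_zero, Finset.sum_eq_zero_iff, orientableOn_disjointUnion]
    simp only [Finset.mem_univ, true_implies, nonorNum_eq_zero]
  simp only [term, Finset.prod_mul_distrib, Finset.prod_pow_eq_pow_sum]
  rw [hw', nullNum_disjointUnion hS, compNum_disjointUnion, bdNum_disjointUnion,
    numComponents_disjointUnion, ← Finset.sum_add_distrib,
    ← Finset.sum_tsub_distrib _ fun i _ => (B i).numComponents_le _,
    ← Finset.sum_tsub_distrib _ fun i _ => (isEdgeSet_disjointUnion.1 hS i).bdNum_le]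

theorem brPoly_disjointUnion {W : K} (hW : W = W ^ 2) (X Y Z : K) :
    (disjointUnion B).brPoly X Y Z W = ∏ i, (B i).brPoly X Y Z W := by
  simp only [brPoly_eq_sum]
  rw [Finset.prod_univ_sum]
  refine Finset.sum_bij (fun S _ i => part S i) ?_ ?_ ?_ ?_
  · intro S hS
    rw [Fintype.mem_piFinset]
    exact fun i => (mem_edgeSets _).2 (isEdgeSet_disjointUnion.1 ((mem_edgeSets _).1 hS) i)
  · intro S _ S' _ h
    ext f
    exact Set.ext_iff.1 (congrFun h f.1) f.2
  · intro T hT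
    rw [Fintype.mem_piFinset] at hT
    refine ⟨{f | f.2 ∈ T f.1}, (mem_edgeSets _).2 (isEdgeSet_disjointUnion.2 fun i => ?_), rfl⟩
    exact (mem_edgeSets _).1 (hT i)
  · intro S hS
    exact term_disjointUnion hW ((mem_edgeSets _).1 hS) _ _ _

end DisjointUnion

/-! ### Joins of bouquets -/

section Join

theorem card_quot_sum {F F' : Type} [Finite F] [Finite F'] {R : F ⊕ F' → F ⊕ F' → Prop}
    {r : F → F → Prop} {r' : F' → F' → Prop}
    (h1 : ∀ y z, R y z → (Sum.map (Quot.mk r) (Quot.mk r') y) = Sum.map (Quot.mk r) (Quot.mk r') z)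
    (h2 : ∀ y z, r y z → R (Sum.inl y) (Sum.inl z))
    (h3 : ∀ y z, r' y z → R (Sum.inr y) (Sum.inr z)) :
    Nat.card (Quot R) = Nat.card (Quot r) + Nat.card (Quot r') := by
  rw [← Nat.card_sum]
  exact Nat.card_congr
    { toFun := Quot.lift (Sum.map (Quot.mk r) (Quot.mk r')) h1
      invFun := Sum.elim
        (Quot.lift (fun y => Quot.mk R (Sum.inl y)) fun y z h => Quot.sound (h2 y z h))
        (Quot.lift (fun y => Quot.mk R (Sum.inr y)) fun y z h => Quot.sound (h3 y z h))
      left_inv := by rintro ⟨y | y⟩ <;> rfl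
      right_inv := by rintro (⟨⟨y⟩⟩ | ⟨⟨y⟩⟩) <;> rfl }

theorem ncard_sum {F F' : Type} [Finite F] [Finite F'] (S : Set (F ⊕ F')) :
    S.ncard = (Sum.inl ⁻¹' S).ncard + (Sum.inr ⁻¹' S).ncard := by
  rw [← Set.ncard_image_of_injective (Sum.inl ⁻¹' S) (Sum.inl_injective (β := F')),
    ← Set.ncard_image_of_injective (Sum.inr ⁻¹' S) (Sum.inr_injective (α := F)),
    ← Set.ncard_union_eq]
  · congr 1
    ext (f | f) <;> simp
  · rw [Set.disjoint_left]
    rintro _ ⟨f, _, rfl⟩ ⟨g, _, h⟩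
    cases h

variable {G H : PinchedRibbonGraph} {a : G.Flag} {b : H.Flag} {S : Set (G.join H a b).Flag}

/-- The flags of the first summand that belong to `S`. -/
def leftPart (S : Set (G.join H a b).Flag) : Set G.Flag :=
  {f | (show (G.join H a b).Flag from Sum.inl f) ∈ S}

/-- The flags of the second summand that belong to `S`. -/
def rightPart (S : Set (G.join H a b).Flag) : Set H.Flag :=
  {f | (show (G.join H a b).Flag from Sum.inr f) ∈ S}

theorem compNum_of_isBouquet (hG : G.IsBouquet) (S : Set G.Flag) : G.compNum S = 1 := by
  have h1 := G.compNum_le S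
  rw [hG] at h1
  have h2 : 0 < G.numVertices := by rw [hG]; exact one_pos
  rw [numVertices_eq] at h2
  rcases Nat.eq_zero_or_pos (Nat.card G.Bare) with h | h
  · have : 0 < Nat.card (Quot fun f g : G.Flag => g = G.corner f ∨ g = G.side f) := by omega
    obtain ⟨⟨f⟩⟩ := (Nat.card_pos_iff.1 this).1
    have : 0 < Nat.card (Quot fun f g : G.Flag =>
        g = G.corner f ∨ g = G.side f ∨ g = G.cutStrand S f) :=
      Nat.card_pos_iff.2 ⟨⟨Quot.mk _ f⟩, inferInstance⟩
    rw [compNum] at *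
    omega
  · rw [compNum] at *
    omega

theorem numComponents_of_isBouquet (hG : G.IsBouquet) : G.numComponents = 1 := by
  rw [numComponents_eq, compNum_of_isBouquet hG]

theorem nullNum_of_isBouquet (hG : G.IsBouquet) {S : Set G.Flag} (hS : G.IsEdgeSet S) :
    G.nullNum S = G.edgeNum S := by
  have h1 := hS.nullNum_add
  rw [compNum_of_isBouquet hG, hG] at h1
  omega

theorem corner_join_inl : (G.join H a b).corner (Sum.inl a) = Sum.inr b :=
  if_pos rfl

theorem corner_join_inl_corner :
    (G.join H a b).corner (Sum.inl (G.corner a)) = Sum.inr (H.corner b) :=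
  (if_neg (G.corner_ne a)).trans (if_pos rfl)

theorem corner_join_inr : (G.join H a b).corner (Sum.inr b) = Sum.inl a :=
  if_pos rfl

theorem corner_join_inr_corner :
    (G.join H a b).corner (Sum.inr (H.corner b)) = Sum.inl (G.corner a) :=
  (if_neg (H.corner_ne b)).trans (if_pos rfl)

theorem corner_join_of_ne {f : G.Flag ⊕ H.Flag} (h1 : f ≠ Sum.inl a)
    (h2 : f ≠ Sum.inl (G.corner a)) (h3 : f ≠ Sum.inr b) (h4 : f ≠ Sum.inr (H.corner b)) :
    (G.join H a b).corner f = Sum.map G.corner H.corner f := by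
  rcases f with f | f
  · exact (if_neg fun h => h1 (congrArg _ h)).trans (if_neg fun h => h2 (congrArg _ h))
  · exact (if_neg fun h => h3 (congrArg _ h)).trans (if_neg fun h => h4 (congrArg _ h))

theorem cutStrand_join (f : (G.join H a b).Flag) : (G.join H a b).cutStrand S f
      = Sum.map (G.cutStrand (leftPart S)) (H.cutStrand (rightPart S)) f := by
  by_cases h : f ∈ S
  · rw [cutStrand_of_mem h]
    rcases f with f | f
    · exact congrArg Sum.inl (cutStrand_of_mem (show f ∈ leftPart S from h)).symm
    · exact congrArg Sum.inr (cutStrand_of_mem (show f ∈ rightPart S from h)).symm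
  · rw [cutStrand_of_notMem h]
    rcases f with f | f
    · exact congrArg Sum.inl (cutStrand_of_notMem (show f ∉ leftPart S from h)).symm
    · exact congrArg Sum.inr (cutStrand_of_notMem (show f ∉ rightPart S from h)).symm

theorem isHalf_join_inl {f : G.Flag} : (G.join H a b).IsHalf (Sum.inl f) ↔ G.IsHalf f :=
  ⟨fun h => Sum.inl_injective h, fun h => congrArg Sum.inl h⟩

theorem isHalf_join_inr {f : H.Flag} : (G.join H a b).IsHalf (Sum.inr f) ↔ H.IsHalf f :=
  ⟨fun h => Sum.inr_injective h, fun h => congrArg Sum.inr h⟩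

theorem isEdgeSet_join : (G.join H a b).IsEdgeSet S ↔
    G.IsEdgeSet (leftPart S) ∧ H.IsEdgeSet (rightPart S) := by
  constructor
  · exact fun h => ⟨⟨fun f hf => h.side _ hf, fun f hf => h.strand _ hf,
      fun f hf h' => h.not_isHalf _ hf (isHalf_join_inl.2 h')⟩,
      ⟨fun f hf => h.side _ hf, fun f hf => h.strand _ hf,
      fun f hf h' => h.not_isHalf _ hf (isHalf_join_inr.2 h')⟩⟩
  · rintro ⟨h, h'⟩
    refine ⟨?_, ?_, ?_⟩
    · rintro (f | f) hf
      exacts [h.side f hf, h'.side f hf]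
    · rintro (f | f) hf
      exacts [h.strand f hf, h'.strand f hf]
    · rintro (f | f) hf
      · exact fun h' => h.not_isHalf f hf (isHalf_join_inl.1 h')
      · exact fun h => h'.not_isHalf f hf (isHalf_join_inr.1 h)

/-- The join switches `corner` at the two arcs while the strands stay fixed, so the switching lemma
applies with the roles of arcs and strands exchanged. The two curves through `a` and `b` become one.
-/
theorem bdNum_join (hS : (G.join H a b).IsEdgeSet S) : (G.join H a b).bdNum S + 1
      = G.bdNum (leftPart S) + H.bdNum (rightPart S) := by
  let t : G.Flag ⊕ H.Flag → G.Flag ⊕ H.Flag := Sum.map G.corner H.corner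
  let c : G.Flag ⊕ H.Flag → G.Flag ⊕ H.Flag := (G.join H a b).cutStrand S
  have hc : ∀ f, c f = Sum.map (G.cutStrand (leftPart S)) (H.cutStrand (rightPart S)) f :=
    cutStrand_join
  have ht : ∀ f, t (t f) = f := by
    rintro (f | f)
    exacts [congrArg Sum.inl (G.corner_corner f), congrArg Sum.inr (H.corner_corner f)]
  have ht' : ∀ f, t f ≠ f := by
    rintro (f | f) h
    exacts [G.corner_ne f (Sum.inl_injective h), H.corner_ne f (Sum.inr_injective h)]
  have h1 := card_quot_switch_add_one (c := c) (t := t) (t' := (G.join H a b).corner)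
    (p := Sum.inl a) (q := Sum.inr b) hS.cutStrand_cutStrand
    (fun f => (G.join H a b).cutStrand_ne f) ht ht'
    (G.join H a b).corner_corner corner_join_inl corner_join_inl_corner
    (fun y => corner_join_of_ne) (fun h => by
      have := (mem_iff_of_conn (C := {f : G.Flag ⊕ H.Flag | f.isLeft = true}) (by
        rintro (y | y) z (rfl | rfl) <;> simp [hc, t]) h).1 (by simp)
      simp at this)
  have h2 : Nat.card (Quot fun y z => z = c y ∨ z = t y) =
      Nat.card (Quot fun f g : G.Flag => g = G.corner f ∨ g = G.cutStrand (leftPart S) f) +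
      Nat.card (Quot fun f g : H.Flag => g = H.corner f ∨ g = H.cutStrand (rightPart S) f) := by
    refine card_quot_sum ?_ ?_ ?_
    · rintro (y | y) z (rfl | rfl)
      · rw [hc]
        exact congrArg Sum.inl (Quot.sound (Or.inr rfl))
      · exact congrArg Sum.inl (Quot.sound (Or.inl rfl))
      · rw [hc]
        exact congrArg Sum.inr (Quot.sound (Or.inr rfl))
      · exact congrArg Sum.inr (Quot.sound (Or.inl rfl))
    · rintro y z (rfl | rfl)
      · exact Or.inr rfl
      · exact Or.inl (hc (Sum.inl y)).symm
    · rintro y z (rfl | rfl)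
      · exact Or.inr rfl
      · exact Or.inl (hc (Sum.inr y)).symm
  have h3 : Nat.card (Quot fun f g => g = (G.join H a b).corner f ∨
      g = (G.join H a b).cutStrand S f) = Nat.card (Quot fun f g => g = c f ∨
      g = (G.join H a b).corner f) := card_quot_of_iff fun y z => or_comm
  have h4 : Nat.card (G.join H a b).Bare = Nat.card G.Bare + Nat.card H.Bare := Nat.card_sum
  have h5 : (G.join H a b).bdNum S = Nat.card (G.join H a b).Bare + _ := congrArg (_ + ·) h3
  rw [h5, bdNum, bdNum, h4, add_assoc, h1, h2]
  ring

/-- Without edges the boundary components are the vertices, so this is the boundary count for the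
empty edge set. -/
theorem numVertices_join : (G.join H a b).numVertices + 1 = G.numVertices + H.numVertices := by
  simp only [numVertices_eq_bdNum]
  exact bdNum_join IsEdgeSet.empty

theorem isBouquet_join (hG : G.IsBouquet) (hH : H.IsBouquet) : (G.join H a b).IsBouquet := by
  have := numVertices_join (G := G) (H := H) (a := a) (b := b)
  rw [hG, hH] at this
  exact Nat.succ_injective this

theorem edgeNum_join (hS : (G.join H a b).IsEdgeSet S) :
    (G.join H a b).edgeNum S = G.edgeNum (leftPart S) + H.edgeNum (rightPart S) := by
  have h1 := hS.four_mul_edgeNum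
  have h2 := (isEdgeSet_join.1 hS).1.four_mul_edgeNum
  have h3 := (isEdgeSet_join.1 hS).2.four_mul_edgeNum
  have h4 : S.ncard = (leftPart S).ncard + (rightPart S).ncard :=
    ncard_sum S
  omega

theorem numEdges_join : (G.join H a b).numEdges = G.numEdges + H.numEdges := by
  rw [numEdges_eq, edgeNum_join (isEdgeSet_top _), numEdges_eq, numEdges_eq]
  congr 2
  · ext f; exact not_congr isHalf_join_inl
  · ext f; exact not_congr isHalf_join_inr

theorem numHalf_join : (G.join H a b).numHalf = G.numHalf + H.numHalf := by
  have h1 := (G.join H a b).two_mul_numHalf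
  have h2 : {f | (G.join H a b).IsHalf f}.ncard
      = {f | G.IsHalf f}.ncard + {f | H.IsHalf f}.ncard := by
    refine (ncard_sum _).trans ?_
    congr 2
    · ext f; exact isHalf_join_inl
    · ext f; exact isHalf_join_inr
  have h3 := G.two_mul_numHalf
  have h4 := H.two_mul_numHalf
  omega

theorem orientableOn_join : (G.join H a b).OrientableOn S ↔
    G.OrientableOn (leftPart S) ∧ H.OrientableOn (rightPart S) := by
  constructor
  · rintro ⟨ε, hε⟩
    have hcut := fun f => (hε f).2.2
    simp only [cutStrand_join] at hcut
    refine ⟨⟨fun f => ε (Sum.inl f), fun f => ⟨?_, (hε (Sum.inl f)).2.1, hcut (Sum.inl f)⟩⟩,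
      ⟨fun f => ε (Sum.inr f), fun f => ⟨?_, (hε (Sum.inr f)).2.1, hcut (Sum.inr f)⟩⟩⟩
    · have h1 : ∀ f, f ≠ a → f ≠ G.corner a → ε (Sum.inl (G.corner f)) ≠ ε (Sum.inl f) := by
        intro f h1 h2
        have h := (hε (Sum.inl f)).1
        rwa [corner_join_of_ne (fun h => h1 (Sum.inl_injective h))
          (fun h => h2 (Sum.inl_injective h)) (by simp) (by simp)] at h
      -- The arc at `a` is the only one of `G` broken by the join, so the sign change along it is
      -- forced by the others.
      have h2 := flip_of_involution (C := Set.univ) (p := a) (ε := fun f => ε (Sum.inl f))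
        G.side_side G.side_ne G.corner_corner G.corner_ne trivial (fun _ _ => trivial)
        (fun _ _ => trivial) (fun f _ => (hε (Sum.inl f)).2.1) (fun f _ => h1 f)
      by_cases h3 : f = a
      · rw [h3]; exact h2
      by_cases h4 : f = G.corner a
      · rw [h4, G.corner_corner]; exact h2.symm
      exact h1 f h3 h4
    · have h1 : ∀ f, f ≠ b → f ≠ H.corner b → ε (Sum.inr (H.corner f)) ≠ ε (Sum.inr f) := by
        intro f h1 h2
        have h := (hε (Sum.inr f)).1
        rwa [corner_join_of_ne (by simp) (by simp) (fun h => h1 (Sum.inr_injective h))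
          (fun h => h2 (Sum.inr_injective h))] at h
      have h2 := flip_of_involution (C := Set.univ) (p := b) (ε := fun f => ε (Sum.inr f))
        H.side_side H.side_ne H.corner_corner H.corner_ne trivial (fun _ _ => trivial)
        (fun _ _ => trivial) (fun f _ => (hε (Sum.inr f)).2.1) (fun f _ => h1 f)
      by_cases h3 : f = b
      · rw [h3]; exact h2
      by_cases h4 : f = H.corner b
      · rw [h4, H.corner_corner]; exact h2.symm
      exact h1 f h3 h4
  · rintro ⟨⟨ε, hε⟩, ⟨δ, hδ⟩⟩
    -- Reverse all signs of `H` if `a` and `b` have the same sign. The second new arc then has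
    -- opposite signs at its ends as well.
    let m : Bool := !(xor (ε a) (δ b))
    let η : G.Flag ⊕ H.Flag → Bool := Sum.elim ε fun f => xor m (δ f)
    have hm : ∀ y z : Bool, y ≠ z → xor m y ≠ xor m z := by
      intro y z h
      simpa using h
    have hab : η (Sum.inr b) ≠ η (Sum.inl a) := by
      simp only [η, m, Sum.elim_inl, Sum.elim_inr]
      cases ε a <;> cases δ b <;> simp
    have hc : ∀ f, η (Sum.map G.corner H.corner f) ≠ η f := by
      rintro (f | f)
      · exact (hε f).1
      · exact hm _ _ (hδ f).1
    have hab' : η (Sum.inr (H.corner b)) ≠ η (Sum.inl (G.corner a)) := by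
      have h1 := hc (Sum.inl a)
      have h2 := hc (Sum.inr b)
      simp only [Sum.map_inl, Sum.map_inr] at h1 h2
      revert h1 h2 hab
      cases η (Sum.inl a) <;> cases η (Sum.inr b) <;> cases η (Sum.inr (H.corner b)) <;>
        cases η (Sum.inl (G.corner a)) <;> simp
    refine ⟨η, fun f => ⟨?_, ?_, ?_⟩⟩
    · by_cases h1 : f = Sum.inl a
      · rw [h1, corner_join_inl]; exact hab
      by_cases h2 : f = Sum.inl (G.corner a)
      · rw [h2, corner_join_inl_corner]; exact hab'
      by_cases h3 : f = Sum.inr b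
      · rw [h3]
        exact fun h => hab (h.symm.trans (congrArg η corner_join_inr))
      by_cases h4 : f = Sum.inr (H.corner b)
      · rw [h4]
        exact fun h => hab' (h.symm.trans (congrArg η corner_join_inr_corner))
      rw [corner_join_of_ne h1 h2 h3 h4]
      exact hc f
    · rcases f with f | f
      · exact (hε f).2.1
      · exact hm _ _ (hδ f).2.1
    · rw [cutStrand_join]
      rcases f with f | f
      · exact (hε f).2.2
      · exact hm _ _ (hδ f).2.2

variable {K : Type*} [CommRing K]

theorem term_join (hG : G.IsBouquet) (hH : H.IsBouquet) (hS : (G.join H a b).IsEdgeSet S)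
    {w : K} (hw : w = w ^ 2) (x y z : K) : (G.join H a b).term x y z w S
      = G.term x y z w (leftPart S) * H.term x y z w (rightPart S) := by
  have hJ : (G.join H a b).IsBouquet := isBouquet_join hG hH
  obtain ⟨hS1, hS2⟩ := isEdgeSet_join.1 hS
  have hw' : w ^ (G.join H a b).nonorNum S
      = w ^ (G.nonorNum (leftPart S) + H.nonorNum (rightPart S)) := by
    refine pow_eq_pow_of_idempotent hw ?_
    rw [nonorNum_eq_zero, Nat.add_eq_zero_iff, nonorNum_eq_zero, nonorNum_eq_zero,
      orientableOn_join]
  have h1 := bdNum_join hS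
  have h2 := hS1.bdNum_le
  have h3 := hS2.bdNum_le
  simp only [term, compNum_of_isBouquet hG, compNum_of_isBouquet hH, compNum_of_isBouquet hJ,
    nullNum_of_isBouquet hG hS1, nullNum_of_isBouquet hH hS2, nullNum_of_isBouquet hJ hS,
    edgeNum_join hS, numComponents_of_isBouquet hG, numComponents_of_isBouquet hH,
    numComponents_of_isBouquet hJ, hw'] at h2 h3 ⊢
  -- For bouquets the exponent of `z` is 1 + e - bc. The one boundary curve lost in the join makes
  -- up for the second 1.
  rw [show 1 + (G.edgeNum (leftPart S) + H.edgeNum (rightPart S)) - (G.join H a b).bdNum S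
      = (1 + G.edgeNum (leftPart S) - G.bdNum (leftPart S)) +
        (1 + H.edgeNum (rightPart S) - H.bdNum (rightPart S)) by omega]
  ring

theorem brPoly_join (hG : G.IsBouquet) (hH : H.IsBouquet) {W : K} (hW : W = W ^ 2) (X Y Z : K) :
    (G.join H a b).brPoly X Y Z W = G.brPoly X Y Z W * H.brPoly X Y Z W := by
  simp only [brPoly_eq_sum]
  rw [Finset.sum_mul_sum, ← Finset.sum_product']
  refine Finset.sum_bij (fun S _ => (leftPart S, rightPart S)) ?_ ?_ ?_ ?_
  · intro S hS
    have := isEdgeSet_join.1 ((mem_edgeSets _).1 hS)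
    exact Finset.mem_product.2 ⟨(mem_edgeSets _).2 this.1, (mem_edgeSets _).2 this.2⟩
  · intro S _ S' _ h
    ext (f | f)
    · exact Set.ext_iff.1 (congrArg Prod.fst h) f
    · exact Set.ext_iff.1 (congrArg Prod.snd h) f
  · rintro ⟨T, T'⟩ hT
    obtain ⟨h1, h2⟩ := Finset.mem_product.1 hT
    exact ⟨{f | Sum.elim (· ∈ T) (· ∈ T') f}, (mem_edgeSets _).2 (isEdgeSet_join.2
      ⟨(mem_edgeSets _).1 h1, (mem_edgeSets _).1 h2⟩), rfl⟩
  · intro S hS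
    exact term_join hG hH ((mem_edgeSets _).1 hS) hW _ _ _

end Join

/-! ### The normalised polynomial -/

section Phi

variable {K : Type*} [CommRing K] {G H : PinchedRibbonGraph}

theorem numComponents_le_numVertices (G : PinchedRibbonGraph) :
    G.numComponents ≤ G.numVertices := by
  rw [numComponents_eq]
  exact G.compNum_le _

/-- The polynomial `R`, normalised so as to satisfy the recursion of the recipe theorem. -/
noncomputable def phi (a s t X Y u v T : K) (G : PinchedRibbonGraph) : K :=
  s ^ G.rank * t ^ G.nullity * T ^ G.numHalf * a ^ G.numComponents * G.brPoly X Y u v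

variable {a s t X Y u v T : K}

theorem phi_iso (h : Iso G H) : phi a s t X Y u v T G = phi a s t X Y u v T H := by
  obtain ⟨h1, h2, h3, h4, h5⟩ := h.sameData X Y u v
  simp only [phi, rank, nullity, h1, h2, h3, h4, h5]

/-- Deleting a regular edge lowers the nullity and keeps the rank, contracting it does the opposite.
This accounts for the factors `t` and `s`. -/
theorem phi_of_isRegular {d : G.Edge} (hd : G.IsRegular d) :
    phi a s t X Y u v T G
      = t * phi a s t X Y u v T (G.delete d) + s * phi a s t X Y u v T (G.contract d) := by
  obtain ⟨f, hf⟩ := G.exists_mem_edge d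
  have h1 := G.nullity_add
  have h2 := (G.delete d).nullity_add
  have h3 := (G.contract d).nullity_add
  have h4 := numVertices_delete (d := d)
  have h5 := numEdges_delete (d := d)
  have h6 := (isBridge_iff hf).2 hd.1
  have h7 := numVertices_contract hd.2
  have h8 := numComponents_contract hd.2
  have h9 := numEdges_contract (d := d)
  have h10 := (G.contract d).numComponents_le_numVertices
  have hr : G.rank = (G.contract d).rank + 1 := by rw [rank, rank]; omega
  have hr' : (G.delete d).rank = (G.contract d).rank + 1 := by rw [rank, rank]; omega
  have hn : G.nullity = (G.delete d).nullity + 1 := by omega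
  have hn' : (G.contract d).nullity = (G.delete d).nullity + 1 := by omega
  rw [phi, phi, phi, hr, hr', hn, hn', numHalf_delete, numHalf_contract, h6, h8,
    brPoly_of_isRegular hd]
  ring

theorem phi_of_isBridge {d : G.Edge} (hd : G.IsBridge d) :
    phi a s t X Y u v T G = s * X * phi a s t X Y u v T (G.contract d) := by
  have h0 := not_isLoop_of_isBridge hd
  have h1 := G.nullity_add
  have h3 := (G.contract d).nullity_add
  have h7 := numVertices_contract h0
  have h8 := numComponents_contract h0
  have h9 := numEdges_contract (d := d)
  have h10 := (G.contract d).numComponents_le_numVertices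
  have hr : G.rank = (G.contract d).rank + 1 := by rw [rank, rank]; omega
  have hn : G.nullity = (G.contract d).nullity := by omega
  rw [phi, phi, hr, hn, numHalf_contract, h8, brPoly_of_isBridge hd]
  ring

theorem phi_of_isBouquet (hG : G.IsBouquet) :
    phi a s t X Y u v T G = t ^ G.numEdges * T ^ G.numHalf * a * G.brPoly X Y u v := by
  have h := G.nullity_add
  rw [hG, numComponents_of_isBouquet hG] at h
  rw [phi, rank, hG, numComponents_of_isBouquet hG, show G.nullity = G.numEdges by omega]
  simp

theorem phi_disjointUnion {n : ℕ} {B : Fin n → PinchedRibbonGraph} (hv : v = v ^ 2)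
    (hB : ∀ i, (B i).IsBouquet) :
    phi a s t X Y u v T (disjointUnion B) = ∏ i, phi a s t X Y u v T (B i) := by
  have h1 := (disjointUnion B).nullity_add
  have hk : (disjointUnion B).numComponents = n := by
    simp [numComponents_disjointUnion, numComponents_of_isBouquet (hB _)]
  have hV : (disjointUnion B).numVertices = n := by
    rw [numVertices_disjointUnion, Finset.sum_congr rfl fun i _ => hB i]
    simp
  rw [hk, hV] at h1
  rw [phi, rank, hk, hV, show (disjointUnion B).nullity = (disjointUnion B).numEdges by omega,
    numEdges_disjointUnion, numHalf_disjointUnion, brPoly_disjointUnion hv]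
  simp only [phi_of_isBouquet (hB _), Finset.prod_mul_distrib, Finset.prod_pow_eq_pow_sum]
  simp

theorem phi_join (hv : v = v ^ 2) (hG : G.IsBouquet) (hH : H.IsBouquet) (f : G.Flag)
    (g : H.Flag) : a * phi a s t X Y u v T (G.join H f g)
      = phi a s t X Y u v T G * phi a s t X Y u v T H := by
  rw [phi_of_isBouquet hG, phi_of_isBouquet hH, phi_of_isBouquet (isBouquet_join hG hH),
    numEdges_join, numHalf_join, brPoly_join hG hH hv]
  ring

theorem Edgeless.isHalf (hG : G.Edgeless) (f : G.Flag) : G.IsHalf f := by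
  by_contra hf
  exact hG.elim (G.edgeOf f hf)

theorem brPoly_of_edgeless (hG : G.Edgeless) : G.brPoly X Y u v = 1 := by
  have h0 : {f | ¬ G.IsHalf f} = ∅ := Set.eq_empty_of_forall_notMem fun f hf => hf (hG.isHalf f)
  have h1 : G.edgeSets = {∅} := by
    ext S
    rw [mem_edgeSets, Finset.mem_singleton]
    refine ⟨fun h => Set.eq_empty_of_forall_notMem fun f hf => h.not_isHalf f hf (hG.isHalf f), ?_⟩
    rintro rfl
    exact IsEdgeSet.empty
  have h2 : G.OrientableOn ∅ := by
    obtain ⟨ε, hε⟩ := exists_two_colouring G.corner_corner G.corner_ne G.side_side G.side_ne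
    exact ⟨ε, fun f => ⟨(hε f).1, (hε f).2, by rw [cutStrand_empty]; exact (hε f).2⟩⟩
  have h3 := (IsEdgeSet.empty (G := G)).nullNum_add
  have h4 : G.numComponents = G.numVertices := by
    rw [numComponents_eq, h0, ← numVertices_eq_compNum]
  have h5 : G.edgeNum ∅ = 0 := by simp [edgeNum]
  rw [brPoly_eq_sum, h1, Finset.sum_singleton, term, nonorNum_eq_zero.2 h2,
    ← numVertices_eq_compNum, ← numVertices_eq_bdNum, h4]
  rw [← numVertices_eq_compNum] at h3
  rw [show G.nullNum ∅ = 0 by omega]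
  simp

theorem phi_of_edgeless (hG : G.Edgeless) :
    phi a s t X Y u v T G = a ^ G.numVertices * T ^ G.numHalf := by
  have h0 : {f | ¬ G.IsHalf f} = ∅ := Set.eq_empty_of_forall_notMem fun f hf => hf (hG.isHalf f)
  have h4 : G.numComponents = G.numVertices := by
    rw [numComponents_eq, h0, ← numVertices_eq_compNum]
  have h5 : G.numEdges = 0 := by
    have : IsEmpty G.Edge := hG
    exact Nat.card_of_isEmpty
  have h6 := G.nullity_add
  rw [phi, rank, brPoly_of_edgeless hG, show G.nullity = 0 by omega, h4]
  simp [mul_comm]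

end Phi

/-! ### Adding an edge -/

theorem bypass_eq_of_notMem {F : Type} {c x : F → F} {D : Set F} {y z : F} (h : c y = z)
    (hz : z ∉ D) : bypass c x D y = z := by
  simp [bypass, h, hz]

theorem bypass_eq_of_mem {F : Type} {c x : F → F} {D : Set F} {y z z' w : F} (h : c y = z)
    (hz : z ∈ D) (h' : x z = z') (h'' : c z' = w) (hw : w ∉ D) : bypass c x D y = w := by
  simp [bypass, h, hz, h', h'', hw]

theorem bypass_eq_of_mem_of_mem {F : Type} {c x : F → F} {D : Set F} {y z z' w w' v : F}
    (h : c y = z) (hz : z ∈ D) (h' : x z = z') (h'' : c z' = w) (hw : w ∈ D) (h3 : x w = w')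
    (h4 : c w' = v) : bypass c x D y = v := by
  simp [bypass, h, hz, h', h'', hw, h3, h4]

section AddEdge

variable {B : PinchedRibbonGraph} {κ : B.Flag ⊕ Bool × Bool → B.Flag ⊕ Bool × Bool}
  {hκ : ∀ f, κ (κ f) = f} {hκ' : ∀ f, κ f ≠ f}

/-- Add a ribbon edge to `B`, where `κ` describes the free arcs of the new vertex boundaries.  The
flags `(i, false)` and `(i, true)` are those of the `i`-th end of the new edge. -/
def addEdge (B : PinchedRibbonGraph) (κ : B.Flag ⊕ Bool × Bool → B.Flag ⊕ Bool × Bool)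
    (hκ : ∀ f, κ (κ f) = f) (hκ' : ∀ f, κ f ≠ f) : PinchedRibbonGraph where
  Bare := B.Bare
  Flag := B.Flag ⊕ Bool × Bool
  finite_bare := inferInstance
  finite_flag := inferInstance
  corner := κ
  side := Sum.map B.side fun e => (e.1, !e.2)
  strand := Sum.map B.strand fun e => (!e.1, e.2)
  corner_corner := hκ
  side_side f := by rcases f with f | f <;> simp [side_side]
  strand_strand f := by rcases f with f | f <;> simp [strand_strand]
  corner_ne := hκ'
  side_ne f := by rcases f with f | ⟨_ | _, _ | _⟩ <;> simp [side_ne]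
  strand_ne f := by rcases f with f | ⟨_ | _, _ | _⟩ <;> simp [strand_ne]
  strand_side f := by rcases f with f | f <;> simp [strand_side]

/-- A flag of `B` as a flag of `addEdge B`. -/
def old (f : B.Flag) : (addEdge B κ hκ hκ').Flag := Sum.inl f

/-- The flags of the new edge. -/
def new (e : Bool × Bool) : (addEdge B κ hκ hκ').Flag := Sum.inr e

theorem old_injective : Function.Injective (old : B.Flag → (addEdge B κ hκ hκ').Flag) :=
  Sum.inl_injective

theorem not_isHalf_new (e : Bool × Bool) : ¬ (addEdge B κ hκ hκ').IsHalf (new e) := fun h => by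
  have := Sum.inr_injective h
  rcases e with ⟨_ | _, _ | _⟩ <;> simp at this

theorem isHalf_old {f : B.Flag} : (addEdge B κ hκ hκ').IsHalf (old f) ↔ B.IsHalf f :=
  ⟨fun h => Sum.inl_injective h, fun h => congrArg Sum.inl h⟩

/-- The new edge. -/
def newEdge : (addEdge B κ hκ hκ').Edge := edgeOf _ (new (true, false)) (not_isHalf_new _)

theorem new_mem_newEdge (e : Bool × Bool) :
    new e ∈ (newEdge : (addEdge B κ hκ hκ').Edge).1 := by
  rcases e with ⟨_ | _, _ | _⟩
  exacts [Or.inr (Or.inr (Or.inl rfl)), Or.inr (Or.inr (Or.inr rfl)), Or.inl rfl,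
    Or.inr (Or.inl rfl)]

theorem old_notMem_newEdge (f : B.Flag) :
    old f ∉ (newEdge : (addEdge B κ hκ hκ').Edge).1 := by
  rintro (h | h | h | h) <;> cases h

theorem card_flag_addEdge : Nat.card (addEdge B κ hκ hκ').Flag = Nat.card B.Flag + 4 := by
  refine Nat.card_sum.trans ?_
  simp

/-- A criterion for contraction to undo the addition of an edge: `h1` says that the arcs of `B` come
back, `h2` that no new bare vertex arises. -/
theorem iso_contract_addEdge
    (h1 : ∀ f, bypass κ ((addEdge B κ hκ hκ').crossing newEdge)
      (newEdge : (addEdge B κ hκ hκ').Edge).1 (Sum.inl f) = Sum.inl (B.corner f))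
    (h2 : ∀ e, ∃ f, Quot.mk (fun f g : (addEdge B κ hκ hκ').Flag =>
      g = (addEdge B κ hκ hκ').corner f ∨ g = (addEdge B κ hκ hκ').crossing newEdge f) (new e)
        = Quot.mk _ (old f)) :
    Iso B ((addEdge B κ hκ hκ').contract newEdge) := by
  refine ⟨⟨Equiv.symm (@Equiv.sumEmpty _ _ ⟨?_⟩)⟩, Equiv.ofBijective
    (fun f => ⟨old f, old_notMem_newEdge f⟩)
    ⟨fun f g h => old_injective (congrArg Subtype.val h), ?_⟩, fun f => ⟨?_, rfl, rfl⟩⟩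
  · rintro ⟨⟨f | e⟩, hq⟩
    · exact old_notMem_newEdge f (hq _ rfl)
    · obtain ⟨f, hf⟩ := h2 e
      exact old_notMem_newEdge f (hq _ hf.symm)
  · rintro ⟨f | e, hf⟩
    · exact ⟨f, rfl⟩
    · exact (hf (new_mem_newEdge e)).elim
  · exact Subtype.ext (h1 f).symm

end AddEdge

theorem mem_iff_of_vertexOf {G : PinchedRibbonGraph} {C : Set G.Flag}
    (h : ∀ f ∈ C, G.corner f ∈ C ∧ G.side f ∈ C) {f g : G.Flag}
    (hfg : G.vertexOf f = G.vertexOf g) : f ∈ C ↔ g ∈ C := by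
  refine mem_iff_of_conn ?_ (vertexOf_eq_iff.1 hfg)
  rintro y z (rfl | rfl)
  · refine ⟨fun h' => (h _ h').1, fun h' => ?_⟩
    have := (h _ h').1
    rwa [G.corner_corner] at this
  · refine ⟨fun h' => (h _ h').2, fun h' => ?_⟩
    have := (h _ h').2
    rwa [G.side_side] at this

/-! ### Pendant edges -/

section Leaf

variable (B : PinchedRibbonGraph) (a : B.Flag)

open Classical in
/-- The arcs of the graph with a pendant edge attached to the arc at `a`. -/
noncomputable def leafCorner : B.Flag ⊕ Bool × Bool → B.Flag ⊕ Bool × Bool :=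
  Sum.elim
    (fun f => if f = a then Sum.inr (true, false) else if f = B.corner a then Sum.inr (true, true)
      else Sum.inl (B.corner f))
    fun e => if e.1 then Sum.inl (if e.2 then B.corner a else a) else Sum.inr (false, !e.2)

theorem leafCorner_leafCorner (f : B.Flag ⊕ Bool × Bool) :
    B.leafCorner a (B.leafCorner a f) = f := by
  have h1 := B.corner_corner
  have h2 := B.corner_ne
  rcases f with f | ⟨_ | _, _ | _⟩ <;> simp [leafCorner] <;> grind

theorem leafCorner_ne (f : B.Flag ⊕ Bool × Bool) : B.leafCorner a f ≠ f := by
  have h2 := B.corner_ne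
  rcases f with f | ⟨_ | _, _ | _⟩ <;> simp only [leafCorner, Sum.elim_inl, Sum.elim_inr] <;> grind

/-- The graph with a pendant edge attached to the arc at `a`. -/
noncomputable abbrev leaf : PinchedRibbonGraph :=
  addEdge B (B.leafCorner a) (B.leafCorner_leafCorner a) (B.leafCorner_ne a)

/-- It shows that a bouquet with flags is a contraction of a two-vertex graph, hence lies in the
class. -/
theorem iso_contract_leaf : Iso B ((B.leaf a).contract newEdge) := by
  have hn : ∀ e, (B.leaf a).crossing newEdge (Sum.inr e) = Sum.inr (!e.1, e.2) := fun e =>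
    crossing_of_mem (new_mem_newEdge e)
  have hm : ∀ e, (Sum.inr e ∈ (newEdge : (B.leaf a).Edge).1) := new_mem_newEdge
  have hm' : ∀ f, (Sum.inl f ∉ (newEdge : (B.leaf a).Edge).1) := old_notMem_newEdge
  have h1 := B.corner_corner
  have h3 : B.leafCorner a (Sum.inl a) = Sum.inr (true, false) := if_pos rfl
  have h4 : B.leafCorner a (Sum.inl (B.corner a)) = Sum.inr (true, true) :=
    (if_neg (B.corner_ne a)).trans (if_pos rfl)
  have h5 : ∀ f, f ≠ a → f ≠ B.corner a → B.leafCorner a (Sum.inl f) = Sum.inl (B.corner f) :=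
    fun f hf hf' => (if_neg hf).trans (if_neg hf')
  refine iso_contract_addEdge (fun f => ?_) ?_
  · by_cases hf : f = a
    · rw [hf]
      -- The walk goes along one strand of the pendant ribbon, round its far vertex and back along
      -- the other strand, which takes two rounds of `bypass`.
      exact bypass_eq_of_mem_of_mem h3 (hm _) (hn _) rfl (hm _) (hn _) rfl
    · by_cases hf' : f = B.corner a
      · rw [hf', h1]
        exact bypass_eq_of_mem_of_mem h4 (hm _) (hn _) rfl (hm _) (hn _) rfl
      · exact bypass_eq_of_notMem (h5 f hf hf') (hm' _)
  · have h3 : ∀ e : Bool × Bool, e.1 = true → ∃ f, Quot.mk (fun f g : (B.leaf a).Flag =>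
        g = (B.leaf a).corner f ∨ g = (B.leaf a).crossing newEdge f) (new e)
          = Quot.mk _ (old f) := by
      rintro ⟨i, j⟩ rfl
      exact ⟨_, Quot.sound (Or.inl rfl)⟩
    rintro ⟨_ | _, j⟩
    · obtain ⟨f, hf⟩ := h3 (true, j) rfl
      exact ⟨f, (Quot.sound (Or.inr (hn (false, j)).symm) :
        Quot.mk (fun f g : (B.leaf a).Flag => g = (B.leaf a).corner f ∨
          g = (B.leaf a).crossing newEdge f) (new (false, j)) = Quot.mk _ (new (true, j))).trans hf⟩
    · exact h3 _ rfl

theorem not_isLoop_newEdge_leaf : ¬ (B.leaf a).IsLoop newEdge := by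
  intro h
  have := (mem_iff_of_vertexOf (C := {f | ∃ j, f = new (false, j)}) (by
    rintro _ ⟨j, rfl⟩
    exact ⟨⟨_, rfl⟩, ⟨_, rfl⟩⟩) ((isLoop_iff (new_mem_newEdge (true, false))).1 h)).2 ⟨false, rfl⟩
  obtain ⟨j, hj⟩ := this
  cases hj

end Leaf

/-! ### Splitting a vertex -/

/-- A set of flags closed under `side` that is left by exactly two arcs. -/
structure Pocket (B : PinchedRibbonGraph) (V : Set B.Flag) (a b : B.Flag) : Prop where
  side : ∀ f ∈ V, B.side f ∈ V
  mem_left : a ∈ V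
  mem_right : b ∈ V
  ne : a ≠ b
  corner_left : B.corner a ∉ V
  corner_right : B.corner b ∉ V
  corner : ∀ f ∈ V, f ≠ a → f ≠ b → B.corner f ∈ V

section Split

variable (B : PinchedRibbonGraph) (a b : B.Flag)

open Classical in
/-- The arcs of the graph in which the arcs at `a` and at `b` are cut and led along a new edge. -/
noncomputable def splitCorner : B.Flag ⊕ Bool × Bool → B.Flag ⊕ Bool × Bool :=
  Sum.elim
    (fun f => if f = a then Sum.inr (true, false) else if f = b then Sum.inr (true, true)
      else if f = B.corner a then Sum.inr (false, false)
      else if f = B.corner b then Sum.inr (false, true) else Sum.inl (B.corner f))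
    fun e => Sum.inl (if e.1 then (if e.2 then b else a)
      else if e.2 then B.corner b else B.corner a)

theorem splitCorner_splitCorner (hab : a ≠ b) (hab' : B.corner a ≠ b)
    (f : B.Flag ⊕ Bool × Bool) : B.splitCorner a b (B.splitCorner a b f) = f := by
  have h1 := B.corner_corner
  have h2 := B.corner_ne
  rcases f with f | ⟨_ | _, _ | _⟩ <;> simp only [splitCorner, Sum.elim_inl, Sum.elim_inr] <;> grind

theorem splitCorner_ne (f : B.Flag ⊕ Bool × Bool) : B.splitCorner a b f ≠ f := by
  have h2 := B.corner_ne
  rcases f with f | ⟨_ | _, _ | _⟩ <;> simp only [splitCorner, Sum.elim_inl, Sum.elim_inr] <;> grind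

/-- The graph in which the arcs at `a` and at `b` are cut and led along the two sides of a new edge:
the arcs at `a` and `b` end at one end of the new edge, the rests of the two arcs at the other. -/
noncomputable abbrev split (hab : a ≠ b) (hab' : B.corner a ≠ b) : PinchedRibbonGraph :=
  addEdge B (B.splitCorner a b) (B.splitCorner_splitCorner a b hab hab') (B.splitCorner_ne a b)

variable {B a b} {hab : a ≠ b} {hab' : B.corner a ≠ b}

theorem corner_split_left : (B.split a b hab hab').corner (old a) = new (true, false) :=
  if_pos rfl

theorem corner_split_right : (B.split a b hab hab').corner (old b) = new (true, true) :=
  (if_neg hab.symm).trans (if_pos rfl)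

theorem corner_split_corner_left :
    (B.split a b hab hab').corner (old (B.corner a)) = new (false, false) :=
  (if_neg (B.corner_ne a)).trans ((if_neg hab').trans (if_pos rfl))

theorem corner_split_corner_right :
    (B.split a b hab hab').corner (old (B.corner b)) = new (false, true) := by
  have h1 : B.corner b ≠ a := fun h => hab' (by rw [← h, B.corner_corner])
  have h2 : B.corner b ≠ B.corner a := fun h =>
    hab (by rw [← B.corner_corner b, h, B.corner_corner])
  exact (if_neg h1).trans ((if_neg (B.corner_ne b)).trans ((if_neg h2).trans (if_pos rfl)))

theorem corner_split_of_ne {f : B.Flag} (h1 : f ≠ a) (h2 : f ≠ b) (h3 : f ≠ B.corner a)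
    (h4 : f ≠ B.corner b) : (B.split a b hab hab').corner (old f) = old (B.corner f) :=
  (if_neg h1).trans ((if_neg h2).trans ((if_neg h3).trans (if_neg h4)))

/-- The strand from the `true` end to the `false` end leads from `a` back to `corner a`, and
likewise for `b`, so the cut arcs are restored. -/
theorem iso_contract_split : Iso B ((B.split a b hab hab').contract newEdge) := by
  have hn : ∀ e, (B.split a b hab hab').crossing newEdge (Sum.inr e) = Sum.inr (!e.1, e.2) :=
    fun e => crossing_of_mem (new_mem_newEdge e)
  have hm : ∀ e, (Sum.inr e ∈ (newEdge : (B.split a b hab hab').Edge).1) := new_mem_newEdge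
  have hm' : ∀ f, (Sum.inl f ∉ (newEdge : (B.split a b hab hab').Edge).1) := old_notMem_newEdge
  refine iso_contract_addEdge (fun f => ?_) fun e => ⟨_, Quot.sound (Or.inl rfl)⟩
  by_cases hf : f = a
  · rw [hf]
    exact bypass_eq_of_mem (z := Sum.inr (true, false))
      (corner_split_left (hab := hab) (hab' := hab'))
      (hm _) (hn _) rfl (hm' _)
  by_cases hf2 : f = b
  · rw [hf2]
    exact bypass_eq_of_mem (z := Sum.inr (true, true))
      (corner_split_right (hab := hab) (hab' := hab'))
      (hm _) (hn _) rfl (hm' _)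
  by_cases hf3 : f = B.corner a
  · rw [hf3, B.corner_corner]
    exact bypass_eq_of_mem (z := Sum.inr (false, false))
      (corner_split_corner_left (hab := hab) (hab' := hab'))
      (hm _) (hn _) rfl (hm' _)
  by_cases hf4 : f = B.corner b
  · rw [hf4, B.corner_corner]
    exact bypass_eq_of_mem (z := Sum.inr (false, true))
      (corner_split_corner_right (hab := hab) (hab' := hab'))
      (hm _) (hn _) rfl (hm' _)
  · exact bypass_eq_of_notMem (corner_split_of_ne (hab := hab) (hab' := hab') hf hf2 hf3 hf4)
      (hm' _)

variable {V : Set B.Flag}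

theorem Pocket.corner_ne_right (h : Pocket B V a b) : B.corner a ≠ b := fun h' =>
  h.corner_left (h' ▸ h.mem_right)

/-- One vertex of the split carries `V` and one end of the new edge, the rest lies elsewhere. Hence
the ribbons with just one end in `V` become non-loops. -/
theorem Pocket.mem_iff_of_vertexOf_eq (h : Pocket B V a b)
    {f g : (B.split a b h.ne h.corner_ne_right).Flag}
    (hfg : (B.split a b h.ne h.corner_ne_right).vertexOf f
      = (B.split a b h.ne h.corner_ne_right).vertexOf g) :
    Sum.elim (· ∈ V) (fun e => e.1 = true) f ↔ Sum.elim (· ∈ V) (fun e => e.1 = true) g := by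
  refine mem_iff_of_vertexOf (C := {f | Sum.elim (· ∈ V) (fun e => e.1 = true) f}) ?_ hfg
  rintro (f | ⟨i, j⟩) hf
  · refine ⟨?_, h.side f hf⟩
    by_cases hfa : f = a
    · rw [hfa]
      exact (congrArg _ corner_split_left).mpr rfl
    by_cases hfb : f = b
    · rw [hfb]
      exact (congrArg _ corner_split_right).mpr rfl
    · have h1 : f ≠ B.corner a := fun h' => h.corner_left (h' ▸ hf)
      have h2 : f ≠ B.corner b := fun h' => h.corner_right (h' ▸ hf)
      exact (congrArg _ (corner_split_of_ne hfa hfb h1 h2)).mpr (h.corner f hf hfa hfb)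
  · refine ⟨?_, hf⟩
    obtain rfl : i = true := hf
    cases j
    exacts [h.mem_left, h.mem_right]

end Split

/-! ### Polynomials of chord diagrams -/

section Chord

/-- A finite certificate that `decide` can check: `g` labels the classes, `o` picks representatives,
and every flag is reached from its representative along the cycle within `n` rounds. -/
theorem card_quot_of_label {F : Type} (c t : F → F) {k : ℕ} (g : F → Fin k) (o : Fin k → F) (n : ℕ)
    (hg : ∀ y, g (c y) = g y ∧ g (t y) = g y) (ho : ∀ i, g (o i) = i)
    (hconn : ∀ y, ∃ j : Fin n, (t ∘ c)^[j] (o (g y)) = y ∨ c ((t ∘ c)^[j] (o (g y))) = y) :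
    Nat.card (Quot fun y z => z = c y ∨ z = t y) = k := by
  have hc : ∀ y, Quot.mk (fun y z => z = c y ∨ z = t y) y = Quot.mk _ (c y) :=
    fun y => Quot.sound (Or.inl rfl)
  have ht : ∀ y, Quot.mk (fun y z => z = c y ∨ z = t y) y = Quot.mk _ (t y) :=
    fun y => Quot.sound (Or.inr rfl)
  have hit : ∀ (j : ℕ) y, Quot.mk (fun y z => z = c y ∨ z = t y) y
      = Quot.mk _ ((t ∘ c)^[j] y) := by
    intro j
    induction j with
    | zero => exact fun y => rfl
    | succ j ih =>
      intro y
      rw [Function.iterate_succ_apply, ← ih]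
      exact (hc y).trans (ht _)
  have e : Quot (fun y z => z = c y ∨ z = t y) ≃ Fin k :=
    { toFun := Quot.lift g (by rintro y z (rfl | rfl); exacts [(hg y).1.symm, (hg y).2.symm])
      invFun := fun i => Quot.mk _ (o i)
      left_inv := by
        rintro ⟨y⟩
        obtain ⟨j, hj | hj⟩ := hconn y
        · exact (hit j _).trans (congrArg _ hj)
        · exact (hit j _).trans ((hc _).trans (congrArg _ hj))
      right_inv := ho }
  rw [Nat.card_congr e, Nat.card_fin]

variable {m : ℕ} {π : Fin (m + 2) → Fin (m + 2)} {tw : Fin (m + 2) → Bool}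
  {hπ : ∀ p, π (π p) = p} {hne : ∀ p, π p ≠ p} {htw : ∀ p, tw (π p) = tw p}

variable (π tw hπ hne htw) in
/-- The flags of the chords whose ends are marked by `A`. -/
def marked (A : Fin (m + 2) → Bool) : Set (chordDiagram m π tw hπ hne htw).Flag :=
  {f : Fin (m + 2) × Bool | A f.1 = true}

/-- Edge sets of a chord diagram become markings of the end points invariant under the matching,
which can be enumerated. -/
theorem edgeSets_chordDiagram : (chordDiagram m π tw hπ hne htw).edgeSets
    = (Finset.univ.filter fun A : Fin (m + 2) → Bool => ∀ p, A (π p) = A p).image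
        (marked π tw hπ hne htw) := by
  classical
  ext S
  rw [mem_edgeSets, Finset.mem_image]
  constructor
  · intro hS
    have h1 : ∀ p b, ((p, b) : Fin (m + 2) × Bool) ∈ S ↔ ((p, false) : Fin (m + 2) × Bool) ∈ S := by
      rintro p (_ | _)
      · rfl
      · exact hS.side_mem_iff (f := ((p, false) : Fin (m + 2) × Bool))
    refine ⟨fun p => decide (((p, false) : Fin (m + 2) × Bool) ∈ S), ?_, ?_⟩
    · rw [Finset.mem_filter]
      refine ⟨Finset.mem_univ _, fun p => decide_eq_decide.2 ?_⟩
      have := hS.strand_mem_iff (f := ((p, false) : Fin (m + 2) × Bool))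
      exact (h1 _ _).symm.trans this
    · ext ⟨p, b⟩
      exact (decide_eq_true_iff).trans (h1 p b).symm
  · rintro ⟨A, hA, rfl⟩
    refine ⟨fun f hf => hf, fun f hf => ?_, fun f _ hf => hne _ (congrArg Prod.fst hf)⟩
    exact ((Finset.mem_filter.1 hA).2 _).trans hf

theorem marked_injective : Function.Injective (marked π tw hπ hne htw) := by
  intro A A' h
  funext p
  have := Set.ext_iff.1 h (p, false)
  change A p = true ↔ A' p = true at this
  exact Bool.eq_iff_iff.2 this

theorem cutStrand_marked (A : Fin (m + 2) → Bool) (f : Fin (m + 2) × Bool) :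
    (chordDiagram m π tw hπ hne htw).cutStrand (marked π tw hπ hne htw A) f
      = if A f.1 = true then (π f.1, xor (!f.2) (tw f.1)) else (f.1, !f.2) := by
  by_cases h : A f.1 = true
  · rw [if_pos h]
    exact cutStrand_of_mem h
  · rw [if_neg h]
    exact cutStrand_of_notMem h

theorem bdNum_marked (A : Fin (m + 2) → Bool) :
    (chordDiagram m π tw hπ hne htw).bdNum (marked π tw hπ hne htw A)
      = Nat.card (Quot fun f g : Fin (m + 2) × Bool =>
        g = (if f.2 = true then (f.1 + 1, false) else (f.1 - 1, true)) ∨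
        g = if A f.1 = true then (π f.1, xor (!f.2) (tw f.1)) else (f.1, !f.2)) := by
  simp only [← cutStrand_marked (hπ := hπ) (hne := hne) (htw := htw)]
  refine (congrArg (· + _) (?_ : Nat.card Empty = 0)).trans (zero_add _)
  simp

theorem edgeNum_marked (A : Fin (m + 2) → Bool) :
    (chordDiagram m π tw hπ hne htw).edgeNum (marked π tw hπ hne htw A)
      = (Finset.univ.filter fun f : Fin (m + 2) × Bool => A f.1 = true).card / 4 := by
  refine congrArg (· / 4) ?_
  rw [← Set.ncard_coe_finset]
  congr 1
  ext f
  simp only [Finset.coe_filter, Finset.mem_univ, true_and]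
  exact Iff.rfl

theorem orientableOn_marked {A : Fin (m + 2) → Bool} (h : ∀ p, A p = true → tw p = false) :
    (chordDiagram m π tw hπ hne htw).OrientableOn (marked π tw hπ hne htw A) := by
  have h1 : ∀ b : Bool, (!b) ≠ b := by decide
  refine ⟨fun f : Fin (m + 2) × Bool => f.2, fun f => ⟨?_, h1 _, fun h2 => ?_⟩⟩
  · rcases f with ⟨p, _ | _⟩ <;> simp [chordDiagram]
  · have h3 := (congrArg Prod.snd
      (cutStrand_marked (hπ := hπ) (hne := hne) (htw := htw) A f)).symm.trans h2
    obtain ⟨p, b⟩ := f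
    by_cases hA : A p = true <;> simp [hA, h] at h3

theorem isBouquet_chordDiagram : (chordDiagram m π tw hπ hne htw).IsBouquet := by
  set G := chordDiagram m π tw hπ hne htw
  let r : Fin (m + 2) × Bool → Fin (m + 2) × Bool → Prop := fun f g =>
    g = (if f.2 then (f.1 + 1, false) else (f.1 - 1, true)) ∨ g = (f.1, !f.2)
  have h1 : ∀ p, Quot.mk r (p, false) = Quot.mk r (p, true) := fun p => Quot.sound (Or.inr rfl)
  have h2 : ∀ p, Quot.mk r (p, true) = Quot.mk r (p + 1, false) := fun p => Quot.sound (Or.inl rfl)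
  have h3 : ∀ p, Quot.mk r (p, false) = Quot.mk r (0, false) := by
    intro p
    induction p using Fin.induction with
    | zero => rfl
    | succ p ih => rw [← Fin.coeSucc_eq_succ, ← h2, ← h1, ih]
  have h4 : Nat.card (Quot r) = 1 := by
    refine Nat.card_eq_one_iff_unique.2 ⟨⟨?_⟩, ⟨Quot.mk _ (0, false)⟩⟩
    have h5 : ∀ y, y = Quot.mk r (0, false) := by
      rintro ⟨p, _ | _⟩
      · exact h3 p
      · exact (h1 p).symm.trans (h3 p)
    exact fun y z => (h5 y).trans (h5 z).symm
  have h6 : Nat.card Empty = 0 := by simp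
  exact (numVertices_eq _).trans (congrArg₂ (· + ·) h6 h4)

variable {K : Type*} [CommRing K]

theorem brPoly_chordDiagram (X Y Z W : K) : (chordDiagram m π tw hπ hne htw).brPoly X Y Z W
    = ∑ A : Fin (m + 2) → Bool with ∀ p, A (π p) = A p,
      (Y - 1) ^ (chordDiagram m π tw hπ hne htw).edgeNum (marked π tw hπ hne htw A) *
      Z ^ (1 + (chordDiagram m π tw hπ hne htw).edgeNum (marked π tw hπ hne htw A) -
        (chordDiagram m π tw hπ hne htw).bdNum (marked π tw hπ hne htw A)) *
      W ^ (chordDiagram m π tw hπ hne htw).nonorNum (marked π tw hπ hne htw A) := by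
  classical
  have hb : (chordDiagram m π tw hπ hne htw).IsBouquet := isBouquet_chordDiagram
  rw [brPoly_eq_sum, edgeSets_chordDiagram, Finset.sum_image fun _ _ _ _ h => marked_injective h]
  refine Finset.sum_congr rfl fun A hA => ?_
  have hS : (chordDiagram m π tw hπ hne htw).IsEdgeSet (marked π tw hπ hne htw A) := by
    rw [← mem_edgeSets, edgeSets_chordDiagram]
    exact Finset.mem_image_of_mem _ hA
  rw [term, compNum_of_isBouquet hb, numComponents_of_isBouquet hb, nullNum_of_isBouquet hb hS]
  simp

theorem sum_invariant_two (φ : (Fin 2 → Bool) → K) :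
    ∑ A : Fin 2 → Bool with ∀ p, A (p + 1) = A p, φ A
      = φ (fun _ => false) + φ (fun _ => true) := by
  rw [show (Finset.univ.filter fun A : Fin 2 → Bool => ∀ p, A (p + 1) = A p)
    = {fun _ => false, fun _ => true} by decide, Finset.sum_pair (by decide)]

theorem sum_invariant_four (φ : (Fin 4 → Bool) → K) :
    ∑ A : Fin 4 → Bool with ∀ p, A (p + 2) = A p, φ A
      = φ ![false, false, false, false] + (φ ![true, false, true, false] +
        (φ ![false, true, false, true] + φ ![true, true, true, true])) := by
  rw [show (Finset.univ.filter fun A : Fin 4 → Bool => ∀ p, A (p + 2) = A p)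
    = {![false, false, false, false], ![true, false, true, false], ![false, true, false, true],
      ![true, true, true, true]} by decide, Finset.sum_insert (by decide),
      Finset.sum_insert (by decide), Finset.sum_pair (by decide)]

theorem brPoly_positiveChord (X Y Z W : K) : positiveChord.brPoly X Y Z W = Y := by
  refine (brPoly_chordDiagram X Y Z W).trans ((sum_invariant_two _).trans ?_)
  rw [nonorNum_eq_zero.2 (orientableOn_marked fun _ _ => rfl),
    nonorNum_eq_zero.2 (orientableOn_marked fun _ _ => rfl), edgeNum_marked, edgeNum_marked,
    bdNum_marked, bdNum_marked,
    card_quot_of_label (k := 1) _ _ (fun _ => 0) (fun _ => (0, true)) 4 (by decide) (by decide)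
      (by decide),
    -- With the untwisted chord the surface is an annulus; the label tells its two boundary circles
    -- apart.
    card_quot_of_label (k := 2) _ _ (fun f => if xor (f.1 = 0) f.2 then 0 else 1)
      (fun i => if i = 0 then (1, true) else (0, true)) 4 (by decide) (by decide) (by decide)]
  simp

theorem brPoly_negativeChord (X Y Z W : K) :
    negativeChord.brPoly X Y Z W = 1 + (Y - 1) * Z * W := by
  have h : ∀ S, negativeChord.nonorNum S ≤ 1 := fun S => by
    unfold nonorNum
    split_ifs <;> simp
  refine (brPoly_chordDiagram X Y Z W).trans ((sum_invariant_two _).trans ?_)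
  have h0 : negativeChord.nonorNum (marked _ _ (by decide) (by decide) (by decide) fun _ => false)
      = 0 := by
    exact nonorNum_eq_zero.2 (orientableOn_marked fun _ h => by simp at h)
  have h1 : negativeChord.nonorNum (marked _ _ (by decide) (by decide) (by decide) fun _ => true)
      = 1 := by
    -- A Möbius band is not orientable: a side, a strand and an arc form a triangle of flags, whose
    -- three signs would have to differ pairwise.
    refine le_antisymm (h _) (Nat.one_le_iff_ne_zero.2 fun h => ?_)
    obtain ⟨ε, hε⟩ := nonorNum_eq_zero.1 h
    have e1 : ε ((0, true) : Fin 2 × Bool) ≠ ε ((0, false) : Fin 2 × Bool) :=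
      (hε ((0, false) : Fin 2 × Bool)).2.1
    have e2 : ε ((1, false) : Fin 2 × Bool) ≠ ε ((0, false) : Fin 2 × Bool) :=
      (congrArg ε (cutStrand_marked _ ((0, false) : Fin 2 × Bool))).symm.trans_ne
        (hε ((0, false) : Fin 2 × Bool)).2.2
    have e3 : ε ((0, true) : Fin 2 × Bool) ≠ ε ((1, false) : Fin 2 × Bool) :=
      (hε ((1, false) : Fin 2 × Bool)).1
    exact e3 ((Bool.eq_not_of_ne e1).trans (Bool.eq_not_of_ne e2).symm)
  unfold negativeChord at h0 h1
  rw [h0, h1, edgeNum_marked, edgeNum_marked, bdNum_marked, bdNum_marked,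
    card_quot_of_label (k := 1) _ _ (fun _ => 0) (fun _ => (0, true)) 4 (by decide) (by decide)
      (by decide),
    card_quot_of_label (k := 1) _ _ (fun _ => 0) (fun _ => (0, true)) 4 (by decide) (by decide)
      (by decide)]
  simp

/-- No chord or one chord gives a disc or an annulus, both of genus zero. Both chords give a torus
with one boundary curve, of Euler genus two. -/
theorem brPoly_crossedChords (X Y Z W : K) :
    crossedChords.brPoly X Y Z W = 1 + 2 * (Y - 1) + (Y - 1) ^ 2 * Z ^ 2 := by
  refine (brPoly_chordDiagram X Y Z W).trans ((sum_invariant_four _).trans ?_)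
  have h : ∀ A, nonorNum _ _ = 0 := fun A => nonorNum_eq_zero.2 (orientableOn_marked (m := 2)
    (π := fun p => p + 2) (tw := fun _ => false) (hπ := by decide) (hne := by decide)
    (htw := by decide) (A := A) fun _ _ => rfl)
  simp only [h, edgeNum_marked, bdNum_marked]
  rw [
    card_quot_of_label (k := 1) _ _ (fun _ => 0) (fun _ => (0, true)) 8 (by decide) (by decide)
      (by decide),
    card_quot_of_label (k := 2) _ _
      (fun f => if f = (0, true) ∨ f = (1, false) ∨ f = (1, true) ∨ f = (2, false) then 0 else 1)
      (fun i => if i = 0 then (0, true) else (2, true)) 4 (by decide) (by decide) (by decide),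
    card_quot_of_label (k := 2) _ _
      (fun f => if f = (1, true) ∨ f = (2, false) ∨ f = (2, true) ∨ f = (3, false) then 0 else 1)
      (fun i => if i = 0 then (1, true) else (3, true)) 4 (by decide) (by decide) (by decide),
    card_quot_of_label (k := 1) _ _ (fun _ => 0) (fun _ => (0, true)) 8 (by decide) (by decide)
      (by decide),
    show (Finset.univ.filter fun f : Fin 4 × Bool =>
      ![false, false, false, false] f.1 = true).card = 0 by decide,
    show (Finset.univ.filter fun f : Fin 4 × Bool =>
      ![true, false, true, false] f.1 = true).card = 4 by decide,
    show (Finset.univ.filter fun f : Fin 4 × Bool =>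
      ![false, true, false, true] f.1 = true).card = 4 by decide,
    show (Finset.univ.filter fun f : Fin 4 × Bool =>
      ![true, true, true, true] f.1 = true).card = 8 by decide]
  simp
  ring

end Chord

/-! ### Cutting a bouquet along a pocket -/

section Cap

variable {B : PinchedRibbonGraph} {V : Set B.Flag} {a b : B.Flag}

theorem Pocket.compl (h : Pocket B V a b) : Pocket B Vᶜ (B.corner a) (B.corner b) where
  side f hf hf' := hf (by simpa only [B.side_side] using h.side _ hf')
  mem_left := h.corner_left
  mem_right := h.corner_right
  ne h' := h.ne (by rw [← B.corner_corner a, h', B.corner_corner])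
  corner_left h' := h' (by rw [B.corner_corner]; exact h.mem_left)
  corner_right h' := h' (by rw [B.corner_corner]; exact h.mem_right)
  corner f hf h1 h2 hf' := hf (by
    rw [← B.corner_corner f]
    exact h.corner _ hf' (fun e => h1 (by rw [← e, B.corner_corner]))
      (fun e => h2 (by rw [← e, B.corner_corner])))

open Classical in
/-- The graph cut out by a pocket: the two arcs that leave it are replaced by a single one. -/
noncomputable def Pocket.cap (h : Pocket B V a b) (ht : ∀ f ∈ V, B.strand f ∈ V) :
    PinchedRibbonGraph where
  Bare := Empty
  Flag := {f // f ∈ V}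
  finite_bare := inferInstance
  finite_flag := inferInstance
  corner f := ⟨if f.1 = a then b else if f.1 = b then a else B.corner f.1, by
    split_ifs with h1 h2
    exacts [h.mem_right, h.mem_left, h.corner _ f.2 h1 h2]⟩
  side f := ⟨B.side f.1, h.side _ f.2⟩
  strand f := ⟨B.strand f.1, ht _ f.2⟩
  corner_corner f := by
    have h1 := B.corner_corner
    have h2 := B.corner_ne
    have h3 := h.ne
    have h4 := h.corner_left
    have h5 := h.corner_right
    have h6 := f.2
    refine Subtype.ext ?_
    simp only
    grind
  side_side f := Subtype.ext (B.side_side f.1)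
  strand_strand f := Subtype.ext (B.strand_strand f.1)
  corner_ne f h' := by
    have h2 := B.corner_ne
    have h3 := h.ne
    have h4 := congrArg Subtype.val h'
    simp only at h4
    grind
  side_ne f h' := B.side_ne f.1 (congrArg Subtype.val h')
  strand_ne f h' := B.strand_ne f.1 (congrArg Subtype.val h')
  strand_side f := Subtype.ext (B.strand_side f.1)

theorem bare_isEmpty_of_isBouquet (hB : B.IsBouquet) (f : B.Flag) : IsEmpty B.Bare := by
  have h1 := B.numVertices_eq.symm.trans hB
  have h2 : 0 < Nat.card (Quot fun f g : B.Flag => g = B.corner f ∨ g = B.side f) :=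
    Nat.card_pos_iff.2 ⟨⟨Quot.mk _ f⟩, inferInstance⟩
  have h3 : Nat.card B.Bare = 0 := by omega
  exact (Nat.card_eq_zero.1 h3).resolve_right fun h => (not_finite_iff_infinite.2 h) inferInstance

/-- If no ribbon leaves the pocket, the bouquet is cut in two by a chord of its disc. The two arcs
crossed by the chord are those that the join reconnects. -/
theorem Pocket.iso_join (h : Pocket B V a b) (hB : B.IsBouquet) (ht : ∀ f ∈ V, B.strand f ∈ V)
    (ht' : ∀ f ∈ Vᶜ, B.strand f ∈ Vᶜ) :
    Iso ((h.cap ht).join (h.compl.cap ht') ⟨a, h.mem_left⟩ ⟨B.corner a, h.corner_left⟩) B := by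
  classical
  have hE := bare_isEmpty_of_isBouquet hB a
  let φ : {f // f ∈ V} ⊕ {f // f ∈ Vᶜ} ≃ B.Flag := Equiv.Set.sumCompl V
  let a' : (h.cap ht).Flag := ⟨a, h.mem_left⟩
  let b' : (h.compl.cap ht').Flag := ⟨B.corner a, h.corner_left⟩
  have h3 : (h.cap ht).corner a' = ⟨b, h.mem_right⟩ := Subtype.ext (if_pos rfl)
  have h4 : (h.compl.cap ht').corner b' = ⟨B.corner b, h.corner_right⟩ := Subtype.ext (if_pos rfl)
  have e1 : φ (((h.cap ht).join (h.compl.cap ht') a' b').corner (Sum.inl a')) = B.corner a :=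
    congrArg (⇑φ : _ ⊕ _ → _) (corner_join_inl (a := a') (b := b'))
  have e2 : φ (((h.cap ht).join (h.compl.cap ht') a' b').corner (Sum.inl ⟨b, h.mem_right⟩))
      = B.corner b := by
    have h5 := corner_join_inl_corner (a := a') (b := b')
    rw [h3, h4] at h5
    exact congrArg (⇑φ : _ ⊕ _ → _) h5
  have e3 : φ (((h.cap ht).join (h.compl.cap ht') a' b').corner
      (Sum.inr ⟨B.corner a, h.corner_left⟩)) = a :=
    congrArg (⇑φ : _ ⊕ _ → _) (corner_join_inr (a := a') (b := b'))
  have e4 : φ (((h.cap ht).join (h.compl.cap ht') a' b').corner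
      (Sum.inr ⟨B.corner b, h.corner_right⟩)) = b := by
    have h5 := corner_join_inr_corner (a := a') (b := b')
    rw [h3, h4] at h5
    exact congrArg (⇑φ : _ ⊕ _ → _) h5
  refine ⟨⟨@Equiv.equivOfIsEmpty (Empty ⊕ Empty) _ _ hE⟩, φ, fun f => ⟨?_, ?_, ?_⟩⟩
  · by_cases h1 : f = Sum.inl ⟨a, h.mem_left⟩
    · rw [h1]
      exact e1
    by_cases h2 : f = Sum.inl ⟨b, h.mem_right⟩
    · rw [h2]
      exact e2
    by_cases h5 : f = Sum.inr ⟨B.corner a, h.corner_left⟩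
    · rw [h5]
      exact e3.trans (B.corner_corner a).symm
    by_cases h6 : f = Sum.inr ⟨B.corner b, h.corner_right⟩
    · rw [h6]
      exact e4.trans (B.corner_corner b).symm
    refine (congrArg (⇑φ : _ ⊕ _ → _) (corner_join_of_ne (a := a') (b := b') h1
      (h3 ▸ h2) h5 (h4 ▸ h6))).trans ?_
    rcases f with f | f
    · exact (if_neg fun h' => h1 (congrArg Sum.inl (Subtype.ext h'))).trans
        (if_neg fun h' => h2 (congrArg Sum.inl (Subtype.ext h')))
    · exact (if_neg fun h' => h5 (congrArg Sum.inr (Subtype.ext h'))).trans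
        (if_neg fun h' => h6 (congrArg Sum.inr (Subtype.ext h')))
  · rcases f with f | f <;> rfl
  · rcases f with f | f <;> rfl

theorem isBouquet_of_join {G H : PinchedRibbonGraph} {f : G.Flag} {g : H.Flag}
    (h : (G.join H f g).IsBouquet) : G.IsBouquet ∧ H.IsBouquet := by
  have key : ∀ (G : PinchedRibbonGraph) (f : G.Flag), 0 < G.numVertices := fun G f =>
    Nat.card_pos_iff.2 ⟨⟨G.vertexOf f⟩, by unfold Vertex; infer_instance⟩
  have h1 := numVertices_join (G := G) (H := H) (a := f) (b := g)
  have h2 := key G f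
  have h3 := key H g
  have h4 : _ = 1 := h
  exact ⟨show _ = 1 by omega, show _ = 1 by omega⟩

end Cap

/-! ### Recognising chord diagrams -/

/-- In a bouquet all flags lie on one boundary circle, so a nonempty set closed under `corner` and
`side` is everything. -/
theorem mem_of_isBouquet {B : PinchedRibbonGraph} (hB : B.IsBouquet) {C : Set B.Flag}
    (hC : ∀ f ∈ C, B.corner f ∈ C ∧ B.side f ∈ C) {f : B.Flag} (hf : f ∈ C) (g : B.Flag) :
    g ∈ C := by
  refine (mem_iff_of_vertexOf hC ?_).1 hf
  have := (Nat.card_eq_one_iff_unique.1 hB).1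
  exact Subsingleton.elim _ _

/-- A structure-preserving map into a bouquet is onto, its image being closed along the boundary
circle. The count of flags then makes it bijective. -/
theorem iso_of_map {G B : PinchedRibbonGraph} (hG : IsEmpty G.Bare) (hB : B.IsBouquet)
    (φ : G.Flag → B.Flag) (f : G.Flag)
    (hφ : ∀ f, φ (G.corner f) = B.corner (φ f) ∧ φ (G.side f) = B.side (φ f) ∧
      φ (G.strand f) = B.strand (φ f)) (hc : Nat.card G.Flag ≤ Nat.card B.Flag) : Iso G B := by
  have h1 : Function.Surjective φ := by
    refine mem_of_isBouquet hB (C := Set.range φ) ?_ ⟨f, rfl⟩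
    rintro _ ⟨g, rfl⟩
    exact ⟨⟨_, (hφ g).1⟩, ⟨_, (hφ g).2.1⟩⟩
  have h2 : Function.Bijective φ := h1.bijective_of_nat_card_le hc
  have := bare_isEmpty_of_isBouquet hB (φ f)
  exact ⟨⟨Equiv.equivOfIsEmpty _ _⟩, Equiv.ofBijective φ h2, hφ⟩

theorem quad_le_card {B : PinchedRibbonGraph} {p : B.Flag} (hp : ¬ B.IsHalf p) :
    4 ≤ Nat.card B.Flag := by
  rw [← B.ncard_quad hp]
  exact Set.ncard_le_card _

theorem iso_positiveChord {B : PinchedRibbonGraph} (hB : B.IsBouquet) {p : B.Flag}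
    (hp : ¬ B.IsHalf p) (h1 : B.corner p = B.strand p)
    (h2 : B.corner (B.side p) = B.side (B.strand p)) : Iso positiveChord B := by
  refine iso_of_map (inferInstanceAs (IsEmpty Empty)) hB
    (fun f : Fin 2 × Bool => ![fun b => bif b then p else B.side p,
      fun b => bif b then B.side (B.strand p) else B.strand p] f.1 f.2)
    ((0, true) : Fin 2 × Bool) ?_ ?_
  · rintro ⟨i, _ | _⟩ <;> fin_cases i
    · exact ⟨h2.symm, (B.side_side p).symm, (B.strand_side p).symm⟩
    · exact ⟨(B.corner_corner p).symm.trans (congrArg _ h1), rfl, (B.strand_strand p).symm⟩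
    · exact ⟨h1.symm, rfl, rfl⟩
    · refine ⟨(B.corner_corner _).symm.trans (congrArg _ h2), (B.side_side _).symm, ?_⟩
      exact (congrArg _ (B.strand_strand p).symm).trans (B.strand_side _).symm
  · refine le_trans (le_of_eq ?_) (quad_le_card hp)
    exact (Nat.card_eq_fintype_card (α := Fin 2 × Bool)).trans (by simp)

theorem iso_negativeChord {B : PinchedRibbonGraph} (hB : B.IsBouquet) {p : B.Flag}
    (hp : ¬ B.IsHalf p) (h1 : B.corner p = B.side (B.strand p))
    (h2 : B.corner (B.side p) = B.strand p) : Iso negativeChord B := by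
  refine iso_of_map (inferInstanceAs (IsEmpty Empty)) hB
    (fun f : Fin 2 × Bool => ![fun b => bif b then p else B.side p,
      fun b => bif b then B.strand p else B.side (B.strand p)] f.1 f.2)
    ((0, true) : Fin 2 × Bool) ?_ ?_
  · rintro ⟨i, _ | _⟩ <;> fin_cases i
    · exact ⟨h2.symm, (B.side_side p).symm, (B.strand_side p).symm⟩
    · refine ⟨(B.corner_corner p).symm.trans (congrArg _ h1), (B.side_side _).symm, ?_⟩
      exact (congrArg _ (B.strand_strand p).symm).trans (B.strand_side _).symm
    · exact ⟨h1.symm, rfl, rfl⟩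
    · exact ⟨(B.corner_corner _).symm.trans (congrArg _ h2), rfl, (B.strand_strand p).symm⟩
  · refine le_trans (le_of_eq ?_) (quad_le_card hp)
    exact (Nat.card_eq_fintype_card (α := Fin 2 × Bool)).trans (by simp)

theorem iso_crossedChords {B : PinchedRibbonGraph} (hB : B.IsBouquet) {p w : B.Flag}
    (hp : ¬ B.IsHalf p) (hw : ¬ B.IsHalf w) (hwp : w ∉ B.quad p) (h1 : B.corner p = w)
    (h2 : B.corner (B.side w) = B.strand p) (h3 : B.corner (B.strand w) = B.side p)
    (h4 : B.corner (B.side (B.strand p)) = B.side (B.strand w)) : Iso crossedChords B := by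
  refine iso_of_map (inferInstanceAs (IsEmpty Empty)) hB
    (fun f : Fin 4 × Bool => ![fun b => bif b then p else B.side p,
      fun b => bif b then B.side w else w,
      fun b => bif b then B.side (B.strand p) else B.strand p,
      fun b => bif b then B.strand w else B.side (B.strand w)] f.1 f.2)
    ((0, true) : Fin 4 × Bool) ?_ ?_
  · rintro ⟨i, _ | _⟩ <;> fin_cases i
    · exact ⟨(B.corner_corner _).symm.trans (congrArg _ h3), (B.side_side p).symm,
        (B.strand_side p).symm⟩
    · exact ⟨(B.corner_corner _).symm.trans (congrArg _ h1), rfl, rfl⟩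
    · exact ⟨(B.corner_corner _).symm.trans (congrArg _ h2), rfl, (B.strand_strand p).symm⟩
    · refine ⟨(B.corner_corner _).symm.trans (congrArg _ h4), (B.side_side _).symm, ?_⟩
      exact (congrArg _ (B.strand_strand w).symm).trans (B.strand_side _).symm
    · exact ⟨h1.symm, rfl, rfl⟩
    · exact ⟨h2.symm, (B.side_side w).symm, (B.strand_side w).symm⟩
    · refine ⟨h4.symm, (B.side_side _).symm, ?_⟩
      exact (congrArg _ (B.strand_strand p).symm).trans (B.strand_side _).symm
    · exact ⟨h3.symm, rfl, (B.strand_strand w).symm⟩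
  · have h5 : (B.quad p ∪ B.quad w).ncard = 8 := by
      rw [Set.ncard_union_eq, B.ncard_quad hp, B.ncard_quad hw]
      rw [Set.disjoint_left]
      intro f hf hf'
      refine hwp ?_
      rw [← B.quad_eq hf, B.quad_eq hf']
      exact Or.inl rfl
    refine le_trans (le_of_eq ?_) (h5.symm.le.trans (Set.ncard_le_card _))
    exact (Nat.card_eq_fintype_card (α := Fin 4 × Bool)).trans (by simp)

/-! ### Graphs all of whose edges are loops -/

section Loops

variable {G : PinchedRibbonGraph}

theorem vertexOf_strand (hG : ∀ d : G.Edge, G.IsLoop d) (f : G.Flag) :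
    G.vertexOf (G.strand f) = G.vertexOf f := by
  by_cases h : G.IsHalf f
  · rw [h, vertexOf_side]
  · exact ((isLoop_iff (G.mem_edgeOf f h)).1 (hG _)).symm

/-- The bouquet at a vertex of a graph all of whose edges are loops. -/
def atVertex (hG : ∀ d : G.Edge, G.IsLoop d) (v : G.Vertex) : PinchedRibbonGraph where
  Bare := {b : G.Bare // Sum.inl b = v}
  Flag := {f : G.Flag // G.vertexOf f = v}
  finite_bare := inferInstance
  finite_flag := inferInstance
  corner f := ⟨G.corner f.1, (vertexOf_corner f.1).trans f.2⟩
  side f := ⟨G.side f.1, (vertexOf_side f.1).trans f.2⟩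
  strand f := ⟨G.strand f.1, (vertexOf_strand hG f.1).trans f.2⟩
  corner_corner f := Subtype.ext (G.corner_corner f.1)
  side_side f := Subtype.ext (G.side_side f.1)
  strand_strand f := Subtype.ext (G.strand_strand f.1)
  corner_ne f h := G.corner_ne f.1 (congrArg Subtype.val h)
  side_ne f h := G.side_ne f.1 (congrArg Subtype.val h)
  strand_ne f h := G.strand_ne f.1 (congrArg Subtype.val h)
  strand_side f := Subtype.ext (G.strand_side f.1)

theorem bijective_sigma_fibre {A X ι : Type} (g : A → X) (e : ι ≃ X) :
    Function.Bijective (fun x : Σ i, {a // g a = e i} => x.2.1) := by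
  constructor
  · rintro ⟨i, a, ha⟩ ⟨j, b, hb⟩ h
    obtain rfl : a = b := h
    obtain rfl : i = j := e.injective (ha.symm.trans hb)
    rfl
  · exact fun a => ⟨⟨e.symm (g a), a, (e.apply_symm_apply _).symm⟩, rfl⟩

/-- The pieces are the graphs at the single vertices. Each has at least one vertex and the total is
the number of pieces, so each is a bouquet. -/
theorem exists_iso_disjointUnion (hG : ∀ d : G.Edge, G.IsLoop d) :
    ∃ (n : ℕ) (B : Fin n → PinchedRibbonGraph), (∀ i, (B i).IsBouquet) ∧
      (∀ i, Nat.card (B i).Flag ≤ Nat.card G.Flag) ∧ Iso (disjointUnion B) G := by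
  have hfin : Finite G.Vertex := by unfold Vertex; infer_instance
  obtain ⟨n, ⟨e⟩⟩ := Finite.exists_equiv_fin G.Vertex
  let B : Fin n → PinchedRibbonGraph := fun i => atVertex hG (e.symm i)
  have hiso : Iso (disjointUnion B) G := by
    exact ⟨⟨Equiv.ofBijective _ (bijective_sigma_fibre (X := G.Vertex) Sum.inl e.symm)⟩,
      Equiv.ofBijective _ (bijective_sigma_fibre G.vertexOf e.symm), fun f => ⟨rfl, rfl, rfl⟩⟩
  have hpos : ∀ i, 1 ≤ (B i).numVertices := by
    intro i
    refine Nat.card_pos_iff.2 ⟨?_, by unfold Vertex; infer_instance⟩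
    rcases h : e.symm i with b | q
    · exact ⟨Sum.inl ⟨b, h.symm⟩⟩
    · induction q using Quot.ind with
      | mk f => exact ⟨(B i).vertexOf ⟨f, h.symm⟩⟩
  have hsum : ∑ i, (B i).numVertices = ∑ i : Fin n, 1 := by
    rw [← numVertices_disjointUnion, (hiso.sameData (0 : ℤ) 0 0 0).numVertices, numVertices,
      Nat.card_congr e]
    simp
  refine ⟨n, B, fun i => ?_, fun i => ?_, hiso⟩
  · exact ((Finset.sum_eq_sum_iff_of_le fun i _ => hpos i).1 hsum.symm i (Finset.mem_univ i)).symm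
  · exact Finite.card_subtype_le _

end Loops

/-! ### Segments of the boundary of a bouquet -/

section Segment

variable {B : PinchedRibbonGraph}

variable (B) in
/-- The step from a ribbon end to the next one along the vertex boundary. -/
def step : Equiv.Perm B.Flag where
  toFun f := B.side (B.corner f)
  invFun f := B.corner (B.side f)
  left_inv f := by simp [side_side, corner_corner]
  right_inv f := by simp [side_side, corner_corner]

/-- A colour alternating along the boundary circle selects a direction. The flags of one colour, one
for each ribbon end, form a single cycle of `step`. -/
theorem exists_pow_step_eq (hB : B.IsBouquet) {ε : B.Flag → Bool}
    (hε : ∀ f, ε (B.corner f) ≠ ε f ∧ ε (B.side f) ≠ ε f) {y z : B.Flag} (hyz : ε y = ε z) :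
    ∃ k : ℕ, (B.step ^ k) y = z := by
  have h1 : z ∈ {f | ε f = ε y ∧ B.step.SameCycle y f ∨
      ε f ≠ ε y ∧ B.step.SameCycle y (B.side f)} := by
    refine mem_of_isBouquet hB ?_ (f := y) (Or.inl ⟨rfl, Equiv.Perm.SameCycle.refl _ _⟩) z
    rintro f (⟨hf, h⟩ | ⟨hf, h⟩)
    · refine ⟨Or.inr ⟨?_, ?_⟩, Or.inr ⟨?_, ?_⟩⟩
      · rw [← hf]; exact (hε f).1
      · exact (Equiv.Perm.sameCycle_apply_right (f := B.step)).2 h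
      · rw [← hf]; exact (hε f).2
      · rwa [B.side_side]
    · refine ⟨Or.inl ⟨?_, ?_⟩, Or.inl ⟨?_, h⟩⟩
      · exact (Bool.eq_not_of_ne (hε f).1).trans (Bool.eq_not_of_ne hf.symm).symm
      · refine (Equiv.Perm.sameCycle_apply_right (f := B.step)).1 ?_
        change B.step.SameCycle y (B.side (B.corner (B.corner f)))
        rwa [B.corner_corner]
      · exact (Bool.eq_not_of_ne (hε f).2).trans (Bool.eq_not_of_ne hf.symm).symm
  rcases h1 with ⟨-, h⟩ | ⟨h, -⟩
  · exact h.exists_nat_pow_eq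
  · exact (h hyz.symm).elim

/-- The pocket is the stretch of ends from `y` up to but excluding `z`. The last clause locates its
flags before `z` on any run from `y` to `z`; it allows minimality arguments on distances. -/
theorem exists_pocket (hB : B.IsBouquet) {ε : B.Flag → Bool}
    (hε : ∀ f, ε (B.corner f) ≠ ε f ∧ ε (B.side f) ≠ ε f) {y z : B.Flag} (hyz : ε y = ε z)
    (hne : y ≠ z) : ∃ V : Set B.Flag, Pocket B V (B.side y) (B.corner (B.side z)) ∧
      ∀ f ∈ V, ε f = ε y → ∀ n : ℕ, 0 < n → (B.step ^ n) y = z → ∃ k < n, (B.step ^ k) y = f := by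
  classical
  have hex : ∃ n : ℕ, 0 < n ∧ (B.step ^ n) y = z := by
    obtain ⟨k, hk⟩ := exists_pow_step_eq hB hε hyz
    refine ⟨k, Nat.pos_of_ne_zero ?_, hk⟩
    rintro rfl
    exact hne hk
  let m := Nat.find hex
  obtain ⟨hm, hmz⟩ : 0 < m ∧ (B.step ^ m) y = z := Nat.find_spec hex
  have hmin : ∀ n, 0 < n → (B.step ^ n) y = z → m ≤ n := fun n h1 h2 => Nat.find_min' hex ⟨h1, h2⟩
  have hcol : ∀ k : ℕ, ε ((B.step ^ k) y) = ε y := by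
    intro k
    induction k with
    | zero => rfl
    | succ k ih =>
      rw [pow_succ', Equiv.Perm.mul_apply]
      refine Eq.trans ?_ ih
      exact (Bool.eq_not_of_ne (hε (B.corner ((B.step ^ k) y))).2).trans
        (Bool.eq_not_of_ne (hε ((B.step ^ k) y)).1.symm).symm
  have hstep : ∀ k : ℕ, B.corner ((B.step ^ k) y) = B.side ((B.step ^ (k + 1)) y) := by
    intro k
    rw [pow_succ', Equiv.Perm.mul_apply]
    exact (B.side_side _).symm
  have hstep' : ∀ k : ℕ, B.corner (B.side ((B.step ^ (k + 1)) y)) = (B.step ^ k) y := by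
    intro k
    rw [← hstep, B.corner_corner]
  have hzm : B.corner (B.side z) = (B.step ^ (m - 1)) y := by
    rw [← hmz, ← hstep' (m - 1), Nat.sub_add_cancel hm]
  refine ⟨{f | ∃ k < m, f = (B.step ^ k) y ∨ f = B.side ((B.step ^ k) y)},
    ⟨?_, ⟨0, hm, Or.inr rfl⟩, ⟨m - 1, by omega, Or.inl hzm⟩, ?_, ?_, ?_, ?_⟩, ?_⟩
  · rintro f ⟨k, hk, rfl | rfl⟩
    · exact ⟨k, hk, Or.inr rfl⟩
    · exact ⟨k, hk, Or.inl (B.side_side _)⟩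
  · intro h
    refine (hε y).2 ?_
    rw [h, hzm, hcol]
  · rintro ⟨k, hk, h | h⟩
    -- Otherwise the stretch would have gone once round the circle before reaching `z`, and dropping
    -- that turn would reach `z` sooner.
    · have h1 : (B.step ^ (k + 1)) y = y := by
        rw [pow_succ', Equiv.Perm.mul_apply, ← h]
        exact (congrArg B.side (B.corner_corner _)).trans (B.side_side y)
      have h2 : (B.step ^ (m - (k + 1))) y = z := by
        rw [← hmz]
        conv_lhs => rw [← h1]
        rw [← Equiv.Perm.mul_apply, ← pow_add, Nat.sub_add_cancel hk]
      by_cases h3 : m - (k + 1) = 0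
      · rw [h3] at h2
        exact hne h2
      · have := hmin _ (Nat.pos_of_ne_zero h3) h2
        omega
    · have h1 := congrArg ε h
      have h2 := (hε (B.side y)).1
      have h3 := (hε y).2
      have h4 := (hε ((B.step ^ k) y)).2
      rw [hcol] at h4
      rw [h1] at h2
      exact h2 ((Bool.eq_not_of_ne h4).trans (Bool.eq_not_of_ne h3).symm)
  · rw [B.corner_corner]
    rintro ⟨k, hk, h | h⟩
    · have h1 := (hε z).2
      rw [h, hcol, hyz] at h1
      exact h1 rfl
    · have h1 : z = (B.step ^ k) y := by rw [← B.side_side z, h, B.side_side]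
      rcases Nat.eq_zero_or_pos k with rfl | hk'
      · exact hne h1.symm
      · have := hmin k hk' h1.symm
        omega
  · rintro f ⟨k, hk, rfl | rfl⟩ h1 h2
    · refine ⟨k + 1, ?_, Or.inr (hstep k)⟩
      rcases Nat.lt_or_ge (k + 1) m with h | h
      · exact h
      · refine (h2 ?_).elim
        rw [hzm, show m - 1 = k by omega]
    · rcases k with _ | k
      · exact (h1 rfl).elim
      · exact ⟨k, by omega, Or.inl (hstep' k)⟩
  · rintro f ⟨k, hk, rfl | rfl⟩ hf n hn hn'
    · exact ⟨k, hk.trans_le (hmin n hn hn'), rfl⟩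
    · have := (hε ((B.step ^ k) y)).2
      rw [hf, hcol] at this
      exact (this rfl).elim

end Segment

/-! ### Slides -/

section Slide

variable {B : PinchedRibbonGraph} {a b : B.Flag} {hab : a ≠ b} {hab' : B.corner a ≠ b}

/-- An edge of `B` as an edge of `B.split`. -/
noncomputable def oldEdge (f : B.Flag) (hf : ¬ B.IsHalf f) : (B.split a b hab hab').Edge :=
  edgeOf _ (old f) (isHalf_old.not.2 hf)

theorem old_mem_oldEdge {f g : B.Flag} {hf : ¬ B.IsHalf f} :
    old g ∈ (oldEdge f hf : (B.split a b hab hab').Edge).1 ↔ g ∈ B.quad f := by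
  refine ⟨fun h => ?_, fun h => ?_⟩
  · rcases h with h | h | h | h
    exacts [Or.inl (old_injective h), Or.inr (Or.inl (old_injective h)),
      Or.inr (Or.inr (Or.inl (old_injective h))), Or.inr (Or.inr (Or.inr (old_injective h)))]
  · rcases h with rfl | rfl | rfl | rfl
    exacts [Or.inl rfl, Or.inr (Or.inl rfl), Or.inr (Or.inr (Or.inl rfl)),
      Or.inr (Or.inr (Or.inr rfl))]

theorem new_notMem_oldEdge {f : B.Flag} {hf : ¬ B.IsHalf f} (e : Bool × Bool) :
    new e ∉ (oldEdge f hf : (B.split a b hab hab').Edge).1 := by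
  rintro (h | h | h | h) <;> cases h

/-- Some slide of an end of a ribbon of `B` along another ribbon yields a graph with property `P`:
both arise by contracting an edge of one and the same graph with two vertices. -/
def SlidesTo (B : PinchedRibbonGraph) (P : PinchedRibbonGraph → Prop) : Prop :=
  ∃ (V : Set B.Flag) (a b : B.Flag) (h : Pocket B V a b) (f : B.Flag) (hf : ¬ B.IsHalf f),
    ¬ (f ∈ V ↔ B.strand f ∈ V) ∧
      P ((B.split a b h.ne h.corner_ne_right).contract (oldEdge f hf))

theorem corner_contract_eq {G : PinchedRibbonGraph} {d : G.Edge} {f g : G.Flag} (hf : f ∉ d.1)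
    (hg : g ∉ d.1) (h : bypass G.corner (G.crossing d) d.1 f = g) :
    (G.contract d).corner ⟨f, hf⟩ = ⟨g, hg⟩ := Subtype.ext h

theorem isHalf_contract_split {f : B.Flag} {hf : ¬ B.IsHalf f} (hB : ∀ g, ¬ B.IsHalf g)
    (g : ((B.split a b hab hab').contract (oldEdge f hf)).Flag) :
    ¬ ((B.split a b hab hab').contract (oldEdge f hf)).IsHalf g := by
  refine (isHalf_removeEdge g).not.2 ?_
  obtain ⟨g | e, hg⟩ := g
  · exact isHalf_old.not.2 (hB g)
  · exact not_isHalf_new e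

variable {ε : B.Flag → Bool}

/-- The pocket runs from one end of the twisted ribbon up to the other. After the slide, the new
ribbon that replaces it is twisted and has neighbouring ends. -/
theorem slidesTo_of_twisted (hB : B.IsBouquet)
    (hε : ∀ f, ε (B.corner f) ≠ ε f ∧ ε (B.side f) ≠ ε f) {f : B.Flag} (hf : ¬ B.IsHalf f)
    (hf' : ε (B.strand f) = ε f) :
    SlidesTo B fun G => ∃ p, ¬ G.IsHalf p ∧ G.corner p ∈ G.quad p := by
  obtain ⟨V, hV, -⟩ := exists_pocket hB hε hf' (B.strand_ne f)
  refine ⟨V, _, _, hV, f, hf, ?_, ⟨new (true, false), new_notMem_oldEdge _⟩, ?_, ?_⟩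
  · have h1 : B.strand f ∈ V := by simpa only [B.side_side] using hV.side _ hV.mem_left
    have h2 : f ∉ V := fun h => hV.corner_right (by rw [B.corner_corner]; exact hV.side _ h)
    exact fun h => h2 (h.2 h1)
  · exact (isHalf_removeEdge _).not.2 (not_isHalf_new _)
  · refine (congrArg (· ∈ _) (corner_contract_eq (g := new (false, true)) (new_notMem_oldEdge _)
      (new_notMem_oldEdge _) ?_)).mpr (Or.inr (Or.inr (Or.inr rfl)))
    have hm := old_mem_oldEdge (hf := hf) (hab := hV.ne) (hab' := hV.corner_ne_right).2
      (Or.inr (Or.inr (Or.inr rfl)))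
    -- From the new ribbon the arc meets the ribbon of `f`, which is contracted, follows its strand
    -- to `side f`, and from there arrives at the other end of the new ribbon.
    refine bypass_eq_of_mem (z := old (B.side (B.strand f))) rfl hm
      (z' := old (B.side f)) ((crossing_of_mem hm).trans ?_) ?_ (new_notMem_oldEdge _)
    · refine congrArg old ?_
      rw [B.strand_side, B.strand_strand]
    · exact (congrArg _ (congrArg old (B.corner_corner (B.side f)).symm)).trans
        (corner_split_corner_right (hab := hV.ne) (hab' := hV.corner_ne_right))

/-- Choose a ribbon with its ends as close together as possible. Sliding the ribbon `g` next to its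
first end leaves exactly one end, that of the new ribbon, between its two ends. -/
theorem slidesTo_of_untwisted (hB : B.IsBouquet) (hh : ∀ f, ¬ B.IsHalf f)
    (hε : ∀ f, ε (B.corner f) ≠ ε f ∧ ε (B.side f) ≠ ε f) (ht : ∀ f, ε (B.strand f) ≠ ε f)
    (hi : ∀ f, B.corner f ∉ B.quad f) (f₀ : B.Flag) :
    SlidesTo B fun G =>
      ∃ f p, p ∉ G.quad f ∧ G.corner f = p ∧ G.corner (G.side p) = G.strand f := by
  classical
  have hpartner : ∀ f, ε f = ε (B.side (B.strand f)) := fun f =>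
    (Bool.eq_not_of_ne (ht f).symm).trans (Bool.eq_not_of_ne (hε (B.strand f)).2).symm
  have hpne : ∀ f, f ≠ B.side (B.strand f) := fun f h => hh f (by rw [IsHalf, h, B.side_side, ← h])
  have hex : ∃ m : ℕ, 0 < m ∧ ∃ f, (B.step ^ m) f = B.side (B.strand f) := by
    obtain ⟨k, hk⟩ := exists_pow_step_eq hB hε (hpartner f₀)
    refine ⟨k, Nat.pos_of_ne_zero ?_, f₀, hk⟩
    rintro rfl
    exact hpne f₀ hk
  obtain ⟨hm, f, hf⟩ := Nat.find_spec hex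
  have hmin : ∀ n, 0 < n → ∀ g, (B.step ^ n) g = B.side (B.strand g) → Nat.find hex ≤ n :=
    fun n h1 g h2 => Nat.find_min' hex ⟨h1, g, h2⟩
  set m := Nat.find hex
  let g := B.side (B.corner f)
  have hgf : g ∉ B.quad f := fun h => hi f (by
    have := (isEdgeSet_quad (hh f)).side _ h
    rwa [B.side_side] at this)
  have hfg : B.strand f ∉ B.quad g := fun h => hgf (by
    rw [← B.quad_eq (Or.inr (Or.inr (Or.inl rfl)) : B.strand f ∈ B.quad f), B.quad_eq h]
    exact Or.inl rfl)
  have hne : g ≠ B.side (B.strand f) := fun h => hgf (h ▸ Or.inr (Or.inr (Or.inr rfl)))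
  have hεg : ε g = ε f := (Bool.eq_not_of_ne (hε (B.corner f)).2).trans
    (Bool.eq_not_of_ne (hε f).1.symm).symm
  have hm1 : (B.step ^ (m - 1)) g = B.side (B.strand f) := by
    rw [← hf]
    conv_rhs => rw [← Nat.sub_add_cancel hm, pow_succ, Equiv.Perm.mul_apply]
    rfl
  have hm2 : 0 < m - 1 := Nat.pos_of_ne_zero fun h => hne (by rw [h] at hm1; exact hm1)
  obtain ⟨V, hV, hV'⟩ := exists_pocket hB hε (hεg.trans (hpartner f)) hne
  have hgV : g ∈ V := by simpa only [B.side_side] using hV.side _ hV.mem_left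
  -- If both ends of `g` lay between the ends of `f`, they would be closer together than those of
  -- `f`, against the choice of `f`.
  have hgV' : B.strand g ∉ V := by
    intro h
    obtain ⟨k, hk, hk'⟩ := hV' _ (hV.side _ h) (hpartner g).symm _ hm2 hm1
    have h1 : 0 < k := Nat.pos_of_ne_zero fun h => hpne g (by rw [h] at hk'; exact hk')
    have := hmin k h1 g hk'
    omega
  have hca : B.corner (B.side g) = f := by
    rw [B.side_side, B.corner_corner]
  have hcb : B.corner (B.corner (B.side (B.side (B.strand f)))) = B.strand f := by
    rw [B.corner_corner, B.side_side]
  have hmf : old f ∉ (oldEdge g (hh g) : (B.split _ _ hV.ne hV.corner_ne_right).Edge).1 :=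
    fun h => hfg ((isEdgeSet_quad (hh g)).strand _ (old_mem_oldEdge.1 h))
  refine ⟨V, _, _, hV, g, hh g, fun h => hgV' (h.1 hgV), ⟨old f, hmf⟩,
    ⟨new (false, false), new_notMem_oldEdge _⟩, ?_, ?_, ?_⟩
  · rintro (h | h | h | h) <;> cases congrArg Subtype.val h
  · refine corner_contract_eq _ _ (bypass_eq_of_notMem ?_ (new_notMem_oldEdge _))
    exact (congrArg _ (congrArg old hca.symm)).trans corner_split_corner_left
  · refine corner_contract_eq (new_notMem_oldEdge (false, true)) _
      (bypass_eq_of_notMem (z := old (B.strand f)) ?_ fun h => hfg (old_mem_oldEdge.1 h))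
    exact congrArg old hcb

/-- Starting from a single end of `p` between the ends of `f`, the stretch from the second end of
`f` up to the second end of `p` is slid away. The ribbon replacing `f` and that of `p` then have
four consecutive, alternating ends. -/
theorem slidesTo_of_adjacent (hB : B.IsBouquet) (hh : ∀ f, ¬ B.IsHalf f)
    (hε : ∀ f, ε (B.corner f) ≠ ε f ∧ ε (B.side f) ≠ ε f) (ht : ∀ f, ε (B.strand f) ≠ ε f)
    {f p : B.Flag} (hp : p ∉ B.quad f) (h1 : B.corner f = p)
    (h2 : B.corner (B.side p) = B.strand f) :
    SlidesTo B fun G => ∃ p w, w ∉ G.quad p ∧ G.corner p = w ∧ G.corner (G.side w) = G.strand p ∧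
      G.corner (G.strand w) = G.side p := by
  have hpartner : ∀ f, ε f = ε (B.side (B.strand f)) := fun f =>
    (Bool.eq_not_of_ne (ht f).symm).trans (Bool.eq_not_of_ne (hε (B.strand f)).2).symm
  have hpf : B.side p ∉ B.quad f := fun h => hp (by
    have := (isEdgeSet_quad (hh f)).side _ h
    rwa [B.side_side] at this)
  have hrf : B.strand (B.side p) ∉ B.quad f := fun h => hpf (by
    have := (isEdgeSet_quad (hh f)).strand _ h
    rwa [B.strand_strand] at this)
  have hne : B.side (B.strand f) ≠ B.side (B.strand (B.side p)) := fun h => hrf (by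
    have h3 := congrArg B.side h
    rw [B.side_side, B.side_side] at h3
    rw [← h3]
    exact Or.inr (Or.inr (Or.inl rfl)))
  have hcol : ε (B.side (B.strand f)) = ε (B.side (B.strand (B.side p))) := by
    rw [← hpartner, ← hpartner]
    refine (Bool.eq_not_of_ne (h1 ▸ (hε f).1.symm)).trans (Bool.eq_not_of_ne (hε p).2).symm
  obtain ⟨V, hV, -⟩ := exists_pocket hB hε hcol hne
  have hca : B.corner (B.side (B.side (B.strand f))) = B.side p := by
    rw [B.side_side, ← h2, B.corner_corner]
  have hcb : B.corner (B.corner (B.side (B.side (B.strand (B.side p))))) = B.strand (B.side p) := by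
    rw [B.corner_corner, B.side_side]
  have hfp : f ≠ B.corner (B.side (B.side (B.strand (B.side p)))) := fun h => hh p (by
    have h3 := congrArg B.corner h
    rw [hcb, h1, B.strand_side] at h3
    rw [IsHalf]
    conv_rhs => rw [h3, B.side_side])
  have hfa : f ≠ B.side (B.side (B.strand f)) := fun h => B.strand_ne f (by
    rw [B.side_side] at h
    exact h.symm)
  have hsf : B.strand f ∈ V := by simpa only [B.side_side] using hV.mem_left
  have hfV : f ∉ V := fun h => by
    have h3 := hV.side _ (hV.corner f h hfa hfp)
    rw [h1, ← hca] at h3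
    exact hV.corner_left h3
  have hnp : old (B.side p) ∉ (oldEdge f (hh f) :
      (B.split _ _ hV.ne hV.corner_ne_right).Edge).1 := fun h => hpf (old_mem_oldEdge.1 h)
  refine ⟨V, _, _, hV, f, hh f, fun h => hfV (h.2 hsf), ⟨old (B.side p), hnp⟩,
    ⟨new (false, false), new_notMem_oldEdge _⟩, ?_, ?_, ?_, ?_⟩
  · rintro (h | h | h | h) <;> cases congrArg Subtype.val h
  · refine corner_contract_eq _ _ (bypass_eq_of_notMem ?_ (new_notMem_oldEdge _))
    exact (congrArg _ (congrArg old hca.symm)).trans corner_split_corner_left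
  · refine corner_contract_eq (new_notMem_oldEdge (false, true)) _
      (bypass_eq_of_notMem (z := old (B.strand (B.side p))) ?_ fun h => hrf (old_mem_oldEdge.1 h))
    exact congrArg old hcb
  · have hm := old_mem_oldEdge (hf := hh f) (hab := hV.ne) (hab' := hV.corner_ne_right).2
      (Or.inr (Or.inr (Or.inl rfl)))
    have hpm : old p ∉ (oldEdge f (hh f) : (B.split _ _ hV.ne hV.corner_ne_right).Edge).1 :=
      fun h => hp (old_mem_oldEdge.1 h)
    refine (corner_contract_eq (new_notMem_oldEdge (true, false)) hpm
      (bypass_eq_of_mem (z := old (B.strand f)) (congrArg old (B.side_side _)) hm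
      (z' := old f) ((crossing_of_mem hm).trans (congrArg old (B.strand_strand f))) (w := old p) ?_
      hpm)).trans (Subtype.ext (congrArg old (B.side_side p).symm))
    refine (corner_split_of_ne hfa hfp ?_ ?_).trans (congrArg old h1)
    · rw [hca]
      exact fun h => hpf (h ▸ Or.inl rfl)
    · rw [hcb]
      exact fun h => hrf (h ▸ Or.inl rfl)

end Slide

/-! ### Two-vertex graphs -/

section TwoVertices

variable {G : PinchedRibbonGraph} {d e : G.Edge}

theorem vertexOf_bypass (D : Set G.Flag) (f : G.Flag) :
    G.vertexOf (bypass G.corner G.side D f) = G.vertexOf f := by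
  classical
  have h : ∀ f, G.vertexOf (if f ∈ D then G.corner (G.side f) else f) = G.vertexOf f := by
    intro f
    split_ifs
    · rw [vertexOf_corner, vertexOf_side]
    · rfl
  exact (h _).trans ((h _).trans (vertexOf_corner f))

theorem vertexOf_eq_of_delete {f g : (G.delete d).Flag}
    (h : (G.delete d).vertexOf f = (G.delete d).vertexOf g) :
    G.vertexOf f.1 = G.vertexOf g.1 := by
  refine congrArg (Quot.lift (fun f : {f // f ∉ d.1} => G.vertexOf f.1) ?_) (vertexOf_eq_iff.1 h)
  rintro y z (rfl | rfl)
  · exact (vertexOf_bypass d.1 y.1).symm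
  · exact (vertexOf_side y.1).symm

theorem numComponents_le_one (hG : G.numVertices = 2) (hd : ¬ G.IsLoop d) :
    G.numComponents ≤ 1 := by
  have h1 := numVertices_contract hd
  rw [← numComponents_contract hd]
  exact (numComponents_le_numVertices _).trans (by omega)

/-- Two vertices still joined by another edge after deleting `e` stay connected, so `e` is no
bridge. -/
theorem isRegular_of_delete (hG : G.numVertices = 2) (he : ¬ G.IsLoop e) {d : (G.delete e).Edge}
    (hd : ¬ (G.delete e).IsLoop d) : G.IsRegular e := by
  refine ⟨fun h => ?_, he⟩
  have h1 := numComponents_le_one ((numVertices_delete (d := e)).trans hG) hd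
  have h2 : G.numComponents = 0 := by
    have : G.numComponents < (G.delete e).numComponents := h
    omega
  have h3 : 0 < G.numComponents := by
    obtain ⟨f, -⟩ := G.exists_mem_edge e
    refine Nat.card_pos_iff.2 ⟨⟨Sum.inr (Quot.mk _ f)⟩, by unfold Component; infer_instance⟩
  omega

theorem exists_not_isLoop_delete {f : G.Flag} (hf : ¬ G.IsHalf f) (hfe : f ∉ e.1)
    (h : G.vertexOf f ≠ G.vertexOf (G.strand f)) :
    ∃ d : (G.delete e).Edge, ¬ (G.delete e).IsLoop d := by
  have hf' : ¬ (G.delete e).IsHalf ⟨f, hfe⟩ := (isHalf_removeEdge _).not.2 hf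
  refine ⟨edgeOf _ ⟨f, hfe⟩ hf', fun h' => h ?_⟩
  exact vertexOf_eq_of_delete ((isLoop_iff ((G.delete e).mem_edgeOf _ hf')).1 h')

end TwoVertices

theorem Edgeless.of_forall_isHalf {G : PinchedRibbonGraph} (h : ∀ f, G.IsHalf f) : G.Edgeless :=
  ⟨fun ⟨_, f, hf, _⟩ => hf (h f)⟩

theorem numHalf_chordDiagram {m : ℕ} {π : Fin (m + 2) → Fin (m + 2)} {tw : Fin (m + 2) → Bool}
    {hπ : ∀ p, π (π p) = p} {hne : ∀ p, π p ≠ p} {htw : ∀ p, tw (π p) = tw p} :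
    (chordDiagram m π tw hπ hne htw).numHalf = 0 ∧
      2 * (chordDiagram m π tw hπ hne htw).numEdges = m + 2 := by
  have h0 : ∀ f, ¬ (chordDiagram m π tw hπ hne htw).IsHalf f := fun f h =>
    hne _ (congrArg Prod.fst h)
  have h1 := (chordDiagram m π tw hπ hne htw).two_mul_numHalf
  have h2 := (chordDiagram m π tw hπ hne htw).four_mul_numEdges
  have h3 : Nat.card (chordDiagram m π tw hπ hne htw).Flag = (m + 2) * 2 :=
    (Nat.card_eq_fintype_card (α := Fin (m + 2) × Bool)).trans (by simp)
  simp only [h0, not_false_eq_true, Set.ofPred_false, Set.ofPred_true, Set.ncard_empty,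
    Set.ncard_univ, h3] at h1 h2
  omega

/-! ### The recipe theorem -/

/-- The hypotheses of the recipe theorem. -/
structure IsRecipe {K : Type*} [CommRing K] (M : Set PinchedRibbonGraph)
    (F : PinchedRibbonGraph → K) (α σ τ : Kˣ) (x u v T : K) : Prop where
  minorClosed : MinorClosed M
  mem : ∀ G : PinchedRibbonGraph, G.numVertices = 2 → G ∈ M
  iso : ∀ G H : PinchedRibbonGraph, Iso G H → F G = F H
  regular : ∀ G ∈ M, ∀ d : G.Edge, G.IsRegular d →
    F G = τ * F (G.delete d) + σ * F (G.contract d)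
  bridge : ∀ G ∈ M, ∀ d : G.Edge, G.IsBridge d → F G = x * F (G.contract d)
  union : ∀ (n : ℕ) (B : Fin n → PinchedRibbonGraph), (∀ i, (B i).IsBouquet) →
    disjointUnion B ∈ M → F (disjointUnion B) = ∏ i, F (B i)
  join : ∀ G H : PinchedRibbonGraph, G.IsBouquet → H.IsBouquet →
    ∀ (a : G.Flag) (b : H.Flag), α * F (G.join H a b) = F G * F H
  edgeless : ∀ E ∈ M, E.Edgeless → F E = (α : K) ^ E.numVertices * T ^ E.numHalf
  crossed : (F positiveChord - α * τ) ^ 2 * u ^ 2 =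
    α * (F crossedChords - 2 * τ * F positiveChord + α * (τ : K) ^ 2)
  negative : (F positiveChord - α * τ) * u * v = F negativeChord - α * τ
  idempotent : v = v ^ 2

namespace IsRecipe

variable {K : Type*} [CommRing K] {M : Set PinchedRibbonGraph} {F : PinchedRibbonGraph → K}
  {α σ τ : Kˣ} {x u v T : K}

/-- The value predicted by the recipe theorem is attained at `G`. -/
def Good (_ : IsRecipe M F α σ τ x u v T) (G : PinchedRibbonGraph) : Prop :=
  F G = phi (α : K) σ τ ((σ⁻¹ : Kˣ) * x) ((α⁻¹ : Kˣ) * (τ⁻¹ : Kˣ) * F positiveChord) u v T G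

theorem mul_inv_mul_inv (y : K) : (α : K) * τ * ((α⁻¹ : Kˣ) * (τ⁻¹ : Kˣ) * y) = y := by
  rw [show (α : K) * τ * ((α⁻¹ : Kˣ) * (τ⁻¹ : Kˣ) * y)
    = (α * (α⁻¹ : Kˣ)) * (τ * (τ⁻¹ : Kˣ)) * y by ring, Units.mul_inv, Units.mul_inv]
  ring

variable (h : IsRecipe M F α σ τ x u v T) {G H B : PinchedRibbonGraph}

include h

theorem good_of_iso (hGH : Iso G H) (hG : h.Good G) : h.Good H := by
  rw [Good, ← h.iso G H hGH, ← phi_iso hGH]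
  exact hG

theorem good_of_not_isLoop (hG : G ∈ M) {d : G.Edge} (hd : ¬ G.IsLoop d)
    (h1 : h.Good (G.delete d)) (h2 : h.Good (G.contract d)) : h.Good G := by
  rw [Good] at *
  by_cases hb : G.IsBridge d
  · rw [h.bridge G hG d hb, h2, phi_of_isBridge hb, Units.mul_inv_cancel_left]
  · rw [h.regular G hG d ⟨hb, hd⟩, h1, h2, phi_of_isRegular ⟨hb, hd⟩]

/-- The recursion read backwards: as σ is a unit, the contraction is determined by the graph and the
deletion. -/
theorem good_contract (hG : G ∈ M) {d : G.Edge} (hd : G.IsRegular d)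
    (h1 : h.Good G) (h2 : h.Good (G.delete d)) : h.Good (G.contract d) := by
  rw [Good] at *
  rw [h.regular G hG d hd, h2, phi_of_isRegular hd] at h1
  exact σ.isUnit.mul_left_cancel (add_left_cancel h1)

theorem good_join (hG : G.IsBouquet) (hH : H.IsBouquet) {a : G.Flag} {b : H.Flag}
    (h1 : h.Good G) (h2 : h.Good H) : h.Good (G.join H a b) := by
  rw [Good] at *
  refine α.isUnit.mul_left_cancel ?_
  rw [h.join G H hG hH, h1, h2, phi_join h.idempotent hG hH]

theorem good_disjointUnion {n : ℕ} {B : Fin n → PinchedRibbonGraph} (hB : ∀ i, (B i).IsBouquet)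
    (hM : disjointUnion B ∈ M) (h1 : ∀ i, h.Good (B i)) : h.Good (disjointUnion B) := by
  rw [Good, h.union n B hB hM, phi_disjointUnion h.idempotent hB]
  exact Finset.prod_congr rfl fun i _ => h1 i

theorem good_of_edgeless (hG : G ∈ M) (hG' : G.Edgeless) : h.Good G := by
  rw [Good, h.edgeless G hG hG', phi_of_edgeless hG']

theorem good_positiveChord : h.Good positiveChord := by
  obtain ⟨h1, h2⟩ : positiveChord.numHalf = 0 ∧ 2 * positiveChord.numEdges = 0 + 2 :=
    numHalf_chordDiagram
  rw [Good, phi_of_isBouquet (show positiveChord.IsBouquet from isBouquet_chordDiagram),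
    brPoly_positiveChord, h1,
    show positiveChord.numEdges = 1 by omega]
  linear_combination -mul_inv_mul_inv (α := α) (τ := τ) (F positiveChord)

theorem good_negativeChord : h.Good negativeChord := by
  obtain ⟨h1, h2⟩ : negativeChord.numHalf = 0 ∧ 2 * negativeChord.numEdges = 0 + 2 :=
    numHalf_chordDiagram
  rw [Good, phi_of_isBouquet (show negativeChord.IsBouquet from isBouquet_chordDiagram),
    brPoly_negativeChord, h1,
    show negativeChord.numEdges = 1 by omega]
  linear_combination -u * v * mul_inv_mul_inv (α := α) (τ := τ) (F positiveChord) - h.negative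

/-- With q = ατY this is α times the required equation τ²α(1 + 2(Y-1) + (Y-1)²u²) = s, which is how
the first part of condition 4 arises. -/
theorem good_crossedChords : h.Good crossedChords := by
  obtain ⟨h1, h2⟩ : crossedChords.numHalf = 0 ∧ 2 * crossedChords.numEdges = 2 + 2 :=
    numHalf_chordDiagram
  rw [Good, phi_of_isBouquet (show crossedChords.IsBouquet from isBouquet_chordDiagram),
    brPoly_crossedChords, h1,
    show crossedChords.numEdges = 2 by omega]
  have h3 := h.crossed
  have h4 := mul_inv_mul_inv (α := α) (τ := τ) (F positiveChord)
  generalize ((α⁻¹ : Kˣ) : K) * (τ⁻¹ : Kˣ) * F positiveChord = Y at *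
  rw [← h4] at h3
  refine α.isUnit.mul_left_cancel ?_
  linear_combination -h3

/-- Attach a pendant edge, use that two-vertex graphs are in the class, and contract. -/
theorem mem_of_isBouquet (hB : B.IsBouquet) (f : B.Flag) : B ∈ M := by
  have h1 := B.not_isLoop_newEdge_leaf f
  refine h.minorClosed.iso _ _ (h.minorClosed.contract _ (h.mem (B.leaf f) ?_) newEdge h1)
    (B.iso_contract_leaf f).symm
  have h2 := numVertices_contract h1
  rw [← ((B.iso_contract_leaf f).sameData (0 : ℤ) 0 0 0).numVertices, hB] at h2
  exact h2.symm

/-- The bare vertex has no arc for a pendant edge. It lies in the class as the untwisted loop with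
its edge deleted. -/
theorem good_of_isEmpty (hB : B.IsBouquet) (hf : IsEmpty B.Flag) : h.Good B := by
  refine h.good_of_edgeless ?_ (Edgeless.of_forall_isHalf fun f => hf.elim f)
  let p : positiveChord.Flag := ((0, false) : Fin 2 × Bool)
  have hp : ¬ positiveChord.IsHalf p := fun h => by cases congrArg Prod.fst h
  have h1 := h.minorClosed.delete _ (h.mem_of_isBouquet isBouquet_chordDiagram p)
    (edgeOf _ p hp)
  refine h.minorClosed.iso _ _ h1 ?_
  have h2 := card_flag_delete (d := edgeOf _ p hp)
  have h3 : Nat.card positiveChord.Flag = 4 :=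
    (Nat.card_eq_fintype_card (α := Fin 2 × Bool)).trans (by simp)
  have h4 : Nat.card (positiveChord.delete (edgeOf _ p hp)).Flag = 0 := by omega
  have h5 : IsEmpty (positiveChord.delete (edgeOf _ p hp)).Flag :=
    (Nat.card_eq_zero.1 h4).resolve_right fun h => (not_finite_iff_infinite.2 h) inferInstance
  have key : ∀ G : PinchedRibbonGraph, G.numVertices = 1 → IsEmpty G.Flag →
      Nat.card G.Bare = 1 := by
    intro G hG hG'
    rw [numVertices_eq] at hG
    have : Nat.card (Quot fun f g : G.Flag => g = G.corner f ∨ g = G.side f) = 0 :=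
      Nat.card_eq_zero.2 (Or.inl ⟨by rintro ⟨f⟩; exact hG'.elim f⟩)
    omega
  refine ⟨Finite.card_eq.1 ((key _ ?_ h5).trans (key _ hB hf).symm),
    @Equiv.equivOfIsEmpty _ _ h5 hf, fun f => h5.elim f⟩
  rw [numVertices_delete]
  exact isBouquet_chordDiagram

/-! The inductive step: all graphs with fewer than `N` flags satisfy the theorem. -/

variable {N : ℕ} (ih : ∀ G : PinchedRibbonGraph, Nat.card G.Flag < N →
  (G ∈ M ∨ G.IsBouquet) → h.Good G)

include ih

/-- The bound is `≤ N` and not `< N`, since the graph itself loses four flags in each reduction. The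
slide argument depends on the equality case. -/
theorem good_of_exists_not_isLoop (hG : G ∈ M) (hN : Nat.card G.Flag ≤ N)
    (hd : ∃ d : G.Edge, ¬ G.IsLoop d) : h.Good G := by
  obtain ⟨d, hd⟩ := hd
  have h1 := card_flag_delete (d := d)
  have h2 := card_flag_contract (d := d)
  exact h.good_of_not_isLoop hG hd
    (ih _ (by omega) (Or.inl (h.minorClosed.delete G hG d)))
    (ih _ (by omega) (Or.inl (h.minorClosed.contract G hG d hd)))

/-- Both join factors miss a flag of the bouquet, so the induction hypothesis covers them. -/
theorem good_of_pocket (hB : B.IsBouquet) (hN : Nat.card B.Flag ≤ N) {V : Set B.Flag}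
    {a b : B.Flag} (hV : Pocket B V a b) (ht : ∀ f ∈ V, B.strand f ∈ V) : h.Good B := by
  have ht' : ∀ f ∈ Vᶜ, B.strand f ∈ Vᶜ := fun f hf hf' => hf (by
    simpa only [B.strand_strand] using ht _ hf')
  have hiso := hV.iso_join hB ht ht'
  obtain ⟨h1, h2⟩ := isBouquet_of_join
    (show IsBouquet _ from (hiso.sameData (0 : ℤ) 0 0 0).numVertices.trans hB)
  refine h.good_of_iso hiso (h.good_join h1 h2 (ih _ ?_ (Or.inr h1)) (ih _ ?_ (Or.inr h2)))
  · exact (Finite.card_subtype_lt hV.corner_left).trans_le hN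
  · exact (Finite.card_subtype_lt (p := (· ∈ Vᶜ)) (x := a) fun h => h hV.mem_left).trans_le hN

theorem good_of_isHalf (hB : B.IsBouquet) (hN : Nat.card B.Flag ≤ N) {f : B.Flag}
    (hf : B.IsHalf f) : h.Good B := by
  have h1 := B.corner_corner
  have h2 := B.side_side
  have h3 := B.corner_ne
  have h4 := B.side_ne
  by_cases hc : B.corner f = B.side f
  · refine h.good_of_edgeless (h.mem_of_isBouquet hB f) (Edgeless.of_forall_isHalf fun g => ?_)
    have : g ∈ ({f, B.side f} : Set B.Flag) := by
      refine PinchedRibbonGraph.mem_of_isBouquet hB ?_ (Or.inl rfl) g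
      rintro g (rfl | rfl)
      · exact ⟨Or.inr hc, Or.inr rfl⟩
      · exact ⟨Or.inl (by rw [← hc, h1]), Or.inl (h2 _)⟩
    rcases this with rfl | rfl
    · exact hf
    · exact B.isHalf_side.2 hf
  · refine h.good_of_pocket ih hB hN (V := {f, B.side f}) (a := f) (b := B.side f)
      ⟨?_, Or.inl rfl, Or.inr rfl, (h4 f).symm, ?_, ?_, ?_⟩ ?_
    · rintro g (rfl | rfl)
      · exact Or.inr rfl
      · exact Or.inl (h2 _)
    · rintro (h' | h')
      exacts [h3 _ h', hc h']
    · rintro (h' | h')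
      · exact hc ((congrArg B.corner h').symm.trans (h1 _))
      · exact h3 _ h'
    · rintro g (rfl | rfl) h5 h6
      exacts [(h5 rfl).elim, (h6 rfl).elim]
    · rintro g (rfl | rfl)
      · exact Or.inr hf
      · refine Or.inl ?_
        rw [B.strand_side, show B.strand f = B.side f from hf, h2]

/-- A ribbon with neighbouring ends is either the whole bouquet, that is one of the two one-chord
diagrams, or a pocket. -/
theorem good_of_corner_mem_quad (hB : B.IsBouquet) (hN : Nat.card B.Flag ≤ N) {p : B.Flag}
    (hp : ¬ B.IsHalf p) (hp' : B.corner p ∈ B.quad p) : h.Good B := by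
  have h1 := B.corner_corner
  have h2 := B.side_side
  have h3 := B.corner_ne
  have h4 := B.side_ne
  have h5 := B.strand_strand
  have h6 := B.strand_side
  have h7 := B.strand_ne
  rw [IsHalf] at hp
  rcases hp' with hc | hc | hc | hc
  · exact (h3 _ hc).elim
  -- Here one ribbon end would fill the whole boundary circle, leaving no room for the other end.
  · have : B.strand p ∈ ({p, B.side p} : Set B.Flag) := by
      refine PinchedRibbonGraph.mem_of_isBouquet hB ?_ (Or.inl rfl) _
      rintro g (rfl | rfl)
      · exact ⟨Or.inr hc, Or.inr rfl⟩
      · exact ⟨Or.inl (by rw [← hc, h1]), Or.inl (h2 _)⟩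
    rcases this with h' | h'
    exacts [(h7 _ h').elim, (hp h').elim]
  · by_cases hc' : B.corner (B.side p) = B.side (B.strand p)
    · exact h.good_of_iso (iso_positiveChord hB hp hc hc') h.good_positiveChord
    · refine h.good_of_pocket ih hB hN (V := B.quad p) (a := B.side p) (b := B.side (B.strand p))
        ⟨(isEdgeSet_quad hp).side, ?_, ?_, ?_, ?_, ?_, ?_⟩ (isEdgeSet_quad hp).strand
      all_goals try simp only [mem_quad]
      all_goals grind
  · by_cases hc' : B.corner (B.side p) = B.strand p
    · exact h.good_of_iso (iso_negativeChord hB hp hc hc') h.good_negativeChord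
    · refine h.good_of_pocket ih hB hN (V := B.quad p) (a := B.side p) (b := B.strand p)
        ⟨(isEdgeSet_quad hp).side, ?_, ?_, ?_, ?_, ?_, ?_⟩ (isEdgeSet_quad hp).strand
      all_goals try simp only [mem_quad]
      all_goals grind

theorem good_of_crossed (hB : B.IsBouquet) (hN : Nat.card B.Flag ≤ N) {p w : B.Flag}
    (hp : ¬ B.IsHalf p) (hw : ¬ B.IsHalf w) (hwp : w ∉ B.quad p) (hc1 : B.corner p = w)
    (hc2 : B.corner (B.side w) = B.strand p) (hc3 : B.corner (B.strand w) = B.side p) :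
    h.Good B := by
  by_cases hc4 : B.corner (B.side (B.strand p)) = B.side (B.strand w)
  · exact h.good_of_iso (iso_crossedChords hB hp hw hwp hc1 hc2 hc3 hc4) h.good_crossedChords
  have h1 := B.corner_corner
  have h2 := B.side_side
  have h3 := B.corner_ne
  have h4 := B.side_ne
  have h5 := B.strand_strand
  have h6 := B.strand_side
  have h7 := B.strand_ne
  have hV := (isEdgeSet_quad hp).union (isEdgeSet_quad hw)
  rw [IsHalf] at hp hw
  rw [mem_quad] at hwp
  refine h.good_of_pocket ih hB hN (V := B.quad p ∪ B.quad w) (a := B.side (B.strand p))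
    (b := B.side (B.strand w)) ⟨hV.side, ?_, ?_, ?_, ?_, ?_, ?_⟩ hV.strand
  all_goals try simp only [Set.mem_union, mem_quad]
  all_goals grind

/-- The slide argument. Knowing `G.contract d` gives `G`, by deletion and contraction at `d`;
knowing `G` gives `G.contract e`, which is `B`, by the reversed recursion at `e`. The slid bouquet
has `N` flags too, so the caller must treat it by other means than the induction hypothesis. -/
theorem good_of_slidesTo (hB : B.IsBouquet) (hN : Nat.card B.Flag = N)
    {P : PinchedRibbonGraph → Prop} (hP : SlidesTo B P)
    (hgood : ∀ G : PinchedRibbonGraph, G.IsBouquet → Nat.card G.Flag = N →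
      ((∀ f, ¬ B.IsHalf f) → ∀ f, ¬ G.IsHalf f) → P G → h.Good G) : h.Good B := by
  obtain ⟨V, a, b, hV, f, hf, hfV, hPG⟩ := hP
  set G := B.split a b hV.ne hV.corner_ne_right with hGdef
  have hve : G.vertexOf (new (true, false)) ≠ G.vertexOf (G.strand (new (true, false))) :=
    fun h' => by cases (hV.mem_iff_of_vertexOf_eq h').1 rfl
  have hvd : G.vertexOf (old f) ≠ G.vertexOf (G.strand (old f)) :=
    fun h' => hfV (hV.mem_iff_of_vertexOf_eq h')
  let e : G.Edge := newEdge
  let d : G.Edge := oldEdge f hf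
  have he : ¬ G.IsLoop e := (isLoop_iff (new_mem_newEdge (true, false))).not.2 hve
  have hd : ¬ G.IsLoop d := (isLoop_iff (old_mem_oldEdge.2 (Or.inl rfl))).not.2 hvd
  have hiso : Iso B (G.contract e) := iso_contract_split
  have h1 := numVertices_contract he
  rw [← (hiso.sameData (0 : ℤ) 0 0 0).numVertices, hB] at h1
  have h2 := numVertices_contract hd
  have h3 : Nat.card G.Flag = _ := card_flag_addEdge
  have h4 := card_flag_delete (d := e)
  have h5 := card_flag_delete (d := d)
  have h6 := card_flag_contract (d := d)
  -- Each of `d` and `e` survives as a non-loop when the other is deleted. The deletions have `N`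
  -- flags and are handled by one more reduction.
  have h7 : ∃ d' : (G.delete e).Edge, ¬ (G.delete e).IsLoop d' :=
    exists_not_isLoop_delete (isHalf_old.not.2 hf) (old_notMem_newEdge f) hvd
  have h8 : ∃ e' : (G.delete d).Edge, ¬ (G.delete d).IsLoop e' :=
    exists_not_isLoop_delete (not_isHalf_new _) (new_notMem_oldEdge _) hve
  have hGM : G ∈ M := h.mem G h1.symm
  have h9 : h.Good (G.contract d) :=
    hgood _ (show _ = 1 by omega) (by omega) (fun hh => isHalf_contract_split hh) hPG
  have h10 : h.Good (G.delete e) := h.good_of_exists_not_isLoop ih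
    (h.minorClosed.delete G hGM e) (by omega) h7
  have h11 : h.Good (G.delete d) := h.good_of_exists_not_isLoop ih
    (h.minorClosed.delete G hGM d) (by omega) h8
  obtain ⟨d', hd'⟩ := h7
  exact h.good_of_iso hiso.symm (h.good_contract hGM (isRegular_of_delete h1.symm he hd')
    (h.good_of_not_isLoop hGM hd h11 h9) h10)

theorem good_of_twisted (hB : B.IsBouquet) (hN : Nat.card B.Flag = N) {ε : B.Flag → Bool}
    (hε : ∀ f, ε (B.corner f) ≠ ε f ∧ ε (B.side f) ≠ ε f) {f : B.Flag} (hf : ¬ B.IsHalf f)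
    (hf' : ε (B.strand f) = ε f) : h.Good B := by
  refine h.good_of_slidesTo ih hB hN (slidesTo_of_twisted hB hε hf hf') ?_
  rintro G hG hGN - ⟨p, hp, hp'⟩
  exact h.good_of_corner_mem_quad ih hG hGN.le hp hp'

theorem good_of_adjacent (hB : B.IsBouquet) (hN : Nat.card B.Flag = N) (hh : ∀ f, ¬ B.IsHalf f)
    {f p : B.Flag} (hp : p ∉ B.quad f) (h1 : B.corner f = p)
    (h2 : B.corner (B.side p) = B.strand f) : h.Good B := by
  obtain ⟨ε, hε⟩ := exists_two_colouring B.corner_corner B.corner_ne B.side_side B.side_ne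
  by_cases ht : ∃ f, ε (B.strand f) = ε f
  · obtain ⟨g, hg⟩ := ht
    exact h.good_of_twisted ih hB hN hε (hh g) hg
  · refine h.good_of_slidesTo ih hB hN
      (slidesTo_of_adjacent hB hh hε (not_exists.1 ht) hp h1 h2) ?_
    rintro G hG hGN hGh ⟨p, w, hw, h3, h4, h5⟩
    exact h.good_of_crossed ih hG hGN.le (hGh hh p) (hGh hh w) hw h3 h4 h5

/-- The cases in order of preference: no flags, a half-ribbon, a ribbon with neighbouring ends, a
twisted ribbon, and finally two slides towards interlaced ribbons. -/
theorem good_of_isBouquet (hB : B.IsBouquet) (hN : Nat.card B.Flag = N) : h.Good B := by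
  rcases isEmpty_or_nonempty B.Flag with hf | ⟨⟨f₀⟩⟩
  · exact h.good_of_isEmpty hB hf
  by_cases hh : ∃ f, B.IsHalf f
  · obtain ⟨f, hf⟩ := hh
    exact h.good_of_isHalf ih hB hN.le hf
  replace hh := not_exists.1 hh
  by_cases hi : ∃ f, B.corner f ∈ B.quad f
  · obtain ⟨f, hf⟩ := hi
    exact h.good_of_corner_mem_quad ih hB hN.le (hh f) hf
  obtain ⟨ε, hε⟩ := exists_two_colouring B.corner_corner B.corner_ne B.side_side B.side_ne
  by_cases ht : ∃ f, ε (B.strand f) = ε f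
  · obtain ⟨g, hg⟩ := ht
    exact h.good_of_twisted ih hB hN hε (hh g) hg
  · refine h.good_of_slidesTo ih hB hN
      (slidesTo_of_untwisted hB hh hε (not_exists.1 ht) (not_exists.1 hi) f₀) ?_
    rintro G hG hGN hGh ⟨f, p, hp, h1, h2⟩
    exact h.good_of_adjacent ih hG hGN (hGh hh) hp h1 h2

omit ih

/-- Bouquets are admitted without a membership hypothesis because those arising as join factors or
components are not given as members of the class. -/
theorem good_of_card (N : ℕ) : ∀ G : PinchedRibbonGraph, Nat.card G.Flag = N →
    (G ∈ M ∨ G.IsBouquet) → h.Good G := by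
  induction N using Nat.strong_induction_on with
  | _ N ih =>
    replace ih : ∀ G : PinchedRibbonGraph, Nat.card G.Flag < N → (G ∈ M ∨ G.IsBouquet) →
      h.Good G := fun G hG => ih _ hG G rfl
    rintro G hN (hG | hG)
    · by_cases hd : ∃ d : G.Edge, ¬ G.IsLoop d
      · exact h.good_of_exists_not_isLoop ih hG hN.le hd
      · obtain ⟨n, B, hB, hc, hiso⟩ := exists_iso_disjointUnion
          fun d => not_not.1 (not_exists.1 hd d)
        refine h.good_of_iso hiso (h.good_disjointUnion hB
          (h.minorClosed.iso _ _ hG hiso.symm) fun i => ?_)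
        rcases (hc i).lt_or_eq with h1 | h1
        · exact ih _ (h1.trans_eq hN) (Or.inr (hB i))
        · exact h.good_of_isBouquet ih (hB i) (h1.trans hN)
    · exact h.good_of_isBouquet ih hG hN

theorem good_of_mem (hG : G ∈ M) : h.Good G := h.good_of_card _ G rfl (Or.inl hG)

end IsRecipe

end PinchedRibbonGraph

theorem mainTheorem9 {K : Type*} [CommRing K]
    (M : Set PinchedRibbonGraph)
    (hM : PinchedRibbonGraph.MinorClosed M)
    (hM₂ : ∀ G : PinchedRibbonGraph, G.numVertices = 2 → G ∈ M)
    (F : PinchedRibbonGraph → K)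
    (hFiso : ∀ G H : PinchedRibbonGraph, PinchedRibbonGraph.Iso G H → F G = F H)
    (α σ τ : Kˣ) (x u v T q r s : K)
    (hs : s = F PinchedRibbonGraph.crossedChords)
    (hq : q = F PinchedRibbonGraph.positiveChord)
    (hr : r = F PinchedRibbonGraph.negativeChord)
    (hregular : ∀ G ∈ M, ∀ d : G.Edge, G.IsRegular d →
      F G = τ * F (G.delete d) + σ * F (G.contract d))
    (hbridge : ∀ G ∈ M, ∀ d : G.Edge, G.IsBridge d → F G = x * F (G.contract d))
    (hunion : ∀ (n : ℕ) (B : Fin n → PinchedRibbonGraph), (∀ i, (B i).IsBouquet) →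
      PinchedRibbonGraph.disjointUnion B ∈ M →
      F (PinchedRibbonGraph.disjointUnion B) = ∏ i, F (B i))
    (hjoin : ∀ G H : PinchedRibbonGraph, G.IsBouquet → H.IsBouquet →
      ∀ (a : G.Flag) (b : H.Flag), α * F (G.join H a b) = F G * F H)
    (hedgeless : ∀ E ∈ M, E.Edgeless → F E = (α : K) ^ E.numVertices * T ^ E.numHalf)
    (hu : (q - α * τ) ^ 2 * u ^ 2 = α * (s - 2 * τ * q + α * (τ : K) ^ 2))
    (huv : (q - α * τ) * u * v = r - α * τ)
    (hv : v = v ^ 2) :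
    ∀ G ∈ M,
      ((σ⁻¹ : Kˣ) : K) ^ G.rank * ((τ⁻¹ : Kˣ) : K) ^ G.nullity * F G
        = T ^ G.numHalf * (α : K) ^ G.numComponents *
            G.brPoly ((σ⁻¹ : Kˣ) * x) ((α⁻¹ : Kˣ) * (τ⁻¹ : Kˣ) * q) u v ∧
      ∀ t : Kˣ,
        (α : K) ^ G.numComponents *
            G.brPoly ((σ⁻¹ : Kˣ) * x) ((α⁻¹ : Kˣ) * (τ⁻¹ : Kˣ) * q) u v
          = ((t⁻¹ : Kˣ) : K) ^ (G.numHalf + 2 * G.nullity) * (α : K) ^ G.numComponents *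
              G.brPolyPinched ((σ⁻¹ : Kˣ) * ((x - σ) * ((t⁻¹ : Kˣ) : K) ^ 2 + σ))
                ((t : K) ^ 2 * ((α⁻¹ : Kˣ) * (τ⁻¹ : Kˣ) * q) - (t : K) ^ 2 + 1) u v t := by
  have h : PinchedRibbonGraph.IsRecipe M F α σ τ x u v T :=
    ⟨hM, hM₂, hFiso, hregular, hbridge, hunion, hjoin, hedgeless, by rw [← hs, ← hq, hu],
      by rw [← hq, ← hr, huv], hv⟩
  intro G hG
  refine ⟨?_, fun t => ?_⟩
  · have hF : F G = _ := h.good_of_mem hG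
    rw [hF, PinchedRibbonGraph.phi, ← hq]
    have h1 : ∀ (y : Kˣ) (n : ℕ), ((y⁻¹ : Kˣ) : K) ^ n * (y : K) ^ n = 1 := fun y n => by
      rw [← mul_pow, Units.inv_mul, one_pow]
    linear_combination (T ^ G.numHalf * (α : K) ^ G.numComponents *
      G.brPoly ((σ⁻¹ : Kˣ) * x) ((α⁻¹ : Kˣ) * (τ⁻¹ : Kˣ) * q) u v) *
      (h1 σ G.rank * (((τ⁻¹ : Kˣ) : K) ^ G.nullity * (τ : K) ^ G.nullity) + h1 τ G.nullity)
  · rw [PinchedRibbonGraph.brPoly_eq_brPolyPinched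
      ((σ⁻¹ : Kˣ) * ((x - σ) * ((t⁻¹ : Kˣ) : K) ^ 2 + σ)) _
      ((t : K) ^ 2 * ((α⁻¹ : Kˣ) * (τ⁻¹ : Kˣ) * q) - (t : K) ^ 2 + 1) _ _ _ t ?_ (by ring)]
    · ring
    -- The substituted first variable satisfies X' - 1 = (X - 1)t⁻² because σ⁻¹σ = 1.
    · linear_combination (1 - ((t⁻¹ : Kˣ) : K) ^ 2) * σ.inv_mul
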